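/- **Data and hypotheses.** Let $\mathbb A$ be a $C^*$-algebra and $G$ a second countable locally compact Hausdorff group with left Haar measure $\mu$ and modular function $\Delta$ (normalised by $\int f(sr)\,d\mu(s)=\Delta(r)^{-1}\int f\,d\mu$). Let $\alpha:G\to\mathrm{Aut}(\mathbb A)$ be an action by $*$-automorphisms such that $r\mapsto\alpha_r(a)$ is norm continuous for every $a\in\mathbb A$; $\alpha_r$ also denotes its extension to the multiplier algebra $M(\mathbb A)$. On $C_c(G,\mathbb A)$ put $$(f\star g)(r)=\int_G f(s)\,\alpha_s(g(s^{-1}r))\,d\mu(s),\qquad f^*(r)=\Delta(r)^{-1}\alpha_r(f(r^{-1})^*).$$ Let $H$ be a separable Hilbert space, $\rho$ a faithful nondegenerate representation of $\mathbb A$ on $H$ (extended to $M(\mathbb A)$) and $U$ a strongly continuous unitary representation of $G$ on $H$ with $U_r\rho(a)U_r^*=\rho(\alpha_r(a))$. Let $\hat\rho$ be the regular representation of $C_c(G,\mathbb A)$ on $\hat H=L^2(G,\mu;H)$, $$(\hat\rho(f)\xi)(r)=\int_G\rho(\alpha_{r^{-1}}(f(s)))\,\xi(s^{-1}r)\,d\mu(s),$$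 and let the reduced crossed product $\mathbb B=G\ltimes_{\alpha,\mathrm{red}}\mathbb A$ be the norm closure of $\hat\rho(C_c(G,\mathbb A))$. Assume: 1. $A\subset\mathbb A$ is a dense $*$-subalgebra with $\alpha_r(A)=A$ for all $r$, and $(A,H,D)$ is a spectral triple: $D$ is selfadjoint and, for all $a\in A$, $[D,\rho(a)]$ is densely defined and bounded and $\rho(a)(1+D^2)^{-1/2}$ is compact. 2. $\mathcal A\subset C_c(G,\mathbb A)$ is a linear subspace of functions with values in $A$ which is closed under $\star$ and ${}^*$ and dense in $C_c(G,\mathbb A)$ for the norm $\int\|f(r)\|\,d\mu(r)$ (so density for the inductive limit topology suffices). 3. $z:G\to B(H)$ has boundedly invertible values and, for every $r$, $U_rDU_r^*$ and $z(r)^{*-1}Dz(r)^{-1}$ agree on a common core. $p$ is a strictly continuous positive $\alpha$-one-cocycle, $p(rs)=p(r)\,\alpha_r(p(s))$, with values in the invertible multipliers $m$ of $\mathbb A$ such that $m^{\pm1}A\subset A$ and $m$ commutes with $A$; $\rho(p(r))=z(r)z(r)^*$; and $r\mapsto p(r)^{\pm1}f(r)$ is in $\mathcal A$ for all $f\in\mathcal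 A$. 4. $\eta,\omega\in\mathbb R$, $\omega\ne0$. The space $\hat Y$ of all $\xi\in\hat H$ with $\xi(r)\in\mathrm{Dom}\,D$ for a.e. $r$ and $r\mapsto(D\pm i\omega\rho(p(r)))\xi(r)$ in $L^2(G;H)$ for both signs is dense in $\hat H$, and there is a dense subspace $Y_{\mathcal A}\subset\hat Y$ of $\hat H$ with $\hat\rho(f)Y_{\mathcal A}\subset\hat Y$ for all $f\in\mathcal A$. 5. For every $f\in\mathcal A$ there is a constant $M$ such that, for every $r$ in the support of $f$, $[D,\rho(f(r))z(r)]$ is defined on a core of $D$ and $\|[D,\rho(f(r))z(r)]h\|\le M\|z(r)h\|$ for $h$ in this core. **Construction.** Put $T_p(r)=\eta+\omega\rho(p(r))$, $V_r=U_r\otimes1$ on $H\otimes\mathbb C^2$, and let $\gamma^1,\gamma^2$ be the first two Pauli matrices. On $\mathcal H=L^2(G,\mu;H\otimes\mathbb C^2)$ let $\pi=\hat\rho\otimes1$ and define, on the maximal domains of those $\xi$ for which the right side makes sense for a.e. $r$ and is square integrable, $$(\mathcal D\xi)(r)=V_r^*\big(D\otimes\gamma^1+T_p(r)\otimes\gamma^2\big)V_r\,\xi(r),\qquad(\Theta\xi)(r)=V_r^*\big(\rho(p(r))\otimes1\big)V_r\,\xi(r).$$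 That is, $\mathcal D=\hat D\otimes\gamma^1+\mathcal T\otimes\gamma^2$ with $(\hat D\xi)(r)=U_r^*DU_r\,\xi(r)$ and $(\mathcal T\xi)(r)=U_r^*T_p(r)U_r\,\xi(r)$ on $\hat H$. **Theorem.** $(\mathcal A,\mathcal H,\mathcal D,\beta)$ with $\beta(f)(r)=p(r)f(r)$ is a modular-type $\beta$-twisted spectral triple on $\mathbb B$, up to the resolvent condition, which holds under a convergence condition. Precisely: - $\hat\rho(\mathcal A)$ is norm dense in $\mathbb B$, $\mathcal H$ is separable, and $\pi$ is a faithful nondegenerate $*$-representation of $(\mathcal A,\star,{}^*)$ on $\mathcal H$. - $\beta$ is a linear bijection of $\mathcal A$ with $\beta(f\star g)=\beta(f)\star\beta(g)$ and $\beta(f^*)=(\beta^{-1}(f))^*$. - $\mathcal D$ is selfadjoint and, for every $f\in\mathcal A$, $\pi(f)\,\mathrm{Dom}\,\mathcal D\subset\mathrm{Dom}\,\mathcal D$ and $\mathcal D\pi(f)-\pi(\beta(f))\mathcal D$ extends to a bounded operator. - $\Theta$ is selfadjoint, positive and injective with dense range, and $\pi(\beta(f))=\Theta\,\pi(f)\,\Theta^{-1}$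 on $\mathrm{Dom}\,\Theta^{-1}$ for all $f\in\mathcal A$. - Suppose that the commutator $[\hat D,\mathcal T]$ is defined on a core of $\hat D$ and extends to a bounded operator on $\hat H$. Then, for every $\epsilon>0$ with $$\int_G\Delta(r)^{-1}\,\|\rho(p(r))\|^2\,\big\|(1+T_p(r)^2)^{-1}\big\|^{1+\epsilon}\,d\mu(r)<\infty,$$ the operator $\Theta\,\pi(f)\,(1+\mathcal D^2)^{-(1+\epsilon)/2}$ is everywhere defined and compact for every $f\in\mathcal A$. -/

import Mathlib

open MeasureTheory Filter Topology
open scoped Pointwise CStarAlgebra CompactlySupported ENNReal TensorProduct MultiplierAlgebra InnerProductSpace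

set_option linter.unusedSectionVars false

noncomputable section

namespace ModularTriple

/-! ### Modular function -/

section Modular
variable {G : Type*} [Group G] [TopologicalSpace G] [IsTopologicalGroup G] [LocallyCompactSpace G]

/-- The modular function `Δ` of `G`, normalised by `∫ f (s * r) dμ(s) = Δ(r)⁻¹ ∫ f dμ` for a left
Haar measure `μ` (Mathlib's `modularCharacter` is its inverse). -/
def modularFun (r : G) : ℝ := ((Measure.modularCharacter r : NNReal) : ℝ)⁻¹

theorem integral_mul_right_eq [MeasurableSpace G] [BorelSpace G] (μ : Measure G)
    [μ.IsHaarMeasure] {f : G → ℝ} (hf : Continuous f) (hc : HasCompactSupport f) (r : G) :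
    ∫ s, f (s * r) ∂μ = (modularFun r)⁻¹ * ∫ s, f s ∂μ := by
  have h := Measure.integral_isMulLeftInvariant_eq_smul_of_hasCompactSupport
    (μ' := Measure.map (· * r) μ) (μ := μ) hf hc
  rw [integral_map (by fun_prop) hf.aestronglyMeasurable,
    ← Measure.modularCharacterFun_eq_haarScalarFactor] at h
  rw [h, modularFun, inv_inv, integral_smul_nnreal_measure]
  rfl

theorem modularFun_pos (r : G) : 0 < modularFun r :=
  inv_pos.2 (NNReal.coe_pos.2 (Measure.modularCharacterFun_pos r))

theorem continuous_modularFun : Continuous (modularFun : G → ℝ) := by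
  borelize G
  let μ : Measure G := Measure.haar
  obtain ⟨⟨f, hf⟩, hc, h0, h1⟩ :
    ∃ f : C(G, ℝ), HasCompactSupport f ∧ 0 ≤ f ∧ f 1 ≠ 0 := exists_continuous_nonneg_pos 1
  have hpos : 0 < ∫ s, f s ∂μ := hf.integral_pos_of_hasCompactSupport_nonneg_nonzero hc h0 h1
  have key : Continuous fun r : G => ∫ s, f (s * r) ∂μ := by
    rw [continuous_iff_continuousAt]
    intro r
    obtain ⟨K, hK, hKr⟩ := exists_compact_mem_nhds r
    refine (continuousOn_integral_of_compact_support (k := tsupport f * K⁻¹)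
      (IsCompact.mul hc hK.inv) (by fun_prop) ?_).continuousAt hKr
    intro x s hx hs
    by_contra h
    refine hs ⟨s * x, subset_tsupport _ h, x⁻¹, Set.inv_mem_inv.2 hx, by simp⟩
  have h2 : (modularFun : G → ℝ) = fun r => ((∫ s, f (s * r) ∂μ) / ∫ s, f s ∂μ)⁻¹ := by
    funext r
    rw [integral_mul_right_eq μ hf hc, mul_div_assoc, div_self hpos.ne', mul_one, inv_inv]
  rw [h2]
  refine (key.div_const _).inv₀ fun r => ?_
  rw [integral_mul_right_eq μ hf hc]
  exact (div_pos (mul_pos (inv_pos.2 (modularFun_pos r)) hpos) hpos).ne'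

end Modular

/-! ### Dynamical systems and the `*`-algebra `C_c(G, 𝔸)` -/

/-- A `C*`-dynamical system: an action of `G` on `𝔸` by `*`-automorphisms such that
`r ↦ α_r(a)` is norm continuous for every `a`. -/
structure CStarDynamics (G 𝔸 : Type*) [Group G] [TopologicalSpace G] [NonUnitalCStarAlgebra 𝔸] where
  act : G →* (𝔸 ≃⋆ₐ[ℂ] 𝔸)
  continuous_act : ∀ a : 𝔸, Continuous fun r => act r a

section Dynamics
variable {G 𝔸 : Type*} [Group G] [TopologicalSpace G] [NonUnitalCStarAlgebra 𝔸]

theorem CStarDynamics.continuous_act_apply (𝓢 : CStarDynamics G 𝔸) {X : Type*} [TopologicalSpace X]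
    {u : X → G} {v : X → 𝔸} (hu : Continuous u) (hv : Continuous v) :
    Continuous fun x => 𝓢.act (u x) (v x) := by
  rw [continuous_iff_continuousAt]
  intro x
  have h1 : Tendsto (fun y => 𝓢.act (u y) (v y - v x)) (𝓝 x) (𝓝 0) := by
    rw [tendsto_zero_iff_norm_tendsto_zero]
    have : (fun y => ‖𝓢.act (u y) (v y - v x)‖) = fun y => ‖v y - v x‖ := by
      funext y; exact StarAlgEquiv.norm_map (𝓢.act (u y)) _
    rw [this]
    have := (hv.sub (continuous_const (y := v x))).norm.tendsto x
    simpa using this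
  have h2 : Tendsto (fun y => 𝓢.act (u y) (v x)) (𝓝 x) (𝓝 (𝓢.act (u x) (v x))) :=
    ((𝓢.continuous_act (v x)).comp hu).tendsto x
  have h3 := h1.add h2
  simp only [map_sub, sub_add_cancel, zero_add] at h3
  exact h3

variable [IsTopologicalGroup G] [LocallyCompactSpace G]

/-- The twisted convolution `(f ⋆ g)(r) = ∫ f(s) α_s(g(s⁻¹ r)) dμ(s)` on `C_c(G, 𝔸)`. -/
def conv [MeasurableSpace G] [BorelSpace G] (μ : Measure G) [IsFiniteMeasureOnCompacts μ]
    (𝓢 : CStarDynamics G 𝔸) (f g : C_c(G, 𝔸)) : C_c(G, 𝔸) where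
  toFun r := ∫ s, f s * 𝓢.act s (g (s⁻¹ * r)) ∂μ
  continuous_toFun := by
    rw [← continuousOn_univ]
    refine continuousOn_integral_of_compact_support (k := tsupport f) f.hasCompactSupport ?_ ?_
    · refine Continuous.continuousOn ?_
      simp only [Function.uncurry_def]
      exact (f.continuous.comp continuous_snd).mul (𝓢.continuous_act_apply continuous_snd
        (g.continuous.comp (by fun_prop)))
    · intro r s _ hs
      simp [image_eq_zero_of_notMem_tsupport hs]
  hasCompactSupport' := by
    refine HasCompactSupport.intro' (K := closure (tsupport f * tsupport g))
      (f.hasCompactSupport.mul g.hasCompactSupport).closure isClosed_closure fun r hr => ?_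
    refine integral_eq_zero_of_ae (Eventually.of_forall fun s => ?_)
    by_cases hs : s ∈ tsupport f
    · have : s⁻¹ * r ∉ tsupport g := fun h =>
        hr (subset_closure ⟨s, hs, s⁻¹ * r, h, by simp⟩)
      simp [image_eq_zero_of_notMem_tsupport this]
    · simp [image_eq_zero_of_notMem_tsupport hs]

/-- The involution `f^*(r) = Δ(r)⁻¹ α_r(f(r⁻¹)^*)` on `C_c(G, 𝔸)`. -/
def involution (𝓢 : CStarDynamics G 𝔸) (f : C_c(G, 𝔸)) : C_c(G, 𝔸) where
  toFun r := (((modularFun r)⁻¹ : ℝ) : ℂ) • 𝓢.act r (star (f r⁻¹))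
  continuous_toFun := by
    refine Continuous.smul (Complex.continuous_ofReal.comp
      (continuous_modularFun.inv₀ fun r => (modularFun_pos r).ne')) ?_
    exact 𝓢.continuous_act_apply continuous_id (f.continuous.comp continuous_inv).star
  hasCompactSupport' := by
    refine HasCompactSupport.intro' (K := (tsupport f)⁻¹) (IsCompact.inv f.hasCompactSupport)
      (isClosed_tsupport f).inv fun r hr => ?_
    have : f r⁻¹ = 0 := image_eq_zero_of_notMem_tsupport fun h => hr h
    simp [this]

/-- `𝒜 ⊆ C_c(G, A)` is a `*`-subalgebra of `C_c(G, 𝔸)` for the twisted convolution and involution,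
dense for the `L¹`-norm `‖f‖₁ = ∫ ‖f(r)‖ dμ(r)` (this norm is weaker than the inductive limit
topology and dominates the reduced `C*`-norm). -/
structure IsDenseStarSubalgebra [MeasurableSpace G] [BorelSpace G] (μ : Measure G)
    [IsFiniteMeasureOnCompacts μ] (𝓢 : CStarDynamics G 𝔸) (A : NonUnitalStarSubalgebra ℂ 𝔸)
    (𝒜 : Submodule ℂ C_c(G, 𝔸)) : Prop where
  apply_mem : ∀ f ∈ 𝒜, ∀ r, f r ∈ A
  conv_mem : ∀ f ∈ 𝒜, ∀ g ∈ 𝒜, conv μ 𝓢 f g ∈ 𝒜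
  involution_mem : ∀ f ∈ 𝒜, involution 𝓢 f ∈ 𝒜
  dense : ∀ f : C_c(G, 𝔸), ∀ ε > 0, ∃ g ∈ 𝒜, ∫ r, ‖f r - g r‖ ∂μ < ε

end Dynamics

/-! ### Multipliers -/

section Multipliers
variable {𝔸 : Type*} [NonUnitalCStarAlgebra 𝔸]

/-- The canonical extension of an automorphism `e` of `𝔸` to the multiplier algebra:
`e(m) a = e(m e⁻¹(a))` and `a e(m) = e(e⁻¹(a) m)`. -/
def multiplierAut (e : 𝔸 ≃⋆ₐ[ℂ] 𝔸) (m : 𝓜(ℂ, 𝔸)) : 𝓜(ℂ, 𝔸) where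
  fst := LinearMap.mkContinuous
    { toFun := fun a => e (m.fst (e.symm a))
      map_add' := by simp
      map_smul' := by simp } ‖m.fst‖ fun a => by
      have h1 : ‖e (m.fst (e.symm a))‖ = ‖m.fst (e.symm a)‖ :=
        StarAlgEquiv.norm_map e _
      have h2 : ‖e.symm a‖ = ‖a‖ := StarAlgEquiv.norm_map e.symm _
      exact h1.le.trans ((m.fst.le_opNorm _).trans_eq (by rw [h2]))
  snd := LinearMap.mkContinuous
    { toFun := fun a => e (m.snd (e.symm a))
      map_add' := by simp
      map_smul' := by simp } ‖m.snd‖ fun a => by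
      have h1 : ‖e (m.snd (e.symm a))‖ = ‖m.snd (e.symm a)‖ :=
        StarAlgEquiv.norm_map e _
      have h2 : ‖e.symm a‖ = ‖a‖ := StarAlgEquiv.norm_map e.symm _
      exact h1.le.trans ((m.snd.le_opNorm _).trans_eq (by rw [h2]))
  central := fun x y => by
    have h := congrArg e (m.central (e.symm x) (e.symm y))
    simpa using h

/-- `p` is a strictly continuous positive `α`-one-cocycle with values in the group `Z(A)^×` of
invertible multipliers which preserve `A` and commute with `A`. -/
structure IsCentralCocycle {G : Type*} [Group G] [TopologicalSpace G] (𝓢 : CStarDynamics G 𝔸)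
    (A : NonUnitalStarSubalgebra ℂ 𝔸) (p : G → 𝓜(ℂ, 𝔸)ˣ) : Prop where
  mul_mem : ∀ r, ∀ a ∈ A, (p r : 𝓜(ℂ, 𝔸)).fst a ∈ A
  inv_mul_mem : ∀ r, ∀ a ∈ A, ((p r)⁻¹ : 𝓜(ℂ, 𝔸)ˣ).val.fst a ∈ A
  commute : ∀ r, ∀ a ∈ A, (p r : 𝓜(ℂ, 𝔸)).fst a = (p r : 𝓜(ℂ, 𝔸)).snd a
  positive : ∀ r, ∃ b : 𝓜(ℂ, 𝔸), (p r : 𝓜(ℂ, 𝔸)) = star b * b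
  cocycle : ∀ r s, (p (r * s) : 𝓜(ℂ, 𝔸)) = p r * multiplierAut (𝓢.act r) (p s)
  continuous_fst : ∀ a : 𝔸, Continuous fun r => (p r : 𝓜(ℂ, 𝔸)).fst a
  continuous_snd : ∀ a : 𝔸, Continuous fun r => (p r : 𝓜(ℂ, 𝔸)).snd a

variable {H : Type*} [NormedAddCommGroup H] [InnerProductSpace ℂ H] [CompleteSpace H]

/-- A representation is nondegenerate if the vectors `ρ(a) h` span a dense subspace. -/
def IsNondegenerate {B : Type*} (ρ : B → H →L[ℂ] H) : Prop :=
  Dense (Submodule.span ℂ {x : H | ∃ a h, x = ρ a h} : Set H)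

/-- `a ⊗ h ↦ ρ(a) h`. -/
def repTensor (ρ : 𝔸 →⋆ₙₐ[ℂ] (H →L[ℂ] H)) : 𝔸 ⊗[ℂ] H →ₗ[ℂ] H :=
  TensorProduct.lift (ContinuousLinearMap.coeLM ℂ ∘ₗ
    ({ toFun := ρ, map_add' := map_add ρ, map_smul' := map_smul ρ } : 𝔸 →ₗ[ℂ] (H →L[ℂ] H)))

@[simp] theorem repTensor_tmul (ρ : 𝔸 →⋆ₙₐ[ℂ] (H →L[ℂ] H)) (a : 𝔸) (h : H) :
    repTensor ρ (a ⊗ₜ h) = ρ a h := rfl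

/-- The extension of a (nondegenerate) representation `ρ` of `𝔸` to the multiplier algebra:
the bounded operator with `ρ(a) h ↦ ρ(m a) h`. -/
def multiplierRep (ρ : 𝔸 →⋆ₙₐ[ℂ] (H →L[ℂ] H)) (m : 𝓜(ℂ, 𝔸)) : H →L[ℂ] H :=
  LinearMap.extendOfNorm (repTensor ρ ∘ₗ TensorProduct.map m.fst.toLinearMap LinearMap.id)
    (repTensor ρ)

theorem multiplierRep_apply (ρ : 𝔸 →⋆ₙₐ[ℂ] (H →L[ℂ] H)) (hρ : IsNondegenerate ρ) (m : 𝓜(ℂ, 𝔸))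
    (a : 𝔸) (h : H) : multiplierRep ρ m (ρ a h) = ρ (m.fst a) h := by
  have hd : DenseRange (repTensor ρ) := by
    refine hρ.mono ?_
    have : Submodule.span ℂ {x : H | ∃ a h, x = ρ a h} ≤ LinearMap.range (repTensor ρ) := by
      rw [Submodule.span_le]
      rintro _ ⟨a, h, rfl⟩
      exact ⟨a ⊗ₜ h, rfl⟩
    exact this
  refine LinearMap.extendOfNorm_eq hd ⟨‖m.fst‖, fun t => ?_⟩ (a ⊗ₜ h)
  let _ := CStarAlgebra.spectralOrder 𝔸
  have _ := CStarAlgebra.spectralOrderedRing 𝔸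
  have hu := CStarAlgebra.increasingApproximateUnit 𝔸
  have hm : ∀ x y : 𝔸, m.fst (x * y) = m.fst x * y := by
    intro x y
    have : ∀ c : 𝔸, c * (m.fst (x * y) - m.fst x * y) = 0 := by
      intro c
      rw [mul_sub, ← m.central, ← mul_assoc, ← mul_assoc, ← m.central, mul_assoc, sub_self]
    have h0 := this (star (m.fst (x * y) - m.fst x * y))
    exact sub_eq_zero.1 (CStarRing.star_mul_self_eq_zero_iff _ |>.1 h0)
  have hρc : Continuous ρ := map_continuous ρ
  have lim : Tendsto (fun e => ρ (m.fst e) (repTensor ρ t)) (CStarAlgebra.approximateUnit 𝔸)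
      (𝓝 (repTensor ρ (TensorProduct.map m.fst.toLinearMap LinearMap.id t))) := by
    induction t using TensorProduct.induction_on with
    | zero => simp
    | tmul a h =>
      have h1 : ∀ e, ρ (m.fst e) (repTensor ρ (a ⊗ₜ h)) = ρ (m.fst (e * a)) h := by
        intro e; rw [hm, map_mul]; rfl
      simp only [h1]
      have h2 := hu.tendsto_mul_right a
      have h3 : Continuous fun x => ρ (m.fst x) h := by fun_prop
      exact (h3.tendsto a).comp h2
    | add x y hx hy => simpa using hx.add hy
  refine le_of_tendsto lim.norm ?_
  filter_upwards [hu.eventually_norm] with e he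
  refine (ContinuousLinearMap.le_opNorm _ _).trans ?_
  gcongr
  refine (NonUnitalStarAlgHom.norm_apply_le ρ _).trans ((m.fst.le_opNorm e).trans ?_)
  exact mul_le_of_le_one_right (norm_nonneg _) he

end Multipliers

/-! ### Covariant representations and the regular representation -/

section Covariant
variable {G 𝔸 : Type*} [Group G] [TopologicalSpace G] [NonUnitalCStarAlgebra 𝔸]

/-- A covariant representation `(ρ, U, K)` of a `C*`-dynamical system. -/
structure CovariantRep (𝓢 : CStarDynamics G 𝔸) (K : Type*) [NormedAddCommGroup K]
    [InnerProductSpace ℂ K] [CompleteSpace K] where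
  ρ : 𝔸 →⋆ₙₐ[ℂ] (K →L[ℂ] K)
  U : G →* unitary (K →L[ℂ] K)
  continuous_U : ∀ h : K, Continuous fun r => (U r : K →L[ℂ] K) h
  covariant : ∀ r a, (U r : K →L[ℂ] K) * ρ a * star (U r : K →L[ℂ] K) = ρ (𝓢.act r a)

variable {K : Type*} [NormedAddCommGroup K] [InnerProductSpace ℂ K] [CompleteSpace K]

/-- `K ⊗ ℂ²`. -/
abbrev Twofold (K : Type*) [NormedAddCommGroup K] : Type _ := PiLp 2 (fun _ : Fin 2 => K)

/-- `T ⊗ 1` on `K ⊗ ℂ²`. -/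
def ampOp (T : K →L[ℂ] K) : Twofold K →L[ℂ] Twofold K :=
  ((PiLp.continuousLinearEquiv 2 ℂ (fun _ : Fin 2 => K)).symm : (Fin 2 → K) →L[ℂ] Twofold K) ∘L
    ContinuousLinearMap.pi (fun i => T ∘L PiLp.proj 2 (fun _ : Fin 2 => K) i)

@[simp] theorem ampOp_apply (T : K →L[ℂ] K) (x : Twofold K) (i : Fin 2) :
    ampOp T x i = T (x i) := rfl

theorem ampOp_star (T : K →L[ℂ] K) : ampOp (star T) = star (ampOp T) := by
  rw [ContinuousLinearMap.star_eq_adjoint, ContinuousLinearMap.star_eq_adjoint,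
    ContinuousLinearMap.eq_adjoint_iff]
  intro x y
  simp [PiLp.inner_apply, ContinuousLinearMap.adjoint_inner_left]

/-- `T ↦ T ⊗ 1` as a unital `*`-homomorphism. -/
def ampHom : (K →L[ℂ] K) →⋆ₐ[ℂ] (Twofold K →L[ℂ] Twofold K) where
  toFun := ampOp
  map_one' := by ext; simp
  map_mul' S T := by ext; simp
  map_zero' := by ext; simp
  map_add' S T := by ext; simp
  commutes' c := by ext; simp [Algebra.algebraMap_eq_smul_one]
  map_star' := ampOp_star

/-- The covariant representation `(ρ ⊗ 1, U ⊗ 1, K ⊗ ℂ²)`. -/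
def CovariantRep.amp {𝓢 : CStarDynamics G 𝔸} (R : CovariantRep 𝓢 K) :
    CovariantRep 𝓢 (Twofold K) where
  ρ := (ampHom : _ →⋆ₐ[ℂ] (Twofold K →L[ℂ] Twofold K)).toNonUnitalStarAlgHom.comp R.ρ
  U := (Unitary.map (⟨(ampHom : (K →L[ℂ] K) →⋆ₐ[ℂ] (Twofold K →L[ℂ] Twofold K)), ampOp_star⟩ :
    (K →L[ℂ] K) →⋆* (Twofold K →L[ℂ] Twofold K))).toMonoidHom.comp R.U
  continuous_U h := by
    refine (PiLp.continuous_toLp 2 _).comp (continuous_pi fun i => R.continuous_U (h i))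
  covariant r a := by
    have h := congrArg (ampHom : (K →L[ℂ] K) →⋆ₐ[ℂ] _) (R.covariant r a)
    rw [map_mul, map_mul, map_star] at h
    exact h

variable [IsTopologicalGroup G] [LocallyCompactSpace G] [T2Space G] [SecondCountableTopology G]
  [MeasurableSpace G] [BorelSpace G]

theorem CovariantRep.continuous_rep {𝓢 : CStarDynamics G 𝔸} (R : CovariantRep 𝓢 K) (a : 𝔸) :
    Continuous fun r : G => R.ρ (𝓢.act r⁻¹ a) :=
  (map_continuous R.ρ).comp ((𝓢.continuous_act a).comp continuous_inv)

theorem CovariantRep.norm_rep_le {𝓢 : CStarDynamics G 𝔸} (R : CovariantRep 𝓢 K) (a : 𝔸) (r : G) :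
    ‖R.ρ (𝓢.act r a)‖ ≤ ‖a‖ :=
  (NonUnitalStarAlgHom.norm_apply_le R.ρ _).trans_eq (StarAlgEquiv.norm_map (𝓢.act r) a)

theorem CovariantRep.memLp_rep (μ : Measure G) {𝓢 : CStarDynamics G 𝔸} (R : CovariantRep 𝓢 K)
    (a : 𝔸) (ξ : Lp K 2 μ) : MemLp (fun r => R.ρ (𝓢.act r⁻¹ a) (ξ r)) 2 μ := by
  refine (Lp.memLp ξ).of_le_mul (c := ‖a‖) ?_ (Eventually.of_forall fun r => ?_)
  · exact ContinuousLinearMap.aestronglyMeasurable_comp₂ (ContinuousLinearMap.id ℂ (K →L[ℂ] K))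
      (R.continuous_rep a).aestronglyMeasurable (Lp.aestronglyMeasurable ξ)
  · exact (ContinuousLinearMap.le_opNorm _ _).trans
      (mul_le_mul_of_nonneg_right (R.norm_rep_le a _) (norm_nonneg _))

/-- The induced representation `(ρ_α(a) ξ)(r) = ρ(α_{r⁻¹}(a)) ξ(r)` of `𝔸` on `L²(G; K)`. -/
def inducedRep (μ : Measure G) {𝓢 : CStarDynamics G 𝔸} (R : CovariantRep 𝓢 K) :
    𝔸 →L[ℂ] (Lp K 2 μ →L[ℂ] Lp K 2 μ) :=
  LinearMap.mkContinuous₂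
    (LinearMap.mk₂ ℂ (fun a ξ => (R.memLp_rep μ a ξ).toLp)
      (fun a b ξ => by
        rw [← MemLp.toLp_add]; congr 1; ext r; simp)
      (fun c a ξ => by
        rw [← MemLp.toLp_const_smul]; congr 1; ext r; simp)
      (fun a ξ ζ => by
        rw [← MemLp.toLp_add]
        refine MemLp.toLp_congr _ _ ?_
        filter_upwards [Lp.coeFn_add ξ ζ] with r hr
        rw [hr]; simp)
      (fun c a ξ => by
        rw [← MemLp.toLp_const_smul]
        refine MemLp.toLp_congr _ _ ?_
        filter_upwards [Lp.coeFn_smul c ξ] with r hr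
        rw [hr]; simp)) 1
    (fun a ξ => by
      rw [one_mul]
      refine Lp.norm_le_mul_norm_of_ae_le_mul ?_
      filter_upwards [(R.memLp_rep μ a ξ).coeFn_toLp] with r hr
      simp only [LinearMap.mk₂_apply]
      rw [hr]
      exact (ContinuousLinearMap.le_opNorm _ _).trans
        (mul_le_mul_of_nonneg_right (R.norm_rep_le a _) (norm_nonneg _)))

variable (μ : Measure G) [μ.IsHaarMeasure]

/-- The left regular representation `(λ_s ξ)(r) = ξ(s⁻¹ r)` on `L²(G; K)`. -/
def leftTranslate (s : G) (ξ : Lp K 2 μ) : Lp K 2 μ := DomMulAct.mk s⁻¹ • ξ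

theorem leftTranslate_ae_eq (s : G) (ξ : Lp K 2 μ) :
    leftTranslate μ s ξ =ᵐ[μ] fun r => ξ (s⁻¹ * r) :=
  DomMulAct.smul_Lp_ae_eq _ _

theorem continuous_leftTranslate (ξ : Lp K 2 μ) : Continuous fun s : G => leftTranslate μ s ξ :=
  have : Fact ((2 : ℝ≥0∞) ≠ ∞) := ⟨by simp⟩
  (DomMulAct.continuous_mk.comp continuous_inv).smul continuous_const

theorem integrable_regular {𝓢 : CStarDynamics G 𝔸} (R : CovariantRep 𝓢 K) (f : C_c(G, 𝔸))
    (ξ : Lp K 2 μ) : Integrable (fun s => inducedRep μ R (f s) (leftTranslate μ s ξ)) μ := by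
  refine Continuous.integrable_of_hasCompactSupport ?_ ?_
  · exact ((inducedRep μ R).continuous.comp f.continuous).clm_apply (continuous_leftTranslate μ ξ)
  · refine f.hasCompactSupport.mono fun s hs => ?_
    contrapose! hs
    simp [Function.notMem_support.1 hs]

/-- The operator `ρ̂(f) = ∫ ρ_α(f(s)) λ_s dμ(s)` on `L²(G; K)`, that is
`(ρ̂(f) ξ)(r) = ∫ ρ(α_{r⁻¹}(f(s))) ξ(s⁻¹ r) dμ(s)`. -/
def regularOp {𝓢 : CStarDynamics G 𝔸} (R : CovariantRep 𝓢 K) (f : C_c(G, 𝔸)) :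
    Lp K 2 μ →L[ℂ] Lp K 2 μ :=
  LinearMap.mkContinuous
    { toFun := fun ξ => ∫ s, inducedRep μ R (f s) (leftTranslate μ s ξ) ∂μ
      map_add' := fun ξ ζ => by
        rw [← integral_add (integrable_regular μ R f ξ) (integrable_regular μ R f ζ)]
        congr 1; ext1 s
        rw [← map_add]; congr 1
        exact smul_add _ _ _
      map_smul' := fun c ξ => by
        rw [RingHom.id_apply, ← integral_smul]
        congr 1; ext1 s
        rw [← map_smul]; congr 1
        exact smul_comm _ _ _ } (∫ s, ‖f s‖ ∂μ) fun ξ => by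
    have hf : Integrable (fun s => ‖f s‖) μ :=
      (f.continuous.integrable_of_hasCompactSupport f.hasCompactSupport).norm
    rw [← integral_mul_const]
    refine norm_integral_le_of_norm_le (hf.mul_const _) (Eventually.of_forall fun s => ?_)
    refine (ContinuousLinearMap.le_opNorm₂ _ _ _).trans ?_
    have h1 : ‖inducedRep μ R‖ ≤ 1 := LinearMap.mkContinuous₂_norm_le _ zero_le_one _
    have h2 : ‖leftTranslate μ s ξ‖ = ‖ξ‖ := DomMulAct.norm_smul_Lp _ _
    rw [h2]
    gcongr
    exact mul_le_of_le_one_left (norm_nonneg _) h1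

theorem regularOp_apply {𝓢 : CStarDynamics G 𝔸} (R : CovariantRep 𝓢 K) (f : C_c(G, 𝔸))
    (ξ : Lp K 2 μ) :
    regularOp μ R f ξ = ∫ s, inducedRep μ R (f s) (leftTranslate μ s ξ) ∂μ := rfl

/-- The integrated regular representation `ρ̂` of `C_c(G, 𝔸)` on `L²(G; K)`. -/
def regularRep {𝓢 : CStarDynamics G 𝔸} (R : CovariantRep 𝓢 K) :
    C_c(G, 𝔸) →ₗ[ℂ] (Lp K 2 μ →L[ℂ] Lp K 2 μ) where
  toFun := regularOp μ R
  map_add' f g := by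
    ext1 ξ
    rw [_root_.add_apply, regularOp_apply, regularOp_apply, regularOp_apply,
      ← integral_add (integrable_regular μ R f ξ) (integrable_regular μ R g ξ)]
    congr 1; ext1 s
    simp
  map_smul' c f := by
    ext1 ξ
    rw [RingHom.id_apply, _root_.smul_apply, regularOp_apply, regularOp_apply,
      ← integral_smul]
    congr 1; ext1 s
    simp

/-- The reduced crossed product: the norm closure of `ρ̂(C_c(G, 𝔸))` in `B(L²(G; K))`. -/
def reducedCrossedProduct {𝓢 : CStarDynamics G 𝔸} (R : CovariantRep 𝓢 K) :
    Set (Lp K 2 μ →L[ℂ] Lp K 2 μ) :=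
  closure (Set.range (regularRep μ R))

end Covariant

/-! ### Unbounded operators -/

section Unbounded
variable {K : Type*} [NormedAddCommGroup K] [InnerProductSpace ℂ K] [CompleteSpace K]

/-- The operator `S E T` for bounded `S`, `T` and unbounded `E`, on its natural domain
`{x | T x ∈ Dom E}`. -/
def sandwich (S : K →L[ℂ] K) (E : K →ₗ.[ℂ] K) (T : K →L[ℂ] K) : K →ₗ.[ℂ] K where
  domain := E.domain.comap T.toLinearMap
  toFun := S.toLinearMap ∘ₗ E.toFun ∘ₗ T.toLinearMap.restrict (fun _ h => h)

/-- A bounded operator as an everywhere defined partial operator. -/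
def ofBounded (T : K →L[ℂ] K) : K →ₗ.[ℂ] K := T.toLinearMap.toPMap ⊤

/-- The operator `E + T`, for bounded `T`, with domain `Dom E`. -/
def addBounded (E : K →ₗ.[ℂ] K) (T : K →L[ℂ] K) : K →ₗ.[ℂ] K where
  domain := E.domain
  toFun := E.toFun + T.toLinearMap ∘ₗ E.domain.subtype

/-- `E ⊗ γ¹ + T ⊗ γ²` on `Dom E ⊗ ℂ²`, for bounded `T`, with the Pauli matrices
`γ¹ = (0 1; 1 0)` and `γ² = (0 -i; i 0)`. -/
def pauliSum (E : K →ₗ.[ℂ] K) (T : K →L[ℂ] K) : Twofold K →ₗ.[ℂ] Twofold K where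
  domain :=
    { carrier := {x | ∀ i, x i ∈ E.domain}
      add_mem' := fun hx hy i => E.domain.add_mem (hx i) (hy i)
      zero_mem' := fun _ => E.domain.zero_mem
      smul_mem' := fun c _ hx i => E.domain.smul_mem c (hx i) }
  toFun :=
    { toFun := fun x => WithLp.toLp 2 fun i =>
        ∑ j, ((!![0, 1; 1, 0] : Matrix (Fin 2) (Fin 2) ℂ) i j • E ⟨x.1 j, x.2 j⟩ +
          (!![0, -Complex.I; Complex.I, 0] : Matrix (Fin 2) (Fin 2) ℂ) i j • T (x.1 j))
      map_add' := fun x y => by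
        have h : ∀ j, E ⟨(x + y).1 j, (x + y).2 j⟩ = E ⟨x.1 j, x.2 j⟩ + E ⟨y.1 j, y.2 j⟩ :=
          fun j => E.map_add ⟨x.1 j, x.2 j⟩ ⟨y.1 j, y.2 j⟩
        ext i
        simp only [h]
        fin_cases i <;> simp [Fin.sum_univ_two] <;> abel
      map_smul' := fun c x => by
        have h : ∀ j, E ⟨(c • x).1 j, (c • x).2 j⟩ = c • E ⟨x.1 j, x.2 j⟩ :=
          fun j => E.map_smul c ⟨x.1 j, x.2 j⟩
        ext i
        simp only [h]
        fin_cases i <;> simp [Fin.sum_univ_two, smul_comm c Complex.I] }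

/-- Two operators agree on a common core. -/
def AgreeOnCommonCore (E F : K →ₗ.[ℂ] K) : Prop :=
  ∃ C : Submodule ℂ K, E.HasCore C ∧ F.HasCore C ∧ E.domRestrict C = F.domRestrict C

/-- For a closed densely defined operator `E` (in particular a selfadjoint one), the bounded
positive operator `(1 + E^* E)⁻¹`, obtained as the compression to the first summand of the
orthogonal projection of `K ⊕ K` onto the (closed) graph of `E`. For selfadjoint `E` this is
`(1 + E²)⁻¹`, see `resolventSq_spec`. -/
def resolventSq (E : K →ₗ.[ℂ] K) : K →L[ℂ] K :=
  WithLp.fstL 2 ℂ K K ∘L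
    ((E.graph.map (WithLp.linearEquiv 2 ℂ (K × K)).symm.toLinearMap).topologicalClosure).starProjection
    ∘L ((WithLp.prodContinuousLinearEquiv 2 ℂ K K).symm : K × K →L[ℂ] WithLp 2 (K × K)) ∘L
      ContinuousLinearMap.inl ℂ K K

/-- `(1 + E²)⁻¹` does what its name says. -/
theorem resolventSq_spec (E : K →ₗ.[ℂ] K) (hE : IsSelfAdjoint E) (x : K) :
    ∃ y z : K, (resolventSq E x, y) ∈ E.graph ∧ (y, z) ∈ E.graph ∧ resolventSq E x + z = x := by
  set Γ := E.graph.map (WithLp.linearEquiv 2 ℂ (K × K)).symm.toLinearMap with hΓ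
  have hclosed : IsClosed (Γ : Set (WithLp 2 (K × K))) := by
    have h : (Γ : Set (WithLp 2 (K × K))) =
        (WithLp.prodContinuousLinearEquiv 2 ℂ K K) ⁻¹' (E.graph : Set (K × K)) := by
      ext w
      constructor
      · rintro ⟨v, hv, rfl⟩
        exact hv
      · intro hw
        exact ⟨w.ofLp, hw, rfl⟩
    rw [h]
    exact hE.isClosed.preimage (WithLp.prodContinuousLinearEquiv 2 ℂ K K).continuous
  set w : WithLp 2 (K × K) := WithLp.toLp 2 (x, 0) with hw
  set v : WithLp 2 (K × K) := Γ.topologicalClosure.starProjection w with hv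
  have hvΓ : v ∈ Γ := by
    have h : v ∈ Γ.topologicalClosure := Submodule.starProjection_apply_mem _ _
    rwa [hclosed.submodule_topologicalClosure_eq] at h
  have hR : resolventSq E x = v.fst := rfl
  have hvE : (v.fst, v.snd) ∈ E.graph := by
    obtain ⟨u, hu, huv⟩ := hvΓ
    rw [← huv]
    exact hu
  have horth : ∀ h : E.domain, inner ℂ (x - v.fst) (h : K) = inner ℂ v.snd (E h) := by
    intro h
    have h1 : w - v ∈ Γ.topologicalClosureᗮ := Submodule.sub_starProjection_mem_orthogonal w
    have h2 : (WithLp.toLp 2 ((h : K), E h) : WithLp 2 (K × K)) ∈ Γ.topologicalClosure :=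
      Γ.le_topologicalClosure ⟨_, E.mem_graph h, rfl⟩
    have h3 := (Submodule.mem_orthogonal' _ _).1 h1 _ h2
    rw [WithLp.prod_inner_apply] at h3
    simp only [hw, WithLp.ofLp_sub, Prod.fst_sub, Prod.snd_sub, zero_sub, inner_neg_left] at h3
    exact add_neg_eq_zero.1 h3
  have hd := hE.dense_domain
  have hy : v.snd ∈ (LinearPMap.adjoint E).domain :=
    LinearPMap.mem_adjoint_domain_of_exists _ ⟨_, horth⟩
  have hz : (LinearPMap.adjoint E) ⟨v.snd, hy⟩ = x - v.fst :=
    LinearPMap.adjoint_apply_eq hd _ horth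
  have hg : (v.snd, x - v.fst) ∈ (LinearPMap.adjoint E).graph := by
    rw [← hz]
    exact LinearPMap.mem_graph _ ⟨v.snd, hy⟩
  rw [LinearPMap.isSelfAdjoint_def.1 hE] at hg
  exact ⟨v.snd, x - v.fst, by rw [hR]; exact hvE, hg, by rw [hR]; abel⟩

/-- `(1 + E²)^{-t}` for a selfadjoint operator `E` and `t > 0`, by continuous functional calculus of
the bounded positive operator `(1 + E²)⁻¹`. -/
def bracketPow (E : K →ₗ.[ℂ] K) (t : ℝ) : K →L[ℂ] K := resolventSq E ^ t

/-- The axioms of a spectral triple `(A, K, D)`, with `A` represented on `K` by `ρ`: the commutators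
`[D, ρ(a)]` are densely defined and bounded, and `ρ(a) (1 + D²)^{-1/2}` is compact. -/
structure IsSpectralTriple {𝔸 : Type*} [NonUnitalCStarAlgebra 𝔸] (A : NonUnitalStarSubalgebra ℂ 𝔸)
    (ρ : 𝔸 →⋆ₙₐ[ℂ] (K →L[ℂ] K)) (D : K →ₗ.[ℂ] K) : Prop where
  faithful : Set.InjOn ρ A
  nondegenerate : IsNondegenerate fun a : A => ρ a
  selfAdjoint : IsSelfAdjoint D
  commutator_dense : ∀ a ∈ A, Dense {h : K | h ∈ D.domain ∧ ρ a h ∈ D.domain}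
  commutator_bounded : ∀ a ∈ A, ∃ M : ℝ, ∀ h u v : K, (h, u) ∈ D.graph → (ρ a h, v) ∈ D.graph →
    ‖v - ρ a u‖ ≤ M * ‖h‖
  compact_resolvent : ∀ a ∈ A, IsCompactOperator (ρ a * bracketPow D (1 / 2))

end Unbounded

/-! ### Decomposable operators on `L²(G; K)` -/

section Fiberwise
variable {G : Type*} [MeasurableSpace G]
  {K : Type*} [NormedAddCommGroup K] [InnerProductSpace ℂ K] [CompleteSpace K]

/-- The graph of `fiberwise μ E`. -/
def fiberGraph (μ : Measure G) (E : G → K →ₗ.[ℂ] K) : Submodule ℂ (Lp K 2 μ × Lp K 2 μ) where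
  carrier := {q | ∀ᵐ r ∂μ, (q.1 r, q.2 r) ∈ (E r).graph}
  add_mem' := fun {x y} hx hy => by
    filter_upwards [hx, hy, Lp.coeFn_add x.1 y.1, Lp.coeFn_add x.2 y.2] with r h1 h2 h3 h4
    rw [Prod.fst_add, Prod.snd_add, h3, h4]
    exact (E r).graph.add_mem h1 h2
  zero_mem' := by
    filter_upwards [Lp.coeFn_zero K 2 μ] with r h
    rw [Prod.fst_zero, Prod.snd_zero, h]
    exact (E r).graph.zero_mem
  smul_mem' := fun c x hx => by
    filter_upwards [hx, Lp.coeFn_smul c x.1, Lp.coeFn_smul c x.2] with r h1 h3 h4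
    rw [Prod.smul_fst, Prod.smul_snd, h3, h4]
    exact (E r).graph.smul_mem c h1

/-- The operator `(E ξ)(r) = E_r ξ(r)` on `L²(G; K)`, with the maximal domain consisting of all `ξ`
such that `ξ(r) ∈ Dom E_r` for almost every `r` and `r ↦ E_r ξ(r)` is in `L²(G; K)`. -/
def fiberwise (μ : Measure G) (E : G → K →ₗ.[ℂ] K) : Lp K 2 μ →ₗ.[ℂ] Lp K 2 μ :=
  (fiberGraph μ E).toLinearPMap

theorem mem_fiberwise_graph (μ : Measure G) (E : G → K →ₗ.[ℂ] K) (ξ ζ : Lp K 2 μ) :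
    (ξ, ζ) ∈ (fiberwise μ E).graph ↔ ∀ᵐ r ∂μ, (ξ r, ζ r) ∈ (E r).graph := by
  rw [fiberwise, Submodule.toLinearPMap_graph_eq]
  · rfl
  · rintro ⟨x, y⟩ hx (h0 : x = 0)
    subst h0
    refine Lp.ext ?_
    filter_upwards [show ∀ᵐ r ∂μ, _ from hx, Lp.coeFn_zero K 2 μ] with r h1 h2
    simp only [h2, Pi.zero_apply] at h1 ⊢
    exact (E r).graph_fst_eq_zero_snd h1 rfl

end Fiberwise

/-! ### The objects of the construction -/

section Construction
variable {G 𝔸 : Type*} [Group G] [TopologicalSpace G] [MeasurableSpace G] [NonUnitalCStarAlgebra 𝔸]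
  {𝓢 : CStarDynamics G 𝔸}
  {K : Type*} [NormedAddCommGroup K] [InnerProductSpace ℂ K] [CompleteSpace K]

/-- The operator `ξ ↦ (r ↦ U_r^* E_r U_r ξ(r))` on `L²(G; K)`, on its maximal domain. -/
def CovariantRep.rotated (R : CovariantRep 𝓢 K) (μ : Measure G) (E : G → K →ₗ.[ℂ] K) :
    Lp K 2 μ →ₗ.[ℂ] Lp K 2 μ :=
  fiberwise μ fun r => sandwich (star (R.U r : K →L[ℂ] K)) (E r) (R.U r : K →L[ℂ] K)

/-- `T_p(r) = η + ω ρ(p(r))`. -/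
def fiberT (R : CovariantRep 𝓢 K) (p : G → 𝓜(ℂ, 𝔸)ˣ) (η ω : ℝ) (r : G) : K →L[ℂ] K :=
  (η : ℂ) • (1 : K →L[ℂ] K) + (ω : ℂ) • multiplierRep R.ρ (p r)

/-- `(D̂ ξ)(r) = U_r^* D U_r ξ(r)` on `L²(G; K)`. -/
def hatD (R : CovariantRep 𝓢 K) (μ : Measure G) (D : K →ₗ.[ℂ] K) : Lp K 2 μ →ₗ.[ℂ] Lp K 2 μ :=
  R.rotated μ fun _ => D

/-- `(T_{η,ω} ξ)(r) = U_r^* (η + ω ρ(p(r))) U_r ξ(r)` on `L²(G; K)`. -/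
def hatT (R : CovariantRep 𝓢 K) (μ : Measure G) (p : G → 𝓜(ℂ, 𝔸)ˣ) (η ω : ℝ) :
    Lp K 2 μ →ₗ.[ℂ] Lp K 2 μ :=
  R.rotated μ fun r => ofBounded (fiberT R p η ω r)

/-- `𝒟 = D̂ ⊗ γ¹ + T_{η,ω} ⊗ γ²` on `L²(G; K ⊗ ℂ²)`, that is `(𝒟 ξ)(r) = V_r^* 𝒟_r V_r ξ(r)` with
`V_r = U_r ⊗ 1` and `𝒟_r = D ⊗ γ¹ + T_p(r) ⊗ γ²`, on the maximal domain. -/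
def diracOp (R : CovariantRep 𝓢 K) (μ : Measure G) (D : K →ₗ.[ℂ] K) (p : G → 𝓜(ℂ, 𝔸)ˣ)
    (η ω : ℝ) : Lp (Twofold K) 2 μ →ₗ.[ℂ] Lp (Twofold K) 2 μ :=
  R.amp.rotated μ fun r => pauliSum D (fiberT R p η ω r)

/-- `Θ = θ̂ ⊗ 1` on `L²(G; K ⊗ ℂ²)`, with `(θ̂ ξ)(r) = U_r^* ρ(p(r)) U_r ξ(r)`, on the maximal
domain. -/
def modularOp (R : CovariantRep 𝓢 K) (μ : Measure G) (p : G → 𝓜(ℂ, 𝔸)ˣ) :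
    Lp (Twofold K) 2 μ →ₗ.[ℂ] Lp (Twofold K) 2 μ :=
  R.amp.rotated μ fun r => ofBounded (ampOp (multiplierRep R.ρ (p r)))

/-- The space `Ŷ` of all `ξ ∈ L²(G; K)` with `ξ(r) ∈ Dom D` for almost every `r` and
`r ↦ (D ± i ω ρ(p(r))) ξ(r)` in `L²(G; K)` for both signs. -/
def domainY (R : CovariantRep 𝓢 K) (μ : Measure G) (D : K →ₗ.[ℂ] K) (p : G → 𝓜(ℂ, 𝔸)ˣ) (ω : ℝ) :
    Submodule ℂ (Lp K 2 μ) :=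
  (fiberwise μ fun r => addBounded D ((Complex.I * ω) • multiplierRep R.ρ (p r))).domain ⊓
    (fiberwise μ fun r => addBounded D (-((Complex.I * ω) • multiplierRep R.ρ (p r)))).domain

/-- `[S, T]`, defined on a core of `S`, extends to a bounded operator. -/
def HasBoundedCommutator (S T : K →ₗ.[ℂ] K) : Prop :=
  ∃ B : K →L[ℂ] K, ∃ C : Submodule ℂ K, S.HasCore C ∧ ∀ x ∈ C, ∃ u v w w' : K,
    (x, u) ∈ S.graph ∧ (x, v) ∈ T.graph ∧ (v, w) ∈ S.graph ∧ (u, w') ∈ T.graph ∧ w - w' = B x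

/-- `(B, K, D, β)` is a twisted spectral triple (up to the resolvent condition), of modular type
with respect to the positive selfadjoint operator `Θ`. Here `B` is a `*`-algebra with product `mul`
and involution `inv`, represented by `π`. The field `twisted_commutator` says that
`π(a) Dom D ⊆ Dom D` and that `D π(a) - π(β(a)) D` extends to a bounded operator; the field
`implemented` says that `π(β(a)) = Θ π(a) Θ⁻¹` on the dense subspace `Dom Θ⁻¹ = Ran Θ`. -/
structure IsModularTwistedTriple {B : Type*} [AddCommGroup B] [Module ℂ B] (mul : B → B → B)
    (inv : B → B) (π : B →ₗ[ℂ] (K →L[ℂ] K)) (D : K →ₗ.[ℂ] K) (β : B ≃ₗ[ℂ] B)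
    (Θ : K →ₗ.[ℂ] K) : Prop where
  separable : TopologicalSpace.SeparableSpace K
  map_mul : ∀ a b, π (mul a b) = π a * π b
  map_inv : ∀ a, π (inv a) = star (π a)
  faithful : Function.Injective π
  nondegenerate : IsNondegenerate π
  selfAdjoint : IsSelfAdjoint D
  twist_mul : ∀ a b, β (mul a b) = mul (β a) (β b)
  twist_inv : ∀ a, β (inv a) = inv (β.symm a)
  twisted_commutator : ∀ a, ∃ T : K →L[ℂ] K, ∀ x : D.domain,
    ((π a x : K), π (β a) (D x) + T x) ∈ D.graph
  modular_selfAdjoint : IsSelfAdjoint Θ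
  modular_nonneg : ∀ x : Θ.domain, 0 ≤ RCLike.re (inner ℂ (x : K) (Θ x))
  modular_injective : ∀ x : Θ.domain, Θ x = 0 → (x : K) = 0
  modular_dense_range : Dense (Θ.inverse.domain : Set K)
  implemented : ∀ a, ∀ x : Θ.inverse.domain, (π a (Θ.inverse x), π (β a) x) ∈ Θ.graph

/-- `Θ π(a) (1 + D²)^{-t}` is an everywhere defined compact operator for every `a`. -/
def ModularCompactResolvent {B : Type*} [AddCommGroup B] [Module ℂ B]
    (π : B →ₗ[ℂ] (K →L[ℂ] K)) (D Θ : K →ₗ.[ℂ] K) (t : ℝ) : Prop :=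
  ∀ a, ∃ T : K →L[ℂ] K, IsCompactOperator T ∧ ∀ x, (π a (bracketPow D t x), T x) ∈ Θ.graph

end Construction
end ModularTriple

end

/-!
# The twisted spectral triple on a reduced crossed product

The operators `D̂` and `𝒯` on `L²(G; H)`, and `𝒟` and `Θ` on `L²(G; H ⊗ ℂ²)`, are all of the form
`(Ê ξ)(r) = U_r^* E_r U_r ξ(r)` for a field `E_r` of selfadjoint operators on `K = H` or
`K = H ⊗ ℂ²`, and `ρ̂(f)` is the integral over `s` of `ρ_α(f(s)) λ_s`, where
`(ρ_α(a) ξ)(r) = ρ(α_{r⁻¹}(a)) ξ(r)` and `λ_s` is left translation. Everything is therefore reduced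
to identities and bounds in the fibers.

*Selfadjointness.* `Ê` is symmetric, and the field of the resolvents `(E_r ± i)⁻¹`, rotated by `U`,
inverts `Ê ± i` (`isSelfAdjoint_fiberwise`). This needs strong continuity of the resolvents, which
holds because all `E_r` have one domain on which they are strongly continuous in `r`
(`tendsto_resolvent`). Powers of `(1 + Ê²)⁻¹` are approximated by polynomials and are again computed
fiberwise (`bracketPow_fiberwise`).

*The crossed product.* Multiplicativity of `ρ̂` is Fubini's theorem, and compatibility with the
involution is the behaviour of Haar measure under inversion (`integral_comp_inv`). Faithfulness and
nondegeneracy are `regularRep_injective` and `regularRep_nondegenerate`. The properties of the twist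
`β` follow from the cocycle identity and the centrality of `p`.

*Twisted commutators.* The relation `Ê ρ̂(f) = ρ̂(g) Ê + bounded` follows if, for each `s`, the
defect `E_{st} ρ(f(s)) U_s - ρ(g(s)) U_s E_t` is bounded uniformly in `s` and independent of `t`
(`exists_regularRep_graph`). As `Ê` is selfadjoint, it suffices to check this weakly, so that
the integral over `s` causes no domain problems.
For `g = β(f)` and `E_t = ρ(p(t))` the defect is zero by
the cocycle identity; this is the relation between `Θ` and `β` (`modularOp_implemented`). For
`E_t = D` one has `U_s D U_s^* = z(s)*⁻¹ D z(s)⁻¹` exactly, since selfadjoint operators which agree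
on a common core coincide; with `p(s) = z(s) z(s)^*` the defect becomes
`[D, ρ(f(s)) z(s)] z(s)⁻¹ U_s`, which is bounded by hypothesis (`exists_fiber_commutator`). Together
these give `exists_twisted_commutator`.

*Compactness.* Choose `g` with `β(g) = f^*`. Then `Θ π(f) (1 + 𝒟²)^{-s}` is the adjoint of
`Z = (1 + 𝒟²)^{-s} Θ π(g)`, so it suffices that `Z` is compact. The fiber of `Z` at `t` is a kernel
operator `L²(G; K) → K` whose kernel `(1 + 𝒟_t²)^{-s} ρ(α_{t⁻¹}(a))`, up to scalars, has compact
values because `(A, H, D)` has compact resolvents; hence the fiber is compact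
(`isCompactOperator_comp_kernelOp`). Square integrability of the norms of the fibers makes `Z`
compact, by dominated convergence along weakly null sequences (`exists_compact_of_fibers`). That
integrability is the convergence condition, once `(1 + 𝒟_t²)⁻¹` is compared with `(1 + T_p(t)²)⁻¹`:
boundedness of `[D̂, 𝒯]` localises to a bound `b` on the form of each `[D, T_p(t)]`
(`HasBoundedCommutator.exists_fiber_bound`), and then `‖(1 + 𝒟_t²)⁻¹‖ ≤ (1 + b) ‖(1 + T_p(t)²)⁻¹‖`
(`norm_resolventSq_pauliSum_le`).
-/

noncomputable section

namespace ModularTriple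

/-! ### Selfadjoint partial operators and their resolvents -/

section SelfAdjoint
variable {K : Type*} [NormedAddCommGroup K] [InnerProductSpace ℂ K] [CompleteSpace K]

theorem mem_graph_iff_of_isSelfAdjoint {E : K →ₗ.[ℂ] K} (hE : IsSelfAdjoint E) {x y : K} :
    (x, y) ∈ E.graph ↔ ∀ u v, (u, v) ∈ E.graph → inner ℂ v x = inner ℂ u y := by
  have h := LinearPMap.adjoint_graph_eq_graph_adjoint hE.dense_domain
  rw [LinearPMap.isSelfAdjoint_def.1 hE] at h
  conv_lhs => rw [h]
  rw [Submodule.mem_adjoint_iff]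
  simp only [sub_eq_zero]

theorem inner_graph_comm {E : K →ₗ.[ℂ] K} (hE : IsSelfAdjoint E) {x y u v : K}
    (h : (x, y) ∈ E.graph) (h' : (u, v) ∈ E.graph) : inner ℂ v x = inner ℂ u y :=
  (mem_graph_iff_of_isSelfAdjoint hE).1 h u v h'

theorem graph_unique {E : K →ₗ.[ℂ] K} {x y y' : K}
    (h : (x, y) ∈ E.graph) (h' : (x, y') ∈ E.graph) : y = y' :=
  E.mem_graph_snd_inj' h h' rfl

theorem isSelfAdjoint_of_graph {E : K →ₗ.[ℂ] K} (hd : Dense (E.domain : Set K))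
    (h : ∀ x y, (x, y) ∈ E.graph ↔ ∀ u v, (u, v) ∈ E.graph → inner ℂ v x = inner ℂ u y) :
    IsSelfAdjoint E := by
  rw [LinearPMap.isSelfAdjoint_def]
  refine LinearPMap.eq_of_eq_graph ?_
  rw [LinearPMap.adjoint_graph_eq_graph_adjoint hd]
  ext ⟨x, y⟩
  rw [Submodule.mem_adjoint_iff, h]
  simp only [sub_eq_zero]

theorem mem_domain_of_mem_graph {E : K →ₗ.[ℂ] K} {x y : K} (h : (x, y) ∈ E.graph) :
    x ∈ E.domain := by
  obtain ⟨z, hz, -⟩ := (E.mem_graph_iff).1 h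
  exact (show (z : K) = x from hz) ▸ z.2

theorem exists_mem_graph {E : K →ₗ.[ℂ] K} {x : K} (h : x ∈ E.domain) : ∃ y, (x, y) ∈ E.graph :=
  ⟨_, E.mem_graph ⟨x, h⟩⟩

/-- For a symmetric relation `(u, v)`, the operator `E + i c` is isometric for the graph norm. -/
theorem norm_sq_add_smul {u v : K} (h : inner ℂ v u = inner ℂ u v) {c : ℝ} (hc : c ^ 2 = 1) :
    ‖v + (c * Complex.I) • u‖ ^ 2 = ‖v‖ ^ 2 + ‖u‖ ^ 2 := by
  have h1 : (inner ℂ v u).im = 0 := by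
    have := congrArg Complex.im (inner_conj_symm (𝕜 := ℂ) u v)
    rw [h, Complex.conj_im] at this
    rw [h]; linarith
  rw [norm_add_sq (𝕜 := ℂ), inner_smul_right, norm_smul, mul_pow]
  have : ‖(c * Complex.I : ℂ)‖ ^ 2 = 1 := by simp [hc]
  rw [this]
  simp [h1]

/-- A symmetric operator `E` with `E + i` and `E - i` surjective is selfadjoint. -/
theorem isSelfAdjoint_of_surjective {E : K →ₗ.[ℂ] K}
    (hs : ∀ x y u v, (x, y) ∈ E.graph → (u, v) ∈ E.graph → inner ℂ v x = inner ℂ u y)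
    (hsurj : ∀ c : ℝ, c ^ 2 = 1 → ∀ x, ∃ u v, (u, v) ∈ E.graph ∧ v + (c * Complex.I) • u = x) :
    IsSelfAdjoint E := by
  refine isSelfAdjoint_of_graph ?_ fun x y => ⟨fun h u v h' => hs x y u v h h', fun h => ?_⟩
  · rw [Submodule.dense_iff_topologicalClosure_eq_top, Submodule.topologicalClosure_eq_top_iff,
      Submodule.eq_bot_iff]
    intro e he
    obtain ⟨u, v, huv, rfl⟩ := hsurj 1 (by norm_num) e
    have h0 := (Submodule.mem_orthogonal _ _).1 he u (mem_domain_of_mem_graph huv)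
    have h1 : (inner ℂ u v : ℂ).im = 0 := by
      have := congrArg Complex.im (inner_conj_symm (𝕜 := ℂ) u v)
      rw [hs u v u v huv huv, Complex.conj_im] at this
      linarith
    have h2 : u = 0 := by
      rw [inner_add_right, inner_smul_right, inner_self_eq_norm_sq_to_K] at h0
      have := congrArg Complex.im h0
      simpa [h1, ← Complex.ofReal_pow] using this
    subst h2
    have h3 : v = 0 := graph_unique huv E.graph.zero_mem
    simp [h3]
  · obtain ⟨w, w', hw, hw'⟩ := hsurj 1 (by norm_num) (y + (((1 : ℝ) : ℂ) * Complex.I) • x)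
    obtain ⟨u, v, huv, he⟩ := hsurj (-1) (by norm_num) (x - w)
    have h1 := h u v huv
    have h2 := hs w w' u v hw huv
    have h3 : w' = y + Complex.I • (x - w) := by
      rw [eq_sub_of_add_eq hw']
      simp only [Complex.ofReal_one, one_mul, smul_sub]; abel
    have h4 : inner ℂ v (x - w) + inner ℂ u (Complex.I • (x - w)) = 0 := by
      have h5 : inner ℂ v (x - w) = inner ℂ v x - inner ℂ v w := inner_sub_right _ _ _
      rw [h5, h1, h2, h3, inner_add_right]
      ring
    have h5 : inner ℂ (x - w) (x - w) = (0 : ℂ) := by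
      conv_lhs => rw [← he]
      rw [inner_smul_right] at h4
      rw [inner_add_left, inner_smul_left, he]
      simp only [Complex.ofReal_neg, Complex.ofReal_one, neg_mul, one_mul, map_neg,
        Complex.conj_I, neg_neg]
      exact h4
    have h6 : x = w := sub_eq_zero.1 (inner_self_eq_zero.1 h5)
    subst h6
    have h7 : w' = y := add_right_cancel hw'
    exact h7 ▸ hw

theorem exists_resolvent {E : K →ₗ.[ℂ] K} (hE : IsSelfAdjoint E) {c : ℝ} (hc : c ^ 2 = 1) (x : K) :
    ∃ u v, (u, v) ∈ E.graph ∧ v + (c * Complex.I) • u = x := by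
  obtain ⟨y, z, h1, h2, h3⟩ := resolventSq_spec E hE x
  refine ⟨y - (c * Complex.I) • resolventSq E x, z - (c * Complex.I) • y,
    E.graph.sub_mem h2 (E.graph.smul_mem _ h1), ?_⟩
  have hI : ((c : ℂ) * Complex.I) * (c * Complex.I) = -1 := by
    have hc' : (c : ℂ) ^ 2 = 1 := by exact_mod_cast congrArg Complex.ofReal hc
    linear_combination (Complex.I ^ 2) * hc' + Complex.I_sq
  conv_rhs => rw [← h3]
  rw [smul_sub, smul_smul, hI, neg_smul, one_smul]
  abel

/-- The resolvent `(E + i c)⁻¹` for a selfadjoint operator `E` and `c = ±1`. It is characterised by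
`mem_graph_resolvent`, and it is `0` if no bounded operator satisfies this characterisation. -/
def resolvent (E : K →ₗ.[ℂ] K) (c : ℝ) : K →L[ℂ] K :=
  open scoped Classical in
  if h : ∃ R : K →L[ℂ] K, ∀ x, (R x, x - (c * Complex.I) • R x) ∈ E.graph then h.choose else 0

theorem mem_graph_resolvent {E : K →ₗ.[ℂ] K} (hE : IsSelfAdjoint E) {c : ℝ} (hc : c ^ 2 = 1)
    (x : K) : (resolvent E c x, x - (c * Complex.I) • resolvent E c x) ∈ E.graph := by
  have h : ∃ R : K →L[ℂ] K, ∀ x, (R x, x - (c * Complex.I) • R x) ∈ E.graph := by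
    choose u v huv hx using exists_resolvent hE hc
    have key : ∀ a b x, (a, b) ∈ E.graph → b + (c * Complex.I) • a = x → u x = a := by
      intro a b x hab hbx
      have h1 : (u x - a, v x - b) ∈ E.graph := E.graph.sub_mem (huv x) hab
      have h2 := norm_sq_add_smul (inner_graph_comm hE h1 h1) hc
      have h3 : v x - b + (c * Complex.I) • (u x - a) = 0 := by
        rw [smul_sub, sub_add_sub_comm, hx, hbx, sub_self]
      rw [h3] at h2
      simp only [norm_zero] at h2
      have h4 : ‖u x - a‖ ^ 2 = 0 := by nlinarith [sq_nonneg ‖v x - b‖, sq_nonneg ‖u x - a‖]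
      exact sub_eq_zero.1 (norm_eq_zero.1 (pow_eq_zero_iff two_ne_zero |>.1 h4))
    let R : K →ₗ[ℂ] K :=
      { toFun := u
        map_add' := fun x y => key _ _ _ (E.graph.add_mem (huv x) (huv y)) (by
          simp only [smul_add]
          rw [add_add_add_comm]
          simp only [hx])
        map_smul' := fun a x => key _ _ _ (E.graph.smul_mem a (huv x)) (by
          simp only [RingHom.id_apply]
          rw [smul_comm, ← smul_add, hx]) }
    refine ⟨R.mkContinuous 1 fun x => ?_, fun x => ?_⟩
    · have h2 := norm_sq_add_smul (inner_graph_comm hE (huv x) (huv x)) hc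
      rw [hx] at h2
      rw [one_mul]
      exact abs_le_of_sq_le_sq' (by
        change ‖u x‖ ^ 2 ≤ _
        nlinarith [sq_nonneg ‖v x‖]) (norm_nonneg _) |>.2
    · have := huv x
      rw [eq_sub_of_add_eq (hx x)] at this
      exact this
  rw [resolvent, dif_pos h]
  exact h.choose_spec x

theorem resolvent_eq {E : K →ₗ.[ℂ] K} (hE : IsSelfAdjoint E) {c : ℝ} (hc : c ^ 2 = 1) {u v : K}
    (h : (u, v) ∈ E.graph) : resolvent E c (v + (c * Complex.I) • u) = u := by
  have h0 := mem_graph_resolvent hE hc (v + (c * Complex.I) • u)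
  set w := resolvent E c (v + (c * Complex.I) • u)
  have h1 : (w - u, v + (c * Complex.I) • u - (c * Complex.I) • w - v) ∈ E.graph :=
    E.graph.sub_mem h0 h
  have h2 := norm_sq_add_smul (inner_graph_comm hE h1 h1) hc
  have h3 : (v + (c * Complex.I) • u - (c * Complex.I) • w - v) +
      (c * Complex.I) • (w - u) = 0 := by
    rw [smul_sub]; abel
  rw [h3, norm_zero] at h2
  have h4 : ‖w - u‖ ^ 2 = 0 := by
    nlinarith [sq_nonneg ‖w - u‖,
      sq_nonneg ‖v + (c * Complex.I) • u - (c * Complex.I) • w - v‖]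
  exact sub_eq_zero.1 (norm_eq_zero.1 (pow_eq_zero_iff two_ne_zero |>.1 h4))

theorem norm_resolvent_apply_le {E : K →ₗ.[ℂ] K} (hE : IsSelfAdjoint E) {c : ℝ} (hc : c ^ 2 = 1)
    (x : K) : ‖resolvent E c x‖ ≤ ‖x‖ := by
  have h := mem_graph_resolvent hE hc x
  have h2 := norm_sq_add_smul (inner_graph_comm hE h h) hc
  rw [sub_add_cancel] at h2
  refine abs_le_of_sq_le_sq' ?_ (norm_nonneg _) |>.2
  nlinarith [sq_nonneg ‖x - (c * Complex.I) • resolvent E c x‖]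

theorem star_resolvent {E : K →ₗ.[ℂ] K} (hE : IsSelfAdjoint E) {c : ℝ} (hc : c ^ 2 = 1) :
    star (resolvent E c) = resolvent E (-c) := by
  rw [ContinuousLinearMap.star_eq_adjoint]
  symm
  rw [ContinuousLinearMap.eq_adjoint_iff]
  intro x y
  have hc' : (-c) ^ 2 = 1 := by rw [neg_sq, hc]
  have h1 := mem_graph_resolvent hE hc' x
  have h2 := mem_graph_resolvent hE hc y
  have h3 := inner_graph_comm hE h1 h2
  have h4 := inner_graph_comm hE h2 h1
  rw [inner_sub_left, inner_smul_left, inner_sub_right, inner_smul_right] at h4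
  simp only [map_mul, map_neg, Complex.conj_ofReal, Complex.conj_I, Complex.ofReal_neg] at h4
  linear_combination -h4

/-- Uniqueness in `resolventSq_spec`. -/
theorem resolventSq_eq {E : K →ₗ.[ℂ] K} (hE : IsSelfAdjoint E) {u y z : K}
    (h1 : (u, y) ∈ E.graph) (h2 : (y, z) ∈ E.graph) : resolventSq E (u + z) = u := by
  obtain ⟨y', z', h1', h2', h3'⟩ := resolventSq_spec E hE (u + z)
  set u' := resolventSq E (u + z)
  have e1 : (u' - u, y' - y) ∈ E.graph := E.graph.sub_mem h1' h1
  have e2 : (y' - y, z' - z) ∈ E.graph := E.graph.sub_mem h2' h2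
  have e3 := inner_graph_comm hE e1 e2
  have e4 : z' - z = -(u' - u) := by
    rw [neg_sub, sub_eq_sub_iff_add_eq_add, add_comm z', h3', add_comm]
  rw [e4, inner_neg_left, inner_self_eq_norm_sq_to_K, inner_self_eq_norm_sq_to_K] at e3
  have e5 : -‖u' - u‖ ^ 2 = ‖y' - y‖ ^ 2 := by exact_mod_cast e3
  have e6 : ‖u' - u‖ ^ 2 = 0 := by nlinarith [sq_nonneg ‖u' - u‖, sq_nonneg ‖y' - y‖]
  exact sub_eq_zero.1 (norm_eq_zero.1 (pow_eq_zero_iff two_ne_zero |>.1 e6))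

theorem resolventSq_eq_mul {E : K →ₗ.[ℂ] K} (hE : IsSelfAdjoint E) {c : ℝ} (hc : c ^ 2 = 1) :
    resolventSq E = resolvent E c * resolvent E (-c) := by
  have hc' : (-c) ^ 2 = 1 := by rw [neg_sq, hc]
  ext x
  obtain ⟨y, z, h1, h2, h3⟩ := resolventSq_spec E hE x
  have hI : ((c : ℂ) * Complex.I) * (c * Complex.I) = -1 := by
    have hc' : (c : ℂ) ^ 2 = 1 := by exact_mod_cast congrArg Complex.ofReal hc
    linear_combination (Complex.I ^ 2) * hc' + Complex.I_sq
  have e0 : (y + (c * Complex.I) • resolventSq E x, z + (c * Complex.I) • y) ∈ E.graph :=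
    E.graph.add_mem h2 (E.graph.smul_mem (c * Complex.I) h1)
  have e1 := resolvent_eq hE hc' e0
  have e2 := resolvent_eq hE hc h1
  have e3 : z + (c * Complex.I) • y + (((-c : ℝ) : ℂ) * Complex.I) •
      (y + (c * Complex.I) • resolventSq E x) = x := by
    simp only [Complex.ofReal_neg, smul_add, smul_smul, neg_mul, hI, neg_smul, one_smul, neg_neg]
    conv_rhs => rw [← h3]
    abel
  rw [e3] at e1
  rw [mul_apply_eq_comp, e1, e2]

theorem resolventSq_nonneg {E : K →ₗ.[ℂ] K} (hE : IsSelfAdjoint E) : 0 ≤ resolventSq E := by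
  rw [resolventSq_eq_mul hE (c := 1) (by norm_num), ← star_resolvent hE (by norm_num)]
  exact mul_star_self_nonneg _

theorem norm_resolventSq_le {E : K →ₗ.[ℂ] K} (hE : IsSelfAdjoint E) : ‖resolventSq E‖ ≤ 1 := by
  refine ContinuousLinearMap.opNorm_le_bound _ zero_le_one fun x => ?_
  rw [resolventSq_eq_mul hE (c := 1) (by norm_num), mul_apply_eq_comp, one_mul]
  exact (norm_resolvent_apply_le hE (by norm_num) _).trans
    (norm_resolvent_apply_le hE (by norm_num) _)

/-- If `‖x‖² ≤ a (‖x‖² + ‖E x‖²)` on the domain of `E`, then `(1 + E²)⁻¹` has norm at most `a`. -/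
theorem norm_resolventSq_le_of_form {E : K →ₗ.[ℂ] K} (hE : IsSelfAdjoint E) {a : ℝ} (ha : 0 ≤ a)
    (h : ∀ x y, (x, y) ∈ E.graph → ‖x‖ ^ 2 ≤ a * (‖x‖ ^ 2 + ‖y‖ ^ 2)) : ‖resolventSq E‖ ≤ a := by
  refine ContinuousLinearMap.opNorm_le_bound _ ha fun x => ?_
  obtain ⟨y, z, h1, h2, h3⟩ := resolventSq_spec E hE x
  set u := resolventSq E x
  have e1 : inner ℂ u x = ((‖u‖ ^ 2 + ‖y‖ ^ 2 : ℝ) : ℂ) := by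
    rw [← h3, inner_add_right, ← inner_graph_comm hE h2 h1, inner_self_eq_norm_sq_to_K,
      inner_self_eq_norm_sq_to_K]
    push_cast; rfl
  have e2 : ‖u‖ ^ 2 + ‖y‖ ^ 2 ≤ ‖u‖ * ‖x‖ := by
    have := norm_inner_le_norm (𝕜 := ℂ) u x
    rw [e1, Complex.norm_real, Real.norm_of_nonneg (by positivity)] at this
    exact this
  have e3 := (h u y h1).trans (mul_le_mul_of_nonneg_left e2 ha)
  rcases (norm_nonneg u).eq_or_lt with h0 | h0
  · rw [← h0]; positivity
  · nlinarith

/-- Resolvents of selfadjoint operators with a common domain, on which the operators depend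
continuously on a parameter, are strongly continuous. -/
theorem tendsto_resolvent {X : Type*} {l : Filter X} {E : K →ₗ.[ℂ] K} (hE : IsSelfAdjoint E)
    {F : X → K →ₗ.[ℂ] K} (hF : ∀ t, IsSelfAdjoint (F t)) {c : ℝ} (hc : c ^ 2 = 1)
    (h : ∀ u v, (u, v) ∈ E.graph → ∃ w : X → K, (∀ t, (u, w t) ∈ (F t).graph) ∧
      Tendsto w l (𝓝 v)) (x : K) :
    Tendsto (fun t => resolvent (F t) c x) l (𝓝 (resolvent E c x)) := by
  have h0 := mem_graph_resolvent hE hc x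
  set u := resolvent E c x
  obtain ⟨w, hw, hlim⟩ := h _ _ h0
  rw [tendsto_iff_norm_sub_tendsto_zero]
  have h1 : Tendsto (fun t => ‖x - (w t + (c * Complex.I) • u)‖) l (𝓝 0) := by
    have := (tendsto_const_nhds (x := x)).sub (hlim.add (tendsto_const_nhds
      (x := ((c * Complex.I : ℂ)) • u)))
    rw [sub_add_cancel, sub_self] at this
    simpa using this.norm
  refine squeeze_zero (fun _ => norm_nonneg _) (fun t => ?_) h1
  have e : u = resolvent (F t) c (w t + (c * Complex.I) • u) := (resolvent_eq (hF t) hc (hw t)).symm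
  conv_lhs => rw [e]
  rw [← map_sub]
  exact norm_resolvent_apply_le (hF t) hc _

end SelfAdjoint

/-! ### Rotations and Pauli sums of selfadjoint operators -/

section Constructions
variable {K : Type*} [NormedAddCommGroup K] [InnerProductSpace ℂ K] [CompleteSpace K]

theorem mem_sandwich_graph {S T : K →L[ℂ] K} {E : K →ₗ.[ℂ] K} {x y : K} :
    (x, y) ∈ (sandwich S E T).graph ↔ ∃ v, (T x, v) ∈ E.graph ∧ S v = y := by
  rw [LinearPMap.mem_graph_iff]
  constructor
  · rintro ⟨⟨u, hu⟩, rfl, rfl⟩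
    exact ⟨_, E.mem_graph ⟨T u, hu⟩, rfl⟩
  · rintro ⟨v, hv, rfl⟩
    refine ⟨⟨x, (mem_domain_of_mem_graph hv : T x ∈ E.domain)⟩, rfl, ?_⟩
    exact congrArg S (graph_unique (E.mem_graph ⟨T x, mem_domain_of_mem_graph hv⟩) hv)

theorem mem_rotated_graph {U : K →L[ℂ] K} (hU : U ∈ unitary (K →L[ℂ] K)) {E : K →ₗ.[ℂ] K}
    {x y : K} : (x, y) ∈ (sandwich (star U) E U).graph ↔ (U x, U y) ∈ E.graph := by
  rw [mem_sandwich_graph]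
  have h1 : ∀ v, star U (U v) = v := fun v => DFunLike.congr_fun (Unitary.star_mul_self_of_mem hU) v
  have h2 : ∀ v, U (star U v) = v := fun v => DFunLike.congr_fun (Unitary.mul_star_self_of_mem hU) v
  constructor
  · rintro ⟨v, hv, rfl⟩
    rwa [h2]
  · intro h
    exact ⟨_, h, h1 _⟩

theorem inner_unitary_apply {U : K →L[ℂ] K} (hU : U ∈ unitary (K →L[ℂ] K)) (x y : K) :
    inner ℂ (U x) (U y) = inner ℂ x y := by
  rw [← ContinuousLinearMap.adjoint_inner_right, ← ContinuousLinearMap.star_eq_adjoint]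
  congr 1
  exact DFunLike.congr_fun (Unitary.star_mul_self_of_mem hU) y

theorem norm_unitary_apply {U : K →L[ℂ] K} (hU : U ∈ unitary (K →L[ℂ] K)) (x : K) :
    ‖U x‖ = ‖x‖ := by
  rw [@norm_eq_sqrt_re_inner ℂ, @norm_eq_sqrt_re_inner ℂ _ _ _ _ x, inner_unitary_apply hU]

theorem isSelfAdjoint_sandwich {U : K →L[ℂ] K} (hU : U ∈ unitary (K →L[ℂ] K)) {E : K →ₗ.[ℂ] K}
    (hE : IsSelfAdjoint E) : IsSelfAdjoint (sandwich (star U) E U) := by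
  have h1 : ∀ v, star U (U v) = v := fun v => DFunLike.congr_fun (Unitary.star_mul_self_of_mem hU) v
  have h2 : ∀ v, U (star U v) = v := fun v => DFunLike.congr_fun (Unitary.mul_star_self_of_mem hU) v
  refine isSelfAdjoint_of_surjective (fun x y u v h h' => ?_) fun c hc x => ?_
  · rw [mem_rotated_graph hU] at h h'
    have := inner_graph_comm hE h h'
    rwa [inner_unitary_apply hU, inner_unitary_apply hU] at this
  · obtain ⟨u, v, huv, h⟩ := exists_resolvent hE hc (U x)
    refine ⟨star U u, star U v, ?_, ?_⟩
    · rw [mem_rotated_graph hU, h2, h2]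
      exact huv
    · rw [← map_smul, ← map_add, h, h1]

theorem resolvent_sandwich {U : K →L[ℂ] K} (hU : U ∈ unitary (K →L[ℂ] K)) {E : K →ₗ.[ℂ] K}
    (hE : IsSelfAdjoint E) {c : ℝ} (hc : c ^ 2 = 1) (x : K) :
    resolvent (sandwich (star U) E U) c x = star U (resolvent E c (U x)) := by
  have h1 : ∀ v, star U (U v) = v := fun v => DFunLike.congr_fun (Unitary.star_mul_self_of_mem hU) v
  have h2 : ∀ v, U (star U v) = v := fun v => DFunLike.congr_fun (Unitary.mul_star_self_of_mem hU) v
  have h := mem_graph_resolvent hE hc (U x)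
  set u := resolvent E c (U x)
  have h3 : (star U u, x - (c * Complex.I) • star U u) ∈ (sandwich (star U) E U).graph := by
    rw [mem_rotated_graph hU, h2, map_sub, map_smul, h2]
    exact h
  have h4 := resolvent_eq (isSelfAdjoint_sandwich hU hE) hc h3
  rwa [sub_add_cancel] at h4

theorem mem_ofBounded_graph {T : K →L[ℂ] K} {x y : K} : (x, y) ∈ (ofBounded T).graph ↔ T x = y := by
  rw [LinearPMap.mem_graph_iff]
  constructor
  · rintro ⟨⟨u, hu⟩, rfl, rfl⟩
    rfl
  · rintro rfl
    exact ⟨⟨x, trivial⟩, rfl, rfl⟩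

theorem isSelfAdjoint_ofBounded {T : K →L[ℂ] K} (hT : IsSelfAdjoint T) :
    IsSelfAdjoint (ofBounded T) := by
  refine isSelfAdjoint_of_graph dense_univ fun x y => ?_
  rw [mem_ofBounded_graph]
  have hs : ∀ u v, inner ℂ (T u) v = inner ℂ u (T v) := fun u v => by
    rw [← ContinuousLinearMap.adjoint_inner_right, ← ContinuousLinearMap.star_eq_adjoint,
      hT.star_eq]
  constructor
  · rintro rfl u v h
    rw [← mem_ofBounded_graph.1 h, hs]
  · intro h
    refine ext_inner_left ℂ fun u => ?_
    rw [← hs]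
    exact h u _ (mem_ofBounded_graph.2 rfl)

theorem mem_pauliSum_graph {E : K →ₗ.[ℂ] K} {T : K →L[ℂ] K} {x y : Twofold K} :
    (x, y) ∈ (pauliSum E T).graph ↔
      (x 1, y 0 + Complex.I • T (x 1)) ∈ E.graph ∧ (x 0, y 1 - Complex.I • T (x 0)) ∈ E.graph := by
  rw [LinearPMap.mem_graph_iff]
  constructor
  · rintro ⟨⟨u, hu⟩, rfl, rfl⟩
    constructor
    · have := E.mem_graph ⟨u 1, hu 1⟩
      convert this using 2
      simp [pauliSum, Fin.sum_univ_two]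
    · have := E.mem_graph ⟨u 0, hu 0⟩
      convert this using 2
      simp [pauliSum, Fin.sum_univ_two]
  · rintro ⟨h1, h0⟩
    have hx : ∀ i, x i ∈ E.domain := by
      intro i
      fin_cases i
      exacts [mem_domain_of_mem_graph h0, mem_domain_of_mem_graph h1]
    refine ⟨⟨x, hx⟩, rfl, ?_⟩
    have e1 := graph_unique (E.mem_graph ⟨x 1, hx 1⟩) h1
    have e0 := graph_unique (E.mem_graph ⟨x 0, hx 0⟩) h0
    ext i
    fin_cases i
    · simpa [pauliSum, Fin.sum_univ_two, neg_smul, ← sub_eq_add_neg, sub_eq_iff_eq_add] using e1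
    · simpa [pauliSum, Fin.sum_univ_two, eq_sub_iff_add_eq] using e0

theorem isSelfAdjoint_pauliSum {E : K →ₗ.[ℂ] K} (hE : IsSelfAdjoint E) {T : K →L[ℂ] K}
    (hT : IsSelfAdjoint T) : IsSelfAdjoint (pauliSum E T) := by
  have hs : ∀ u v, inner ℂ (T u) v = inner ℂ u (T v) := fun u v => by
    rw [← ContinuousLinearMap.adjoint_inner_right, ← ContinuousLinearMap.star_eq_adjoint,
      hT.star_eq]
  refine isSelfAdjoint_of_graph ?_ fun x y => ?_
  · have hd := hE.dense_domain
    intro x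
    rw [Metric.mem_closure_iff]
    intro ε hε
    have h : x.ofLp ∈ closure (Set.univ.pi fun _ : Fin 2 => (E.domain : Set K)) := by
      rw [closure_pi_set]
      exact fun i _ => hd _
    have h2 := (PiLp.continuous_toLp 2 (fun _ : Fin 2 => K)).continuousWithinAt.mem_closure_image h
    obtain ⟨b, ⟨v, hv, rfl⟩, hb⟩ := Metric.mem_closure_iff.1 h2 ε hε
    exact ⟨_, fun i => hv i trivial, hb⟩
  · constructor
    · intro h u v h'
      obtain ⟨h1, h0⟩ := mem_pauliSum_graph.1 h
      obtain ⟨h1', h0'⟩ := mem_pauliSum_graph.1 h'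
      have e0 := inner_graph_comm hE h1 h0'
      have e1 := inner_graph_comm hE h0 h1'
      simp only [inner_add_left, inner_sub_left, inner_add_right, inner_sub_right, inner_smul_left,
        inner_smul_right, hs, Complex.conj_I] at e0 e1
      simp only [PiLp.inner_apply, Fin.sum_univ_two]
      linear_combination e0 + e1
    · intro h
      rw [mem_pauliSum_graph, mem_graph_iff_of_isSelfAdjoint hE, mem_graph_iff_of_isSelfAdjoint hE]
      constructor
      · intro u v huv
        have h3 : ((WithLp.toLp 2 ![u, 0] : Twofold K),
            (WithLp.toLp 2 ![0, v + Complex.I • T u] : Twofold K)) ∈ (pauliSum E T).graph := by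
          rw [mem_pauliSum_graph]
          refine ⟨by simp, by simpa using huv⟩
        have := h _ _ h3
        simp only [PiLp.inner_apply, Fin.sum_univ_two] at this
        simp [inner_add_left, inner_smul_left, hs] at this
        rw [inner_add_right, inner_smul_right]
        linear_combination this
      · intro u v huv
        have h3 : ((WithLp.toLp 2 ![0, u] : Twofold K),
            (WithLp.toLp 2 ![v - Complex.I • T u, 0] : Twofold K)) ∈ (pauliSum E T).graph := by
          rw [mem_pauliSum_graph]
          refine ⟨by simpa using huv, by simp⟩
        have := h _ _ h3
        simp only [PiLp.inner_apply, Fin.sum_univ_two] at this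
        simp [inner_sub_left, inner_smul_left, hs] at this
        rw [inner_sub_right, inner_smul_right]
        linear_combination this

end Constructions

/-! ### Strongly continuous fields of operators on `L²` -/

section Fields
variable {G : Type*} [TopologicalSpace G] [TopologicalSpace.MetrizableSpace G]
  [SecondCountableTopology G] [MeasurableSpace G] [BorelSpace G] (μ : Measure G)
  {K : Type*} [NormedAddCommGroup K] [InnerProductSpace ℂ K] [CompleteSpace K]
  [TopologicalSpace.SeparableSpace K]

/-- A uniformly bounded and strongly continuous field of operators. -/
structure IsBoundedField (Y : G → K →L[ℂ] K) : Prop where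
  continuous_apply : ∀ x, Continuous fun t => Y t x
  bounded : ∃ C, ∀ t x, ‖Y t x‖ ≤ C * ‖x‖

variable {μ} in
theorem aestronglyMeasurable_field {Y : G → K →L[ℂ] K} (hY : ∀ x, Continuous fun t => Y t x)
    {ξ : G → K} (hξ : AEStronglyMeasurable ξ μ) : AEStronglyMeasurable (fun t => Y t (ξ t)) μ := by
  borelize K
  have _ : SecondCountableTopology K := UniformSpace.secondCountable_of_separable K
  have h : StronglyMeasurable (Function.uncurry fun (x : K) (t : G) => Y t x) :=
    stronglyMeasurable_uncurry_of_continuous_of_stronglyMeasurable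
      (fun t => (Y t).continuous) fun x => (hY x).stronglyMeasurable
  exact (h.comp_measurable measurable_id).aestronglyMeasurable.comp_aemeasurable
    (f := fun t => (ξ t, t)) (hξ.aemeasurable.prodMk aemeasurable_id)

theorem IsBoundedField.memLp {Y : G → K →L[ℂ] K} (hY : IsBoundedField Y) (ξ : Lp K 2 μ) :
    MemLp (fun t => Y t (ξ t)) 2 μ := by
  obtain ⟨C, hC⟩ := hY.bounded
  exact (Lp.memLp ξ).of_le_mul
    (aestronglyMeasurable_field hY.continuous_apply (Lp.aestronglyMeasurable ξ))
    (Eventually.of_forall fun t => hC t _)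

/-- The decomposable operator `(Y ξ)(t) = Y_t ξ(t)` on `L²(G; K)`. -/
def fieldOp (Y : G → K →L[ℂ] K) (hY : IsBoundedField Y) : Lp K 2 μ →L[ℂ] Lp K 2 μ :=
  LinearMap.mkContinuousOfExistsBound
    { toFun := fun ξ => (hY.memLp μ ξ).toLp
      map_add' := fun ξ ζ => by
        rw [← MemLp.toLp_add]
        refine MemLp.toLp_congr _ _ ?_
        filter_upwards [Lp.coeFn_add ξ ζ] with r hr
        rw [hr]; simp
      map_smul' := fun c ξ => by
        rw [RingHom.id_apply, ← MemLp.toLp_const_smul]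
        refine MemLp.toLp_congr _ _ ?_
        filter_upwards [Lp.coeFn_smul c ξ] with r hr
        rw [hr]; simp } (by
    obtain ⟨C, hC⟩ := hY.bounded
    refine ⟨C, fun ξ => Lp.norm_le_mul_norm_of_ae_le_mul ?_⟩
    filter_upwards [(hY.memLp μ ξ).coeFn_toLp] with r hr
    exact (congrArg norm hr).trans_le (hC r _))

theorem fieldOp_ae_eq {Y : G → K →L[ℂ] K} (hY : IsBoundedField Y) (ξ : Lp K 2 μ) :
    fieldOp μ Y hY ξ =ᵐ[μ] fun t => Y t (ξ t) :=
  (hY.memLp μ ξ).coeFn_toLp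

theorem IsBoundedField.mul {Y Z : G → K →L[ℂ] K} (hY : IsBoundedField Y) (hZ : IsBoundedField Z) :
    IsBoundedField fun t => Y t * Z t := by
  obtain ⟨C, hC⟩ := hY.bounded
  obtain ⟨C', hC'⟩ := hZ.bounded
  refine ⟨fun x => ?_, C * C', fun t x => ?_⟩
  · rw [continuous_iff_continuousAt]
    intro t
    have h1 : Tendsto (fun s => Y s (Z s x - Z t x)) (𝓝 t) (𝓝 0) := by
      have h2 : Tendsto (fun s => C * ‖Z s x - Z t x‖) (𝓝 t) (𝓝 (C * ‖Z t x - Z t x‖)) :=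
        ((((hZ.continuous_apply x).tendsto t).sub tendsto_const_nhds).norm).const_mul C
      rw [sub_self, norm_zero, mul_zero] at h2
      exact squeeze_zero_norm (fun s => hC s _) h2
    have h3 := h1.add ((hY.continuous_apply (Z t x)).tendsto t)
    simp only [map_sub, sub_add_cancel, zero_add] at h3
    exact h3
  · rcases (norm_nonneg x).eq_or_lt with h0 | h0
    · have : x = 0 := norm_eq_zero.1 h0.symm
      simp [this]
    · have hC0 : 0 ≤ C ∨ ∀ y : K, y = 0 := by
        by_contra! h
        obtain ⟨h1, y, hy⟩ := h
        have h2 := hC t y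
        have h3 := norm_pos_iff.2 hy
        nlinarith [norm_nonneg (Y t y)]
      rcases hC0 with h | h
      · rw [mul_assoc]
        exact (hC t _).trans (mul_le_mul_of_nonneg_left (hC' t x) h)
      · simp [h x]

/-- A field of selfadjoint operators whose resolvents are strongly continuous defines a selfadjoint
operator on `L²`: the field of resolvents inverts it after adding `±i`. -/
theorem isSelfAdjoint_fiberwise {E : G → K →ₗ.[ℂ] K} (hE : ∀ t, IsSelfAdjoint (E t))
    (hc : ∀ c : ℝ, c ^ 2 = 1 → ∀ x, Continuous fun t => resolvent (E t) c x) :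
    IsSelfAdjoint (fiberwise μ E) := by
  refine isSelfAdjoint_of_surjective (fun x y u v h h' => ?_) fun c h1 ξ => ?_
  · rw [mem_fiberwise_graph] at h h'
    rw [L2.inner_def, L2.inner_def]
    refine integral_congr_ae ?_
    filter_upwards [h, h'] with t ht ht'
    exact inner_graph_comm (hE t) ht ht'
  · have hR : IsBoundedField fun t => resolvent (E t) c :=
      ⟨hc c h1, 1, fun t x => by rw [one_mul]; exact norm_resolvent_apply_le (hE t) h1 x⟩
    refine ⟨fieldOp μ _ hR ξ, ξ - (c * Complex.I : ℂ) • fieldOp μ _ hR ξ, ?_, by simp⟩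
    rw [mem_fiberwise_graph]
    filter_upwards [fieldOp_ae_eq μ hR ξ, Lp.coeFn_sub ξ ((c * Complex.I : ℂ) • fieldOp μ _ hR ξ),
      Lp.coeFn_smul (c * Complex.I : ℂ) (fieldOp μ _ hR ξ)] with t h2 h3 h4
    rw [h3, Pi.sub_apply, h4, Pi.smul_apply, h2]
    exact mem_graph_resolvent (hE t) h1 _

/-- Both sides solve `(1 + E²) y = ξ` fiberwise. -/
theorem resolventSq_fiberwise {E : G → K →ₗ.[ℂ] K} (hE : ∀ t, IsSelfAdjoint (E t))
    (hF : IsSelfAdjoint (fiberwise μ E)) (ξ : Lp K 2 μ) :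
    resolventSq (fiberwise μ E) ξ =ᵐ[μ] fun t => resolventSq (E t) (ξ t) := by
  obtain ⟨y, z, h1, h2, h3⟩ := resolventSq_spec _ hF ξ
  rw [mem_fiberwise_graph] at h1 h2
  have h4 := Lp.coeFn_add (resolventSq (fiberwise μ E) ξ) z
  rw [h3] at h4
  filter_upwards [h1, h2, h4] with t h1 h2 h4
  rw [h4]
  exact (resolventSq_eq (hE t) h1 h2).symm

end Fields

/-! ### Powers of decomposable operators -/

section Powers
variable {K : Type*} [NormedAddCommGroup K] [InnerProductSpace ℂ K] [CompleteSpace K]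

/-- The function `x ↦ x ^ s` on `[0, 1]` is a uniform limit of polynomials without constant term. -/
theorem exists_polynomial_near_rpow {s : ℝ} (hs : 0 < s) {ε : ℝ} (hε : 0 < ε) :
    ∃ q : Polynomial ℝ, ∀ x ∈ Set.Icc (0 : ℝ) 1, |(q * Polynomial.X).eval x - x ^ s| ≤ ε := by
  obtain ⟨p, hp⟩ := exists_polynomial_near_of_continuousOn 0 1 (fun x => x ^ s)
    (Real.continuous_rpow_const hs.le).continuousOn (ε / 2) (half_pos hε)
  -- `divX` drops the constant term, which is small since `0 ^ s = 0`
  refine ⟨p.divX, fun x hx => ?_⟩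
  have h0 := hp 0 (by simp)
  rw [Real.zero_rpow hs.ne', sub_zero] at h0
  have h1 := hp x hx
  have h2 : (p.divX * Polynomial.X).eval x = p.eval x - p.eval 0 := by
    conv_rhs => rw [← p.divX_mul_X_add]
    simp
  rw [h2, abs_le]
  rw [abs_lt] at h0 h1
  constructor <;> linarith

/-- The power `T ^ s` of a bounded operator by functional calculus, meaningful for `0 ≤ T`. -/
def opPow (T : K →L[ℂ] K) (s : ℝ) : K →L[ℂ] K := T ^ s

theorem norm_aeval_sub_rpow_le {T : K →L[ℂ] K} (hT : 0 ≤ T) (hT1 : ‖T‖ ≤ 1) {s : ℝ} (hs : 0 < s)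
    {ε : ℝ} (hε : 0 ≤ ε) {q : Polynomial ℝ}
    (hq : ∀ x ∈ Set.Icc (0 : ℝ) 1, |q.eval x - x ^ s| ≤ ε) :
    ‖Polynomial.aeval T q - opPow T s‖ ≤ ε := by
  have hsa : IsSelfAdjoint T := hT.isSelfAdjoint
  rw [opPow, CFC.rpow_eq_cfc_real hT, ← cfc_polynomial q T hsa,
    ← cfc_sub (fun x => q.eval x) (fun x => x ^ s) T q.continuous.continuousOn
      (Real.continuous_rpow_const hs.le).continuousOn]
  · refine norm_cfc_le hε fun x hx => hq x ⟨spectrum_nonneg_of_nonneg hT hx, ?_⟩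
    have := spectrum.norm_le_norm_mul_of_mem hx
    have h1 : ‖(1 : K →L[ℂ] K)‖ ≤ 1 := ContinuousLinearMap.norm_id_le
    have h2 : ‖x‖ ≤ 1 := this.trans (mul_le_one₀ hT1 (norm_nonneg _) h1)
    exact (le_abs_self x).trans h2

theorem norm_rpow_le {T : K →L[ℂ] K} (hT : 0 ≤ T) {a : ℝ} (ha : ‖T‖ ≤ a) {s : ℝ} (hs : 0 < s) :
    ‖opPow T s‖ ≤ a ^ s := by
  rw [opPow, CFC.rpow_eq_cfc_real hT]
  refine norm_cfc_le (Real.rpow_nonneg ((norm_nonneg _).trans ha) _) fun x hx => ?_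
  have h0 := spectrum_nonneg_of_nonneg hT hx
  have := spectrum.norm_le_norm_mul_of_mem hx
  have h1 : ‖(1 : K →L[ℂ] K)‖ ≤ 1 := ContinuousLinearMap.norm_id_le
  have h2 : ‖x‖ ≤ a := (this.trans (mul_le_of_le_one_right (norm_nonneg _) h1)).trans ha
  rw [Real.norm_of_nonneg (Real.rpow_nonneg h0 _)]
  exact Real.rpow_le_rpow h0 ((le_abs_self x).trans h2) hs.le

variable {G : Type*} [TopologicalSpace G] [TopologicalSpace.MetrizableSpace G]
  [SecondCountableTopology G] [MeasurableSpace G] [BorelSpace G] (μ : Measure G)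
  [TopologicalSpace.SeparableSpace K]

theorem aeval_fieldOp {Y : G → K →L[ℂ] K} (hY : IsBoundedField Y) (q : Polynomial ℝ)
    (ξ : Lp K 2 μ) :
    Polynomial.aeval (fieldOp μ Y hY) q ξ =ᵐ[μ] fun t => Polynomial.aeval (Y t) q (ξ t) := by
  induction q using Polynomial.induction_on' generalizing ξ with
  | add p q hp hq =>
    rw [map_add, _root_.add_apply]
    filter_upwards [hp ξ, hq ξ, Lp.coeFn_add (Polynomial.aeval (fieldOp μ Y hY) p ξ)
      (Polynomial.aeval (fieldOp μ Y hY) q ξ)] with t h1 h2 h3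
    rw [h3, Pi.add_apply, h1, h2, map_add, _root_.add_apply]
  | monomial n a =>
    induction n generalizing ξ with
    | zero =>
      simp only [Polynomial.monomial_zero_left, Polynomial.aeval_C,
        Algebra.algebraMap_eq_smul_one]
      filter_upwards [Lp.coeFn_smul a ξ] with t ht
      exact ht
    | succ n ih =>
      have e : ∀ {T : Type _} [Ring T] [Algebra ℝ T] (x : T),
          Polynomial.aeval x (Polynomial.monomial (n + 1) a) =
            Polynomial.aeval x (Polynomial.monomial n a) * x := by
        intro T _ _ x
        simp only [Polynomial.aeval_monomial, pow_succ, mul_assoc]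
      rw [e, mul_apply_eq_comp]
      filter_upwards [ih (fieldOp μ Y hY ξ), fieldOp_ae_eq μ hY ξ] with t h1 h2
      rw [h1, h2]
      simp only [Polynomial.aeval_monomial, pow_succ, ← mul_assoc]
      rfl

theorem IsBoundedField.aeval {Y : G → K →L[ℂ] K} (hY : IsBoundedField Y) (q : Polynomial ℝ)
    (x : K) : Continuous fun t => Polynomial.aeval (Y t) q x := by
  induction q using Polynomial.induction_on' generalizing x with
  | add p q hp hq =>
    simp only [map_add, _root_.add_apply]
    exact (hp x).add (hq x)
  | monomial n a =>
    have h : IsBoundedField fun t => Y t ^ n := by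
      induction n with
      | zero => exact ⟨fun x => by simpa using continuous_const, 1, fun t x => by simp⟩
      | succ n ih => simpa only [pow_succ] using ih.mul hY
    have := (h.continuous_apply x).const_smul a
    simp only [Polynomial.aeval_monomial, Algebra.algebraMap_eq_smul_one, smul_mul_assoc, one_mul]
    exact this

theorem IsBoundedField.rpow {Y : G → K →L[ℂ] K} (hY : IsBoundedField Y) (h0 : ∀ t, 0 ≤ Y t)
    (h1 : ∀ t, ‖Y t‖ ≤ 1) {s : ℝ} (hs : 0 < s) : IsBoundedField fun t => opPow (Y t) s := by
  refine ⟨fun x => ?_, 1, fun t x => ?_⟩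
  · refine continuous_of_uniform_approx_of_continuous fun u hu => ?_
    obtain ⟨ε, hε, hu⟩ := Metric.mem_uniformity_dist.1 hu
    have hδ : 0 < ε / (2 * (‖x‖ + 1)) := by positivity
    obtain ⟨q, hq⟩ := exists_polynomial_near_rpow hs hδ
    refine ⟨_, hY.aeval (q * Polynomial.X) x, fun t => hu ?_⟩
    rw [dist_comm, dist_eq_norm, ← _root_.sub_apply]
    have h2 := norm_aeval_sub_rpow_le (h0 t) (h1 t) hs hδ.le hq
    calc _ ≤ ε / (2 * (‖x‖ + 1)) * ‖x‖ := ContinuousLinearMap.le_of_opNorm_le _ h2 x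
      _ < ε := by
        rw [div_mul_eq_mul_div, div_lt_iff₀ (by positivity)]
        nlinarith [norm_nonneg x]
  · have h2 := norm_rpow_le (h0 t) (h1 t) hs
    rw [Real.one_rpow] at h2
    exact ContinuousLinearMap.le_of_opNorm_le _ h2 x

/-- Powers of a decomposable operator are computed fiberwise, because polynomials are and the
approximation of the power by polynomials is uniform over the fibers. -/
theorem rpow_fieldOp {Y : G → K →L[ℂ] K} (hY : IsBoundedField Y) (h0 : ∀ t, 0 ≤ Y t)
    (h1 : ∀ t, ‖Y t‖ ≤ 1) (h0' : 0 ≤ fieldOp μ Y hY) (h1' : ‖fieldOp μ Y hY‖ ≤ 1) {s : ℝ}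
    (hs : 0 < s) : opPow (fieldOp μ Y hY) s = fieldOp μ _ (hY.rpow h0 h1 hs) := by
  ext1 ξ
  refine eq_of_forall_dist_le fun ε hε => ?_
  have hδ : 0 < ε / (2 * (‖ξ‖ + 1)) := by positivity
  obtain ⟨q, hq⟩ := exists_polynomial_near_rpow hs hδ
  set δ := ε / (2 * (‖ξ‖ + 1))
  have h2 := ContinuousLinearMap.le_of_opNorm_le _ (norm_aeval_sub_rpow_le h0' h1' hs hδ.le hq) ξ
  have h3 : ‖Polynomial.aeval (fieldOp μ Y hY) (q * Polynomial.X) ξ -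
      fieldOp μ _ (hY.rpow h0 h1 hs) ξ‖ ≤ δ * ‖ξ‖ := by
    refine Lp.norm_le_mul_norm_of_ae_le_mul ?_
    filter_upwards [aeval_fieldOp μ hY (q * Polynomial.X) ξ, fieldOp_ae_eq μ (hY.rpow h0 h1 hs) ξ,
      Lp.coeFn_sub (Polynomial.aeval (fieldOp μ Y hY) (q * Polynomial.X) ξ)
        (fieldOp μ _ (hY.rpow h0 h1 hs) ξ)] with t h4 h5 h6
    rw [h6, Pi.sub_apply, h4, h5, ← _root_.sub_apply]
    exact ContinuousLinearMap.le_of_opNorm_le _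
      (norm_aeval_sub_rpow_le (h0 t) (h1 t) hs hδ.le hq) _
  rw [_root_.sub_apply] at h2
  refine (dist_triangle_left _ _
    (Polynomial.aeval (fieldOp μ Y hY) (q * Polynomial.X) ξ)).trans ?_
  rw [dist_eq_norm, dist_eq_norm]
  refine (add_le_add h2 h3).trans ?_
  have h7 : δ * ‖ξ‖ ≤ ε / 2 := by
    rw [div_mul_eq_mul_div, div_le_iff₀ (by positivity)]
    nlinarith [norm_nonneg ξ]
  linarith

/-- The powers of `1 + E²` act fiberwise for a decomposable selfadjoint operator `E`. -/
theorem bracketPow_fiberwise {E : G → K →ₗ.[ℂ] K} (hE : ∀ t, IsSelfAdjoint (E t))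
    (hc : ∀ c : ℝ, c ^ 2 = 1 → ∀ x, Continuous fun t => resolvent (E t) c x) {s : ℝ} (hs : 0 < s) :
    ∃ h : IsBoundedField fun t => bracketPow (E t) s,
      bracketPow (fiberwise μ E) s = fieldOp μ _ h := by
  have hF := isSelfAdjoint_fiberwise μ hE hc
  have hR : ∀ c : ℝ, c ^ 2 = 1 → IsBoundedField fun t => resolvent (E t) c := fun c h1 =>
    ⟨hc c h1, 1, fun t x => by rw [one_mul]; exact norm_resolvent_apply_le (hE t) h1 x⟩
  have hS : IsBoundedField fun t => resolventSq (E t) := by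
    have := (hR 1 (by norm_num)).mul (hR (-1) (by norm_num))
    simpa only [← resolventSq_eq_mul (hE _) (c := 1) (by norm_num)] using this
  have e : resolventSq (fiberwise μ E) = fieldOp μ _ hS := by
    ext1 ξ
    exact Lp.ext ((resolventSq_fiberwise μ hE hF ξ).trans (fieldOp_ae_eq μ hS ξ).symm)
  refine ⟨hS.rpow (fun t => resolventSq_nonneg (hE t)) (fun t => norm_resolventSq_le (hE t)) hs, ?_⟩
  change opPow (resolventSq (fiberwise μ E)) s = _
  rw [e]
  exact rpow_fieldOp μ hS (fun t => resolventSq_nonneg (hE t)) (fun t => norm_resolventSq_le (hE t))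
    (e ▸ resolventSq_nonneg hF) (e ▸ norm_resolventSq_le hF) hs

end Powers

/-! ### Inversion of Haar measure -/

section Inversion
variable {G : Type*} [Group G] [TopologicalSpace G] [IsTopologicalGroup G] [LocallyCompactSpace G]
  [T2Space G] [SecondCountableTopology G] [MeasurableSpace G] [BorelSpace G]

theorem modularFun_mul (r s : G) : modularFun (r * s) = modularFun r * modularFun s := by
  simp [modularFun, mul_comm]

theorem modularFun_one : modularFun (1 : G) = 1 := by simp [modularFun]

theorem modularFun_inv (r : G) : modularFun r⁻¹ = (modularFun r)⁻¹ := by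
  refine eq_inv_of_mul_eq_one_left ?_
  rw [← modularFun_mul, inv_mul_cancel, modularFun_one]

theorem measurable_modularCharacter : Measurable (Measure.modularCharacter : G → NNReal) := by
  have h : Measurable fun r : G => (Measure.modularCharacter r : ℝ) := by
    have h0 := (continuous_modularFun (G := G)).measurable.inv
    have e : (fun r : G => (Measure.modularCharacter r : ℝ)) = modularFun⁻¹ := by
      funext r; simp [modularFun]
    rwa [e]
  exact measurable_coe_nnreal_real_iff.1 h

variable (μ : Measure G) [μ.IsHaarMeasure]

/-- The behaviour of Haar measure under inversion. Integrate `h(s⁻¹) φ(x s)` over `s` and `x`, with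
`φ` the indicator function of a compact set of positive measure, in both orders. -/
theorem lintegral_inv_mul_modularCharacter {h : G → ℝ≥0∞} (hh : Measurable h) :
    ∫⁻ s, h s⁻¹ * (Measure.modularCharacter s : NNReal) ∂μ = ∫⁻ s, h s ∂μ := by
  obtain ⟨C, hC, hC1⟩ := exists_compact_mem_nhds (1 : G)
  have hc0 : μ C ≠ 0 := (Measure.measure_pos_of_mem_nhds μ hC1).ne'
  have hct : μ C ≠ ∞ := hC.measure_lt_top.ne
  let φ : G → ℝ≥0∞ := C.indicator 1
  have hφ : Measurable φ := measurable_one.indicator hC.measurableSet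
  have hφi : ∫⁻ s, φ s ∂μ = μ C := lintegral_indicator_one hC.measurableSet
  have e1 : ∀ s, ∫⁻ x, φ (x * s) ∂μ = (Measure.modularCharacter s : NNReal) * μ C := by
    intro s
    have h1 := Measure.map_right_mul_eq_modularCharacterFun_smul μ s
    have h2 := lintegral_map (μ := μ) hφ (measurable_mul_const s)
    rw [← h2, h1, lintegral_smul_measure, hφi]
    rfl
  have e2 : ∫⁻ s, ∫⁻ x, h s⁻¹ * φ (x * s) ∂μ ∂μ =
      (∫⁻ s, h s⁻¹ * (Measure.modularCharacter s : NNReal) ∂μ) * μ C := by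
    rw [← lintegral_mul_const' _ _ hct]
    refine lintegral_congr fun s => ?_
    rw [lintegral_const_mul (h s⁻¹) (f := fun x => φ (x * s)) (hφ.comp (measurable_mul_const s)),
      e1, mul_assoc]
  have e3 : ∫⁻ s, ∫⁻ x, h s⁻¹ * φ (x * s) ∂μ ∂μ = (∫⁻ s, h s ∂μ) * μ C := by
    rw [lintegral_lintegral_swap]
    · have e4 : ∀ x, ∫⁻ s, h s⁻¹ * φ (x * s) ∂μ = ∫⁻ s, h (s⁻¹ * x) * φ s ∂μ := by
        intro x
        rw [← lintegral_mul_left_eq_self _ x⁻¹]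
        refine lintegral_congr fun s => ?_
        simp
      simp_rw [e4]
      rw [lintegral_lintegral_swap]
      · have e5 : ∀ s, ∫⁻ x, h (s⁻¹ * x) * φ s ∂μ = (∫⁻ x, h x ∂μ) * φ s := by
          intro s
          rw [lintegral_mul_const (φ s) (f := fun x => h (s⁻¹ * x))
            (hh.comp (measurable_const_mul _)), lintegral_mul_left_eq_self h]
        simp_rw [e5]
        rw [lintegral_const_mul _ hφ, hφi]
      · exact ((hh.comp (measurable_snd.inv.mul measurable_fst)).mul
          (hφ.comp measurable_snd)).aemeasurable
    · exact ((hh.comp measurable_fst.inv).mul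
        (hφ.comp (measurable_snd.mul measurable_fst))).aemeasurable
  rw [e2] at e3
  exact (ENNReal.mul_left_inj hc0 hct).1 e3

theorem map_inv_eq_withDensity :
    μ.map Inv.inv = μ.withDensity fun s => (Measure.modularCharacter s : NNReal) := by
  refine Measure.ext_of_lintegral _ fun h hh => ?_
  have hm : Measurable fun s : G => ((Measure.modularCharacter s : NNReal) : ℝ≥0∞) :=
    measurable_modularCharacter.coe_nnreal_ennreal
  rw [lintegral_map hh measurable_inv, lintegral_withDensity_eq_lintegral_mul _ hm hh,
    ← lintegral_inv_mul_modularCharacter μ (hm.mul hh)]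
  refine lintegral_congr fun s => ?_
  rw [Pi.mul_apply, mul_right_comm, ← ENNReal.coe_mul, ← map_mul, inv_mul_cancel, map_one,
    ENNReal.coe_one, one_mul]

/-- `∫ h(s⁻¹) dμ(s) = ∫ Δ(s)⁻¹ h(s) dμ(s)`. -/
theorem integral_comp_inv {E : Type*} [NormedAddCommGroup E] [NormedSpace ℝ E] (h : G → E) :
    ∫ s, h s⁻¹ ∂μ = ∫ s, (modularFun s)⁻¹ • h s ∂μ := by
  have e := integral_map_equiv (μ := μ) (MeasurableEquiv.inv G) h
  change ∫ y, h y ∂(Measure.map Inv.inv μ) = ∫ x, h x⁻¹ ∂μ at e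
  rw [← e, map_inv_eq_withDensity,
    integral_withDensity_eq_integral_smul measurable_modularCharacter]
  simp [modularFun, NNReal.smul_def]

end Inversion

/-! ### The regular representation -/

section Regular
variable {G 𝔸 : Type*} [Group G] [TopologicalSpace G] [NonUnitalCStarAlgebra 𝔸]
  [IsTopologicalGroup G] [LocallyCompactSpace G] [T2Space G] [SecondCountableTopology G]
  [MeasurableSpace G] [BorelSpace G] (μ : Measure G) [μ.IsHaarMeasure]
  {K : Type*} [NormedAddCommGroup K] [InnerProductSpace ℂ K] [CompleteSpace K]
  {𝓢 : CStarDynamics G 𝔸} (R : CovariantRep 𝓢 K)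

theorem inducedRep_ae_eq (a : 𝔸) (ξ : Lp K 2 μ) :
    inducedRep μ R a ξ =ᵐ[μ] fun r => R.ρ (𝓢.act r⁻¹ a) (ξ r) :=
  (R.memLp_rep μ a ξ).coeFn_toLp

theorem norm_inducedRep_apply_le (a : 𝔸) (ξ : Lp K 2 μ) : ‖inducedRep μ R a ξ‖ ≤ ‖a‖ * ‖ξ‖ := by
  refine Lp.norm_le_mul_norm_of_ae_le_mul ?_
  filter_upwards [inducedRep_ae_eq μ R a ξ] with r hr
  rw [hr]
  exact ContinuousLinearMap.le_of_opNorm_le _ (R.norm_rep_le a _) _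

theorem inducedRep_mul (a b : 𝔸) (ξ : Lp K 2 μ) :
    inducedRep μ R (a * b) ξ = inducedRep μ R a (inducedRep μ R b ξ) := by
  refine Lp.ext ?_
  filter_upwards [inducedRep_ae_eq μ R (a * b) ξ, inducedRep_ae_eq μ R b ξ,
    inducedRep_ae_eq μ R a (inducedRep μ R b ξ)] with r h1 h2 h3
  rw [h1, h3, h2, map_mul, map_mul]
  rfl

theorem inner_inducedRep_left (a : 𝔸) (ξ ζ : Lp K 2 μ) :
    inner ℂ (inducedRep μ R a ξ) ζ = inner ℂ ξ (inducedRep μ R (star a) ζ) := by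
  rw [L2.inner_def, L2.inner_def]
  refine integral_congr_ae ?_
  filter_upwards [inducedRep_ae_eq μ R a ξ, inducedRep_ae_eq μ R (star a) ζ] with r h1 h2
  rw [h1, h2, map_star, map_star, ContinuousLinearMap.star_eq_adjoint,
    ContinuousLinearMap.adjoint_inner_right]

theorem norm_leftTranslate (s : G) (ξ : Lp K 2 μ) : ‖leftTranslate μ s ξ‖ = ‖ξ‖ :=
  DomMulAct.norm_smul_Lp _ _

theorem leftTranslate_one (ξ : Lp K 2 μ) : leftTranslate μ 1 ξ = ξ := by
  simp [leftTranslate]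

theorem leftTranslate_mul (s t : G) (ξ : Lp K 2 μ) :
    leftTranslate μ (s * t) ξ = leftTranslate μ s (leftTranslate μ t ξ) := by
  simp only [leftTranslate, smul_smul, mul_inv_rev, DomMulAct.mk_mul]

/-- The left translation `λ_s` as a bounded operator. -/
def translateL (s : G) : Lp K 2 μ →L[ℂ] Lp K 2 μ :=
  LinearMap.mkContinuous
    { toFun := leftTranslate μ s
      map_add' := fun ξ ζ => smul_add _ _ _
      map_smul' := fun c ξ => smul_comm _ _ _ } 1 fun ξ => by
    rw [one_mul]; exact (norm_leftTranslate μ s ξ).le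

@[simp] theorem translateL_apply (s : G) (ξ : Lp K 2 μ) :
    translateL μ s ξ = leftTranslate μ s ξ := rfl

theorem ae_comp_left {P : G → Prop} (s : G) (h : ∀ᵐ r ∂μ, P r) : ∀ᵐ r ∂μ, P (s⁻¹ * r) :=
  (measurePreserving_mul_left μ s⁻¹).quasiMeasurePreserving.ae h

theorem inner_leftTranslate_left (s : G) (ξ ζ : Lp K 2 μ) :
    inner ℂ (leftTranslate μ s ξ) ζ = inner ℂ ξ (leftTranslate μ s⁻¹ ζ) := by
  rw [L2.inner_def, L2.inner_def,
    ← integral_mul_left_eq_self (fun r => inner ℂ (ξ r) (leftTranslate μ s⁻¹ ζ r)) s⁻¹]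
  have h1 := ae_comp_left μ s (leftTranslate_ae_eq μ s⁻¹ ζ)
  refine integral_congr_ae ?_
  filter_upwards [leftTranslate_ae_eq μ s ξ, h1] with r h2 h3
  rw [h2, h3]
  simp

theorem leftTranslate_inducedRep (s : G) (a : 𝔸) (ξ : Lp K 2 μ) :
    leftTranslate μ s (inducedRep μ R a ξ) = inducedRep μ R (𝓢.act s a) (leftTranslate μ s ξ) := by
  refine Lp.ext ?_
  filter_upwards [leftTranslate_ae_eq μ s (inducedRep μ R a ξ), leftTranslate_ae_eq μ s ξ,
    inducedRep_ae_eq μ R (𝓢.act s a) (leftTranslate μ s ξ),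
    ae_comp_left μ s (inducedRep_ae_eq μ R a ξ)] with r h1 h2 h3 h4
  rw [h1, h4, h3, h2, mul_inv_rev, inv_inv, map_mul]
  rfl

theorem regularRep_apply (f : C_c(G, 𝔸)) (ξ : Lp K 2 μ) :
    regularRep μ R f ξ = ∫ s, inducedRep μ R (f s) (leftTranslate μ s ξ) ∂μ := rfl

theorem integrable_norm_compactlySupported (f : C_c(G, 𝔸)) : Integrable (fun s => ‖f s‖) μ :=
  (f.continuous.integrable_of_hasCompactSupport f.hasCompactSupport).norm

theorem norm_regularRep_le (f : C_c(G, 𝔸)) : ‖regularRep μ R f‖ ≤ ∫ s, ‖f s‖ ∂μ := by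
  refine ContinuousLinearMap.opNorm_le_bound _ (integral_nonneg fun _ => norm_nonneg _) fun ξ => ?_
  rw [regularRep_apply, ← integral_mul_const]
  refine norm_integral_le_of_norm_le ((integrable_norm_compactlySupported μ f).mul_const _)
    (Eventually.of_forall fun s => ?_)
  have h := norm_inducedRep_apply_le μ R (f s) (leftTranslate μ s ξ)
  rwa [norm_leftTranslate] at h

theorem closure_regularRep_image {A : NonUnitalStarSubalgebra ℂ 𝔸} {𝒜 : Submodule ℂ C_c(G, 𝔸)}
    (h𝒜 : IsDenseStarSubalgebra μ 𝓢 A 𝒜) :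
    closure (regularRep μ R '' (𝒜 : Set C_c(G, 𝔸))) = reducedCrossedProduct μ R := by
  refine Set.Subset.antisymm (closure_mono (Set.image_subset_range _ _))
    (closure_minimal ?_ isClosed_closure)
  rintro _ ⟨f, rfl⟩
  rw [Metric.mem_closure_iff]
  intro ε hε
  obtain ⟨g, hg, hfg⟩ := h𝒜.dense f ε hε
  refine ⟨_, ⟨g, hg, rfl⟩, ?_⟩
  rw [dist_eq_norm, ← map_sub]
  exact (norm_regularRep_le μ R (f - g)).trans_lt hfg

theorem continuous_uncurry_conv (f g : C_c(G, 𝔸)) :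
    Continuous fun q : G × G => f q.2 * 𝓢.act q.2 (g (q.2⁻¹ * q.1)) :=
  (f.continuous.comp continuous_snd).mul (𝓢.continuous_act_apply continuous_snd
    (g.continuous.comp (by fun_prop)))

/-- The regular representation is multiplicative: Fubini and left invariance. -/
theorem regularRep_conv (f g : C_c(G, 𝔸)) :
    regularRep μ R (conv μ 𝓢 f g) = regularRep μ R f * regularRep μ R g := by
  ext1 ξ
  rw [mul_apply_eq_comp]
  have e1 : ∀ t, inducedRep μ R (conv μ 𝓢 f g t) (leftTranslate μ t ξ) =
      ∫ s, inducedRep μ R (f s * 𝓢.act s (g (s⁻¹ * t))) (leftTranslate μ t ξ) ∂μ := by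
    intro t
    have hi : Integrable (fun s => f s * 𝓢.act s (g (s⁻¹ * t))) μ := by
      refine Continuous.integrable_of_hasCompactSupport
        ((continuous_uncurry_conv (𝓢 := 𝓢) f g).comp (Continuous.prodMk_right t)) ?_
      refine f.hasCompactSupport.mono fun s hs => ?_
      contrapose! hs
      simp [Function.notMem_support.1 hs]
    exact (((inducedRep μ R).flip (leftTranslate μ t ξ)).integral_comp_comm hi).symm
  have hcont : Continuous (Function.uncurry fun t s =>
      inducedRep μ R (f s * 𝓢.act s (g (s⁻¹ * t))) (leftTranslate μ t ξ)) :=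
    ((inducedRep μ R).continuous.comp (continuous_uncurry_conv f g)).clm_apply
      ((continuous_leftTranslate μ ξ).comp continuous_fst)
  have hsupp : HasCompactSupport (Function.uncurry fun t s =>
      inducedRep μ R (f s * 𝓢.act s (g (s⁻¹ * t))) (leftTranslate μ t ξ)) := by
    have hf : IsCompact (tsupport f) := f.hasCompactSupport
    have hg : IsCompact (tsupport g) := g.hasCompactSupport
    have hK : IsCompact ((tsupport f * tsupport g) ×ˢ tsupport f) := (hf.mul hg).prod hf
    refine HasCompactSupport.intro' hK hK.isClosed ?_
    rintro ⟨t, s⟩ hts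
    by_cases hs : s ∈ tsupport f
    · have : s⁻¹ * t ∉ tsupport g := fun h => hts ⟨⟨s, hs, s⁻¹ * t, h, by simp⟩, hs⟩
      simp [Function.uncurry, image_eq_zero_of_notMem_tsupport this]
    · simp [Function.uncurry, image_eq_zero_of_notMem_tsupport hs]
  rw [regularRep_apply, integral_congr_ae (Eventually.of_forall e1),
    integral_integral_swap_of_hasCompactSupport hcont hsupp, regularRep_apply μ R f]
  refine integral_congr_ae (Eventually.of_forall fun s => ?_)
  simp only
  rw [← integral_mul_left_eq_self _ s, regularRep_apply,
    ← translateL_apply, ← ContinuousLinearMap.integral_comp_comm _ (integrable_regular μ R g ξ),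
    ← ContinuousLinearMap.integral_comp_comm _
      ((translateL μ s).integrable_comp (integrable_regular μ R g ξ))]
  refine integral_congr_ae (Eventually.of_forall fun t => ?_)
  simp only [translateL_apply, inv_mul_cancel_left]
  rw [inducedRep_mul, leftTranslate_inducedRep, leftTranslate_mul]

theorem inner_regularRep_left (f : C_c(G, 𝔸)) (ξ ζ : Lp K 2 μ) :
    inner ℂ (regularRep μ R f ξ) ζ =
      ∫ s, inner ℂ (inducedRep μ R (f s) (leftTranslate μ s ξ)) ζ ∂μ := by
  rw [← inner_conj_symm, regularRep_apply, ← integral_inner (integrable_regular μ R f ξ),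
    ← integral_conj]
  simp only [inner_conj_symm]

theorem inner_regularRep_right (f : C_c(G, 𝔸)) (ξ ζ : Lp K 2 μ) :
    inner ℂ ζ (regularRep μ R f ξ) =
      ∫ s, inner ℂ ζ (inducedRep μ R (f s) (leftTranslate μ s ξ)) ∂μ := by
  rw [regularRep_apply, ← integral_inner (integrable_regular μ R f ξ)]

/-- The regular representation is involutive: substitute `s⁻¹` for `s`, which produces the factor
`Δ(s)⁻¹` in `f^*`. -/
theorem regularRep_involution (f : C_c(G, 𝔸)) :
    regularRep μ R (involution 𝓢 f) = star (regularRep μ R f) := by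
  rw [ContinuousLinearMap.star_eq_adjoint, ContinuousLinearMap.eq_adjoint_iff]
  intro ξ ζ
  rw [inner_regularRep_left, inner_regularRep_right]
  have e : ∀ s, inner ℂ ξ (inducedRep μ R (f s) (leftTranslate μ s ζ)) =
      (fun r => inner ℂ (inducedRep μ R (𝓢.act r (star (f r⁻¹))) (leftTranslate μ r ξ)) ζ) s⁻¹ := by
    intro s
    simp only [inv_inv]
    rw [← leftTranslate_inducedRep, inner_leftTranslate_left, inv_inv, inner_inducedRep_left,
      star_star]
  rw [integral_congr_ae (Eventually.of_forall e), integral_comp_inv μ fun r =>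
    inner ℂ (inducedRep μ R (𝓢.act r (star (f r⁻¹))) (leftTranslate μ r ξ)) ζ]
  refine integral_congr_ae (Eventually.of_forall fun s => ?_)
  change inner ℂ (inducedRep μ R ((((modularFun s)⁻¹ : ℝ) : ℂ) • 𝓢.act s (star (f s⁻¹)))
    (leftTranslate μ s ξ)) ζ = _
  rw [map_smul, _root_.smul_apply, inner_smul_left, Complex.conj_ofReal]
  rfl

/-- The pointwise formula for the regular representation, which is defined by an integral in
`L²(G; K)`. Both sides have the same integrals over sets of finite measure, by Fubini. -/
theorem regularRep_ae_eq (f : C_c(G, 𝔸)) (ξ : Lp K 2 μ) :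
    regularRep μ R f ξ =ᵐ[μ] fun t => ∫ s, R.ρ (𝓢.act t⁻¹ (f s)) (ξ (s⁻¹ * t)) ∂μ := by
  set Φ : G × G → K := fun q => R.ρ (𝓢.act q.2⁻¹ (f q.1)) (ξ (q.1⁻¹ * q.2)) with hΦ
  have hmeas : AEStronglyMeasurable Φ (μ.prod μ) := by
    refine ContinuousLinearMap.aestronglyMeasurable_comp₂
      (ContinuousLinearMap.id ℂ (K →L[ℂ] K)) ?_ ?_
    · exact ((map_continuous R.ρ).comp (𝓢.continuous_act_apply continuous_snd.inv
        (f.continuous.comp continuous_fst))).aestronglyMeasurable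
    · exact ((Lp.stronglyMeasurable ξ).comp_measurable
        (measurable_fst.inv.mul measurable_snd)).aestronglyMeasurable
  have hdom : ∀ S, μ S < ∞ → Integrable Φ (μ.prod (μ.restrict S)) := by
    intro S hS
    have _ : IsFiniteMeasure (μ.restrict S) := ⟨by rwa [Measure.restrict_apply_univ]⟩
    have hle : μ.prod (μ.restrict S) ≤ μ.prod μ := by
      have : μ.prod (μ.restrict S) = (μ.prod μ).restrict (Set.univ ×ˢ S) := by
        rw [← Measure.prod_restrict, Measure.restrict_univ]
      rw [this]
      exact Measure.restrict_le_self
    have hf := integrable_norm_compactlySupported μ f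
    have h1 : Integrable (fun q : G × G => ‖f q.1‖ * ‖ξ q.2‖ ^ 2) (μ.prod μ) :=
      hf.mul_prod ((memLp_two_iff_integrable_sq_norm (Lp.aestronglyMeasurable ξ)).1 (Lp.memLp ξ))
    have h2 : Integrable (fun q : G × G => ‖f q.1‖ * ‖ξ (q.1⁻¹ * q.2)‖ ^ 2)
        (μ.prod (μ.restrict S)) :=
      ((measurePreserving_prod_inv_mul μ μ).integrable_comp_of_integrable h1).mono_measure hle
    have h3 : Integrable (fun q : G × G => ‖f q.1‖ * 1) (μ.prod (μ.restrict S)) :=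
      hf.mul_prod (integrable_const _)
    refine (h3.add h2).mono' (hmeas.mono_measure hle) (Eventually.of_forall fun q => ?_)
    have h4 : ‖Φ q‖ ≤ ‖f q.1‖ * ‖ξ (q.1⁻¹ * q.2)‖ :=
      ContinuousLinearMap.le_of_opNorm_le _ (R.norm_rep_le _ _) _
    have h5 : ‖ξ (q.1⁻¹ * q.2)‖ ≤ 1 + ‖ξ (q.1⁻¹ * q.2)‖ ^ 2 := by
      nlinarith [sq_nonneg (‖ξ (q.1⁻¹ * q.2)‖ - 1), sq_nonneg (‖ξ (q.1⁻¹ * q.2)‖)]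
    refine h4.trans ((mul_le_mul_of_nonneg_left h5 (norm_nonneg _)).trans_eq ?_)
    simp only [Pi.add_apply]
    ring
  refine ae_eq_of_forall_setIntegral_eq_of_sigmaFinite
    (fun S _ hS => integrableOn_Lp_of_measure_ne_top _ (by norm_num) hS.ne)
    (fun S _ hS => (hdom S hS).integral_prod_right) fun S hS hμS => ?_
  refine ext_inner_left ℂ fun k => ?_
  rw [← L2.inner_indicatorConstLp_eq_inner_setIntegral ℂ hS hμS.ne, inner_regularRep_right,
    ← integral_integral_swap (f := fun s t => Φ (s, t)) (hdom S hμS),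
    ← integral_inner (hdom S hμS).integral_prod_left]
  refine integral_congr_ae (Eventually.of_forall fun s => ?_)
  simp only
  rw [L2.inner_indicatorConstLp_eq_inner_setIntegral ℂ hS hμS.ne]
  congr 1
  refine integral_congr_ae (ae_restrict_of_ae ?_)
  filter_upwards [inducedRep_ae_eq μ R (f s) (leftTranslate μ s ξ), leftTranslate_ae_eq μ s ξ]
    with t h1 h2
  rw [h1, h2]

end Regular

/-! ### Faithfulness and nondegeneracy of the regular representation -/

section Faithful
variable {G 𝔸 : Type*} [Group G] [TopologicalSpace G] [NonUnitalCStarAlgebra 𝔸]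
  [IsTopologicalGroup G] [LocallyCompactSpace G] [T2Space G] [SecondCountableTopology G]
  [MeasurableSpace G] [BorelSpace G] (μ : Measure G) [μ.IsHaarMeasure]
  {K : Type*} [NormedAddCommGroup K] [InnerProductSpace ℂ K] [CompleteSpace K]
  {𝓢 : CStarDynamics G 𝔸} (R : CovariantRep 𝓢 K)

/-- A vanishing operator `ρ̂(f)` has vanishing kernel: the pointwise formula, applied to
`ζ(u) = conj ⟪k, ρ(f(u⁻¹)) h⟫ h`, gives at `t = 1` the integral of `|⟪k, ρ(f(s)) h⟫|²`. -/
theorem regularRep_injective (hR : Function.Injective R.ρ) :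
    Function.Injective (regularRep μ R) := by
  rw [injective_iff_map_eq_zero]
  intro f hf
  suffices h : ∀ s h k, inner ℂ k (R.ρ (f s) h) = (0 : ℂ) by
    ext s
    refine hR ?_
    ext x
    refine ext_inner_left ℂ fun k => ?_
    simpa using h s x k
  intro s₀ h k
  -- the matrix coefficient `w` vanishes because `∫ |w|² = 0`
  let w : G → ℂ := fun s => inner ℂ k (R.ρ (f s) h)
  have hwc : Continuous w := by
    have h1 : Continuous fun s => R.ρ (f s) h :=
      ((map_continuous R.ρ).comp f.continuous).clm_apply continuous_const
    exact continuous_const.inner h1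
  have hws : HasCompactSupport w := by
    refine f.hasCompactSupport.mono fun s hs => ?_
    contrapose! hs
    simp [w, Function.notMem_support.1 hs]
  let ζ : G → K := fun u => star (w u⁻¹) • h
  have hζc : Continuous ζ := (hwc.comp continuous_inv).star.smul continuous_const
  have hζs : HasCompactSupport ζ := by
    have h1 : HasCompactSupport fun u => w u⁻¹ := hws.comp_homeomorph (Homeomorph.inv G)
    refine h1.mono fun s hs => ?_
    contrapose! hs
    simp [ζ, Function.notMem_support.1 hs]
  have hζ : MemLp ζ 2 μ := hζc.memLp_of_hasCompactSupport hζs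
  have h0 := regularRep_ae_eq μ R f hζ.toLp
  rw [hf, _root_.zero_apply] at h0
  let Ψ : G → K := fun t => ∫ s, R.ρ (𝓢.act t⁻¹ (f s)) (ζ (s⁻¹ * t)) ∂μ
  have hΨ : Ψ =ᵐ[μ] 0 := by
    filter_upwards [h0, Lp.coeFn_zero K 2 μ] with t h1 h2
    rw [h2] at h1
    rw [h1]
    refine integral_congr_ae ?_
    have hq : Measure.QuasiMeasurePreserving (fun s : G => s⁻¹ * t) μ μ := by
      have h3 := (quasiMeasurePreserving_inv μ).comp
        (measurePreserving_mul_left μ t⁻¹).quasiMeasurePreserving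
      convert h3 using 1
      ext s; simp
    filter_upwards [hq.ae hζ.coeFn_toLp] with s hs
    rw [hs]
  -- `Ψ` is continuous, so it vanishes everywhere and can be evaluated at `1`
  have hΨc : Continuous Ψ := by
    rw [← continuousOn_univ]
    refine continuousOn_integral_of_compact_support (k := tsupport f) f.hasCompactSupport ?_ ?_
    · refine Continuous.continuousOn ?_
      exact ((map_continuous R.ρ).comp (𝓢.continuous_act_apply continuous_fst.inv
        (f.continuous.comp continuous_snd))).clm_apply (hζc.comp (by fun_prop))
    · intro r s _ hs
      simp [image_eq_zero_of_notMem_tsupport hs]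
  have hΨ1 : Ψ 1 = 0 := congrFun ((hΨc.ae_eq_iff_eq μ continuous_zero).1 hΨ) 1
  have hint : Integrable (fun s => star (w s) • R.ρ (f s) h) μ := by
    refine Continuous.integrable_of_hasCompactSupport ?_ ?_
    · exact hwc.star.smul (((map_continuous R.ρ).comp f.continuous).clm_apply continuous_const)
    · refine hws.mono fun s hs => ?_
      contrapose! hs
      simp [Function.notMem_support.1 hs]
  have h4 : ∫ s, star (w s) • R.ρ (f s) h ∂μ = 0 := by
    rw [← hΨ1]
    refine integral_congr_ae (Eventually.of_forall fun s => ?_)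
    simp [ζ]
  have h5 : ∫ s, ‖w s‖ ^ 2 ∂μ = 0 := by
    have h6 := integral_inner (𝕜 := ℂ) hint k
    rw [h4, inner_zero_right] at h6
    have h7 : ∀ s, inner ℂ k (star (w s) • R.ρ (f s) h) = ((‖w s‖ ^ 2 : ℝ) : ℂ) := by
      intro s
      rw [inner_smul_right]
      change (starRingEnd ℂ) (w s) * w s = _
      rw [Complex.conj_mul', Complex.ofReal_pow]
    simp_rw [h7] at h6
    rw [integral_complex_ofReal] at h6
    exact_mod_cast h6
  by_contra hne
  have h8 : 0 < ∫ s, ‖w s‖ ^ 2 ∂μ := by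
    refine (hwc.norm.pow 2).integral_pos_of_hasCompactSupport_nonneg_nonzero ?_
      (fun s => by positivity) (x := s₀) ?_
    · refine hws.mono fun s hs => ?_
      contrapose! hs
      simp [Function.notMem_support.1 hs]
    · exact pow_ne_zero _ (norm_ne_zero_iff.2 hne)
  exact h8.ne' h5

theorem isNondegenerate_iff {B : Type*} {π : B → K →L[ℂ] K} :
    IsNondegenerate π ↔ ∀ x, (∀ a h, inner ℂ (π a h) x = 0) → x = 0 := by
  rw [IsNondegenerate, Submodule.dense_iff_topologicalClosure_eq_top,
    Submodule.topologicalClosure_eq_top_iff, Submodule.eq_bot_iff]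
  refine forall_congr' fun x => imp_congr_left ?_
  rw [Submodule.mem_orthogonal]
  constructor
  · intro h a k
    exact h _ (Submodule.subset_span ⟨a, k, rfl⟩)
  · intro h u hu
    induction hu using Submodule.span_induction with
    | mem u hu => obtain ⟨a, k, rfl⟩ := hu; exact h a k
    | zero => simp
    | add u v _ _ hu hv => rw [inner_add_left, hu, hv, add_zero]
    | smul c u _ hu => rw [inner_smul_left, hu, mul_zero]

theorem CovariantRep.act_inv_apply (r : G) (a : 𝔸) :
    R.ρ (𝓢.act r⁻¹ a) = star (R.U r : K →L[ℂ] K) * R.ρ a * (R.U r : K →L[ℂ] K) := by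
  have h : ((R.U r⁻¹ : unitary (K →L[ℂ] K)) : K →L[ℂ] K) = star (R.U r : K →L[ℂ] K) := by
    rw [map_inv]; rfl
  rw [← R.covariant, h, star_star]

theorem CovariantRep.amp_ρ_apply (a : 𝔸) (x : Twofold K) (i : Fin 2) :
    R.amp.ρ a x i = R.ρ a (x i) := rfl

theorem CovariantRep.amp_injective (hR : Function.Injective R.ρ) : Function.Injective R.amp.ρ := by
  intro a b hab
  refine hR ?_
  ext x
  exact congrArg (fun y : Twofold K => y 0)
    (DFunLike.congr_fun hab (WithLp.toLp 2 fun _ => x : Twofold K))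

theorem CovariantRep.amp_nondegenerate (hR : IsNondegenerate R.ρ) : IsNondegenerate R.amp.ρ := by
  rw [isNondegenerate_iff] at hR ⊢
  intro x hx
  ext i
  refine hR (x i) fun a h => ?_
  have := hx a (WithLp.toLp 2 (Pi.single i h))
  rw [PiLp.inner_apply, Finset.sum_eq_single i] at this
  · simpa [R.amp_ρ_apply] using this
  · intro j _ hj
    simp [R.amp_ρ_apply, hj]
  · simp

theorem CovariantRep.isBoundedField_U [TopologicalSpace.SeparableSpace K] :
    IsBoundedField fun r => (R.U r : K →L[ℂ] K) :=
  ⟨R.continuous_U, 1, fun r x => by rw [one_mul, norm_unitary_apply (R.U r).2]⟩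

/-- The regular representation of a dense subalgebra is nondegenerate. A vector `χ` which is
orthogonal to its range is orthogonal to all `ρ_α(a) ξ`, as is seen from functions
`f(s) = φ(s) a` with `φ` concentrated near `1`; then nondegeneracy of `ρ` applies. -/
theorem regularRep_nondegenerate [TopologicalSpace.SeparableSpace K] (hR : IsNondegenerate R.ρ)
    {A : NonUnitalStarSubalgebra ℂ 𝔸} {𝒜 : Submodule ℂ C_c(G, 𝔸)}
    (h𝒜 : IsDenseStarSubalgebra μ 𝓢 A 𝒜) :
    IsNondegenerate (regularRep μ R ∘ₗ 𝒜.subtype) := by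
  rw [isNondegenerate_iff]
  intro χ hχ
  have h1 : ∀ f ξ, inner ℂ (regularRep μ R f ξ) χ = 0 := by
    intro f ξ
    rw [← norm_eq_zero]
    refine le_antisymm (le_of_forall_pos_le_add fun ε hε => ?_) (norm_nonneg _)
    have hδ : 0 < ε / (‖ξ‖ * ‖χ‖ + 1) := by positivity
    obtain ⟨g, hg, hfg⟩ := h𝒜.dense f _ hδ
    have h2 : inner ℂ (regularRep μ R f ξ) χ = inner ℂ (regularRep μ R (f - g) ξ) χ := by
      have h3 : inner ℂ (regularRep μ R g ξ) χ = 0 := hχ ⟨g, hg⟩ ξ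
      rw [map_sub, _root_.sub_apply, inner_sub_left, h3, sub_zero]
    rw [h2, zero_add]
    have h4 : ‖regularRep μ R (f - g)‖ ≤ ε / (‖ξ‖ * ‖χ‖ + 1) :=
      (norm_regularRep_le μ R (f - g)).trans hfg.le
    refine (norm_inner_le_norm _ _).trans ?_
    calc _ ≤ ε / (‖ξ‖ * ‖χ‖ + 1) * ‖ξ‖ * ‖χ‖ :=
          mul_le_mul_of_nonneg_right (ContinuousLinearMap.le_of_opNorm_le _ h4 _) (norm_nonneg _)
      _ ≤ ε := by
        rw [mul_assoc, div_mul_eq_mul_div, div_le_iff₀ (by positivity)]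
        nlinarith
  have h2 : ∀ a ξ, inner ℂ (inducedRep μ R a ξ) χ = 0 := by
    intro a ξ
    obtain ⟨⟨b, hb⟩, hbc, hb0, hb1⟩ : ∃ b : C(G, ℝ), HasCompactSupport b ∧ 0 ≤ b ∧ b 1 ≠ 0 :=
      exists_continuous_nonneg_pos 1
    let w : G → ℂ := fun s => inner ℂ (inducedRep μ R a (leftTranslate μ s ξ)) χ
    have hwc : Continuous w :=
      ((inducedRep μ R a).continuous.comp (continuous_leftTranslate μ ξ)).inner continuous_const
    -- the factor `w s` turns the pairing with `χ` into the integral of `b |w|²`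
    let f : C_c(G, 𝔸) :=
      { toFun := fun s => ((b s : ℂ) * w s) • a
        continuous_toFun := ((Complex.continuous_ofReal.comp hb).mul hwc).smul continuous_const
        hasCompactSupport' := by
          refine hbc.mono fun s hs => ?_
          contrapose! hs
          have : b s = 0 := Function.notMem_support.1 hs
          simp [this] }
    have h3 := h1 f ξ
    rw [inner_regularRep_left] at h3
    have h4 : ∀ s, inner ℂ (inducedRep μ R (f s) (leftTranslate μ s ξ)) χ =
        ((b s * ‖w s‖ ^ 2 : ℝ) : ℂ) := by
      intro s
      change inner ℂ (inducedRep μ R (((b s : ℂ) * w s) • a) (leftTranslate μ s ξ)) χ = _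
      rw [map_smul, _root_.smul_apply, inner_smul_left, map_mul, Complex.conj_ofReal, mul_assoc]
      change (b s : ℂ) * ((starRingEnd ℂ) (w s) * w s) = _
      rw [Complex.conj_mul', Complex.ofReal_mul, Complex.ofReal_pow]
    simp_rw [h4] at h3
    rw [integral_complex_ofReal] at h3
    have h5 : ∫ s, b s * ‖w s‖ ^ 2 ∂μ = 0 := by exact_mod_cast h3
    have h6 : w 1 = 0 := by
      by_contra hne
      have h8 : 0 < ∫ s, b s * ‖w s‖ ^ 2 ∂μ := by
        refine (hb.mul (hwc.norm.pow 2)).integral_pos_of_hasCompactSupport_nonneg_nonzero ?_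
          (fun s => mul_nonneg (hb0 s) (by positivity)) (x := 1) ?_
        · exact HasCompactSupport.mul_right hbc
        · exact mul_ne_zero hb1 (pow_ne_zero _ (norm_ne_zero_iff.2 hne))
      exact h8.ne' h5
    simpa [w, leftTranslate_one] using h6
  have h3 : ∀ a, inducedRep μ R a χ = 0 := by
    intro a
    refine ext_inner_left ℂ fun ξ => ?_
    have := h2 (star a) ξ
    rwa [inner_inducedRep_left, star_star, ← inner_zero_right ξ] at this
  -- `ρ(a) U_r χ(r) = 0` for almost all `r`, with an exceptional set that depends on `a`;
  -- integrals of `U_r χ(r)` over sets of finite measure avoid this dependence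
  have hU : MemLp (fun r => (R.U r : K →L[ℂ] K) (χ r)) 2 μ := R.isBoundedField_U.memLp μ χ
  have hint : ∀ S : Set G, μ S < ∞ →
      IntegrableOn (fun r => (R.U r : K →L[ℂ] K) (χ r)) S μ := by
    intro S hS
    refine (integrableOn_Lp_of_measure_ne_top hU.toLp (by norm_num) hS.ne).congr ?_
    exact ae_restrict_of_ae hU.coeFn_toLp
  have h4 : (fun r => (R.U r : K →L[ℂ] K) (χ r)) =ᵐ[μ] 0 := by
    refine ae_eq_zero_of_forall_setIntegral_eq_of_sigmaFinite (fun S _ hS => hint S hS)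
      fun S hS hμS => ?_
    refine isNondegenerate_iff.1 hR _ fun a h => ?_
    have h5 : R.ρ (star a) (∫ r in S, (R.U r : K →L[ℂ] K) (χ r) ∂μ) = 0 := by
      rw [← ContinuousLinearMap.integral_comp_comm _ (hint S hμS)]
      refine integral_eq_zero_of_ae (ae_restrict_of_ae ?_)
      have h6 := inducedRep_ae_eq μ R (star a) χ
      rw [h3] at h6
      filter_upwards [h6, Lp.coeFn_zero K 2 μ] with r h7 h8
      rw [h8, R.act_inv_apply] at h7
      have h9 := congrArg (R.U r : K →L[ℂ] K) h7
      rw [Pi.zero_apply, map_zero] at h9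
      have h10 := DFunLike.congr_fun (Unitary.mul_star_self_of_mem (R.U r).2)
        (R.ρ (star a) ((R.U r : K →L[ℂ] K) (χ r)))
      exact h10.symm.trans h9.symm
    rw [map_star, ContinuousLinearMap.star_eq_adjoint] at h5
    rw [← ContinuousLinearMap.adjoint_inner_right, h5, inner_zero_right]
  refine Lp.ext ?_
  filter_upwards [h4, Lp.coeFn_zero K 2 μ] with r h5 h6
  rw [h6, Pi.zero_apply, ← norm_eq_zero, ← norm_unitary_apply (R.U r).2, h5, Pi.zero_apply,
    norm_zero]

end Faithful

/-! ### Central multipliers and the twist `β` -/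

section Cocycle
variable {G 𝔸 : Type*} [Group G] [TopologicalSpace G] [NonUnitalCStarAlgebra 𝔸]
  {𝓢 : CStarDynamics G 𝔸} {A : NonUnitalStarSubalgebra ℂ 𝔸} {p : G → 𝓜(ℂ, 𝔸)ˣ}

theorem multiplier_fst_mul (m : 𝓜(ℂ, 𝔸)) (x y : 𝔸) : m.fst (x * y) = m.fst x * y := by
  have h : ∀ c : 𝔸, c * (m.fst (x * y) - m.fst x * y) = 0 := by
    intro c
    rw [mul_sub, ← m.central, ← mul_assoc, ← mul_assoc, ← m.central, mul_assoc, sub_self]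
  exact sub_eq_zero.1 (CStarRing.star_mul_self_eq_zero_iff _ |>.1
    (h (star (m.fst (x * y) - m.fst x * y))))

theorem multiplierAut_fst_apply (e : 𝔸 ≃⋆ₐ[ℂ] 𝔸) (m : 𝓜(ℂ, 𝔸)) (a : 𝔸) :
    (multiplierAut e m).fst (e a) = e (m.fst a) := by
  change e (m.fst (e.symm (e a))) = _
  rw [StarAlgEquiv.symm_apply_apply]

theorem unit_fst_inv_apply (m : 𝓜(ℂ, 𝔸)ˣ) (a : 𝔸) :
    (m : 𝓜(ℂ, 𝔸)).fst ((m⁻¹ : 𝓜(ℂ, 𝔸)ˣ).val.fst a) = a := by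
  rw [← mul_apply_eq_comp, ← DoubleCentralizer.mul_fst, Units.mul_inv]
  rfl

theorem unit_inv_fst_apply (m : 𝓜(ℂ, 𝔸)ˣ) (a : 𝔸) :
    (m⁻¹ : 𝓜(ℂ, 𝔸)ˣ).val.fst ((m : 𝓜(ℂ, 𝔸)).fst a) = a := by
  rw [← mul_apply_eq_comp, ← DoubleCentralizer.mul_fst, Units.inv_mul]
  rfl

theorem IsCentralCocycle.fst_eq_snd (hp : IsCentralCocycle 𝓢 A p)
    (hA : Dense (A : Set 𝔸)) (r : G) (a : 𝔸) :
    (p r : 𝓜(ℂ, 𝔸)).fst a = (p r : 𝓜(ℂ, 𝔸)).snd a := by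
  have h := Continuous.ext_on hA (p r : 𝓜(ℂ, 𝔸)).fst.continuous (p r : 𝓜(ℂ, 𝔸)).snd.continuous
    fun a ha => hp.commute r a ha
  exact congrFun h a

theorem IsCentralCocycle.mul_fst_apply (hp : IsCentralCocycle 𝓢 A p)
    (hA : Dense (A : Set 𝔸)) (r : G) (a b : 𝔸) :
    a * (p r : 𝓜(ℂ, 𝔸)).fst b = (p r : 𝓜(ℂ, 𝔸)).fst (a * b) := by
  rw [← (p r : 𝓜(ℂ, 𝔸)).central, ← hp.fst_eq_snd hA, multiplier_fst_mul]

theorem IsCentralCocycle.star_fst_apply (hp : IsCentralCocycle 𝓢 A p)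
    (hA : Dense (A : Set 𝔸)) (r : G) (a : 𝔸) :
    star ((p r : 𝓜(ℂ, 𝔸)).fst a) = (p r : 𝓜(ℂ, 𝔸)).fst (star a) := by
  have h : star (p r : 𝓜(ℂ, 𝔸)) = p r := by
    obtain ⟨b, hb⟩ := hp.positive r
    rw [hb, star_mul, star_star]
  rw [hp.fst_eq_snd hA r (star a), ← h, DoubleCentralizer.star_snd, star_star, h]

theorem IsCentralCocycle.fst_act (hp : IsCentralCocycle 𝓢 A p) (r s : G) (a : 𝔸) :
    (p (r * s) : 𝓜(ℂ, 𝔸)).fst (𝓢.act r a) =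
      (p r : 𝓜(ℂ, 𝔸)).fst (𝓢.act r ((p s : 𝓜(ℂ, 𝔸)).fst a)) := by
  rw [hp.cocycle, DoubleCentralizer.mul_fst, mul_apply_eq_comp, multiplierAut_fst_apply]

theorem IsCentralCocycle.fst_one (hp : IsCentralCocycle 𝓢 A p) (a : 𝔸) :
    (p 1 : 𝓜(ℂ, 𝔸)).fst a = a := by
  have h := hp.fst_act 1 1 a
  rw [mul_one, map_one] at h
  have h2 := congrArg ((p 1)⁻¹ : 𝓜(ℂ, 𝔸)ˣ).val.fst h
  rw [unit_inv_fst_apply] at h2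
  have h3 : ((1 : 𝔸 ≃⋆ₐ[ℂ] 𝔸) : 𝔸 → 𝔸) = id := rfl
  rw [h3, id, id, unit_inv_fst_apply] at h2
  exact h2.symm

variable [IsTopologicalGroup G] [LocallyCompactSpace G] [MeasurableSpace G] [BorelSpace G]

/-- `β(f ⋆ g) = β(f) ⋆ β(g)`, by the cocycle identity and centrality of `p`. -/
theorem conv_twist (hA : Dense (A : Set 𝔸)) (hp : IsCentralCocycle 𝓢 A p) (μ : Measure G)
    [IsFiniteMeasureOnCompacts μ] {f g f' g' : C_c(G, 𝔸)}
    (hf : ∀ r, f' r = (p r : 𝓜(ℂ, 𝔸)).fst (f r)) (hg : ∀ r, g' r = (p r : 𝓜(ℂ, 𝔸)).fst (g r))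
    (r : G) : (p r : 𝓜(ℂ, 𝔸)).fst (conv μ 𝓢 f g r) = conv μ 𝓢 f' g' r := by
  have hi : Integrable (fun s => f s * 𝓢.act s (g (s⁻¹ * r))) μ := by
    refine Continuous.integrable_of_hasCompactSupport (f.continuous.mul
      (𝓢.continuous_act_apply continuous_id (g.continuous.comp (by fun_prop)))) ?_
    refine f.hasCompactSupport.mono fun s hs => ?_
    contrapose! hs
    simp [Function.notMem_support.1 hs]
  change (p r : 𝓜(ℂ, 𝔸)).fst (∫ s, f s * 𝓢.act s (g (s⁻¹ * r)) ∂μ) =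
    ∫ s, f' s * 𝓢.act s (g' (s⁻¹ * r)) ∂μ
  rw [← ContinuousLinearMap.integral_comp_comm _ hi]
  refine integral_congr_ae (Eventually.of_forall fun s => ?_)
  simp only
  have h := hp.fst_act s (s⁻¹ * r) (g (s⁻¹ * r))
  rw [mul_inv_cancel_left] at h
  rw [hf, hg, ← hp.mul_fst_apply hA, h, hp.mul_fst_apply hA, ← multiplier_fst_mul]

/-- `β(f^*) = f'^*` if `f = β(f')`. -/
theorem involution_twist (hA : Dense (A : Set 𝔸)) (hp : IsCentralCocycle 𝓢 A p)
    {f f' : C_c(G, 𝔸)} (hf : ∀ r, f r = (p r : 𝓜(ℂ, 𝔸)).fst (f' r)) (r : G) :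
    (p r : 𝓜(ℂ, 𝔸)).fst (involution 𝓢 f r) = involution 𝓢 f' r := by
  change (p r : 𝓜(ℂ, 𝔸)).fst ((((modularFun r)⁻¹ : ℝ) : ℂ) • 𝓢.act r (star (f r⁻¹))) =
    (((modularFun r)⁻¹ : ℝ) : ℂ) • 𝓢.act r (star (f' r⁻¹))
  rw [map_smul, hf, hp.star_fst_apply hA, ← hp.fst_act, mul_inv_cancel, hp.fst_one]

/-- The twist `β(f)(r) = p(r) f(r)` of `𝒜`. -/
theorem exists_twist {𝒜 : Submodule ℂ C_c(G, 𝔸)}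
    (hp𝒜 : ∀ f ∈ 𝒜, (∃ g ∈ 𝒜, ∀ r, g r = (p r : 𝓜(ℂ, 𝔸)).fst (f r)) ∧
      ∃ g ∈ 𝒜, ∀ r, g r = ((p r)⁻¹ : 𝓜(ℂ, 𝔸)ˣ).val.fst (f r)) :
    ∃ β : 𝒜 ≃ₗ[ℂ] 𝒜,
      ∀ (f : 𝒜) (r : G), (β f : C_c(G, 𝔸)) r = (p r : 𝓜(ℂ, 𝔸)).fst ((f : C_c(G, 𝔸)) r) := by
  choose b hb hb' using fun f : 𝒜 => (hp𝒜 f f.2).1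
  choose c hc hc' using fun f : 𝒜 => (hp𝒜 f f.2).2
  refine ⟨{ toFun := fun f => ⟨b f, hb f⟩
            invFun := fun f => ⟨c f, hc f⟩
            map_add' := fun f g => ?_
            map_smul' := fun a f => ?_
            left_inv := fun f => ?_
            right_inv := fun f => ?_ }, fun f r => hb' f r⟩
  · ext r
    change b (f + g) r = b f r + b g r
    rw [hb', hb', hb', ← map_add]
    rfl
  · ext r
    change b (a • f) r = a • b f r
    rw [hb', hb', ← map_smul]
    rfl
  · ext r
    change c ⟨b f, hb f⟩ r = _
    rw [hc', hb', unit_inv_fst_apply]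
  · ext r
    change b ⟨c f, hc f⟩ r = _
    rw [hb', hc', unit_fst_inv_apply]

end Cocycle

/-! ### The operators `ρ(p(r))` -/

section MultiplierOps
variable {G 𝔸 : Type*} [Group G] [TopologicalSpace G] [NonUnitalCStarAlgebra 𝔸]
  {𝓢 : CStarDynamics G 𝔸} {A : NonUnitalStarSubalgebra ℂ 𝔸} {p : G → 𝓜(ℂ, 𝔸)ˣ}
  {K : Type*} [NormedAddCommGroup K] [InnerProductSpace ℂ K] [CompleteSpace K]

theorem clm_ext_of_nondegenerate {B : Type*} {π : B → K →L[ℂ] K} (hπ : IsNondegenerate π)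
    {S T : K →L[ℂ] K} (h : ∀ a x, S (π a x) = T (π a x)) : S = T := by
  refine ContinuousLinearMap.ext_on hπ ?_
  rintro _ ⟨a, x, rfl⟩
  exact h a x

theorem multiplierRep_mul_rep {ρ : 𝔸 →⋆ₙₐ[ℂ] (K →L[ℂ] K)} (hρ : IsNondegenerate ρ) (m : 𝓜(ℂ, 𝔸))
    (a : 𝔸) : multiplierRep ρ m * ρ a = ρ (m.fst a) := by
  ext x
  exact multiplierRep_apply ρ hρ m a x

theorem norm_multiplierRep_le {ρ : 𝔸 →⋆ₙₐ[ℂ] (K →L[ℂ] K)} (hρ : IsNondegenerate ρ) (m : 𝓜(ℂ, 𝔸))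
    (x : K) : ‖multiplierRep ρ m x‖ ≤ ‖m.fst‖ * ‖x‖ := by
  let _ := CStarAlgebra.spectralOrder 𝔸
  have _ := CStarAlgebra.spectralOrderedRing 𝔸
  have hu := CStarAlgebra.increasingApproximateUnit 𝔸
  refine hρ.induction (P := fun x => ‖multiplierRep ρ m x‖ ≤ ‖m.fst‖ * ‖x‖) (fun x hx => ?_)
    (isClosed_le (multiplierRep ρ m).continuous.norm (continuous_const.mul continuous_norm)) x
  have lim : Tendsto (fun e => ρ (m.fst e) x) (CStarAlgebra.approximateUnit 𝔸)
      (𝓝 (multiplierRep ρ m x)) := by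
    induction hx using Submodule.span_induction with
    | mem x hx =>
      obtain ⟨a, h, rfl⟩ := hx
      have h1 : ∀ e, ρ (m.fst e) (ρ a h) = ρ (m.fst (e * a)) h := by
        intro e; rw [multiplier_fst_mul, map_mul]; rfl
      simp only [h1, multiplierRep_apply ρ hρ]
      have h3 : Continuous fun x => ρ (m.fst x) h :=
        ((map_continuous ρ).comp m.fst.continuous).clm_apply continuous_const
      exact (h3.tendsto a).comp (hu.tendsto_mul_right a)
    | zero => simp
    | add x y _ _ hx hy => simpa using hx.add hy
    | smul c x _ hx => simpa using hx.const_smul c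
  refine le_of_tendsto lim.norm ?_
  filter_upwards [hu.eventually_norm] with e he
  refine (ContinuousLinearMap.le_opNorm _ _).trans ?_
  gcongr
  refine (NonUnitalStarAlgHom.norm_apply_le ρ _).trans ((m.fst.le_opNorm e).trans ?_)
  exact mul_le_of_le_one_right (norm_nonneg _) he

theorem rep_mul_multiplierRep {ρ : 𝔸 →⋆ₙₐ[ℂ] (K →L[ℂ] K)} (hρ : IsNondegenerate ρ)
    (hA : Dense (A : Set 𝔸)) (hp : IsCentralCocycle 𝓢 A p) (r : G) (a : 𝔸) :
    ρ a * multiplierRep ρ (p r) = ρ ((p r : 𝓜(ℂ, 𝔸)).fst a) := by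
  refine clm_ext_of_nondegenerate hρ fun b x => ?_
  rw [mul_apply_eq_comp, multiplierRep_apply ρ hρ, ← mul_apply_eq_comp, ← map_mul,
    hp.mul_fst_apply hA, multiplier_fst_mul, map_mul]
  rfl

/-- The cocycle identity `ρ(p(rs)) U_r = ρ(p(r)) U_r ρ(p(s))`. -/
theorem multiplierRep_cocycle (R : CovariantRep 𝓢 K) (hR : IsNondegenerate R.ρ)
    (hp : IsCentralCocycle 𝓢 A p) (r s : G) :
    multiplierRep R.ρ (p (r * s)) * (R.U r : K →L[ℂ] K) =
      multiplierRep R.ρ (p r) * (R.U r : K →L[ℂ] K) * multiplierRep R.ρ (p s) := by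
  have hU : ∀ a, (R.U r : K →L[ℂ] K) * R.ρ a = R.ρ (𝓢.act r a) * (R.U r : K →L[ℂ] K) := by
    intro a
    rw [← R.covariant, mul_assoc _ (star _), Unitary.star_mul_self_of_mem (R.U r).2, mul_one]
  refine clm_ext_of_nondegenerate hR fun a x => ?_
  rw [← mul_apply_eq_comp, ← mul_apply_eq_comp]
  congr 1
  rw [mul_assoc, hU, ← mul_assoc, multiplierRep_mul_rep hR, mul_assoc _ _ (R.ρ a),
    multiplierRep_mul_rep hR, mul_assoc _ (R.U r : K →L[ℂ] K), hU, ← mul_assoc,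
    multiplierRep_mul_rep hR, hp.fst_act]

/-- Pointwise convergence on a set with dense span extends to the whole space for a locally bounded
family of operators. -/
theorem tendsto_apply_of_dense {X : Type*} {l : Filter X} {Y : X → K →L[ℂ] K} {T : K →L[ℂ] K}
    {s : Set K} (hs : Dense (Submodule.span ℂ s : Set K)) {c : ℝ}
    (hc : ∀ᶠ t in l, ∀ x, ‖Y t x‖ ≤ c * ‖x‖)
    (h : ∀ x ∈ s, Tendsto (fun t => Y t x) l (𝓝 (T x))) (x : K) :
    Tendsto (fun t => Y t x) l (𝓝 (T x)) := by
  have h1 : ∀ x ∈ Submodule.span ℂ s, Tendsto (fun t => Y t x) l (𝓝 (T x)) := by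
    intro x hx
    induction hx using Submodule.span_induction with
    | mem x hx => exact h x hx
    | zero =>
      simp only [map_zero]
      exact tendsto_const_nhds
    | add x y _ _ hx hy => simpa using hx.add hy
    | smul c x _ hx => simpa using hx.const_smul c
  rw [Metric.tendsto_nhds]
  intro ε hε
  have hd : 0 < ε / (3 * (|c| + ‖T‖ + 1)) := by positivity
  obtain ⟨y, hy, hxy⟩ := Metric.dense_iff.1 hs x _ hd
  rw [Metric.mem_ball, dist_comm, dist_eq_norm] at hy
  filter_upwards [hc, Metric.tendsto_nhds.1 (h1 y hxy) (ε / 3) (by positivity)] with t ht1 ht2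
  have e1 : ‖x - y‖ * (|c| + ‖T‖ + 1) < ε / 3 := by
    rw [← lt_div_iff₀ (by positivity), div_div]
    exact hy
  have e2 : ‖Y t (x - y)‖ ≤ |c| * ‖x - y‖ :=
    (ht1 _).trans (mul_le_mul_of_nonneg_right (le_abs_self c) (norm_nonneg _))
  have e3 : ‖T (x - y)‖ ≤ ‖T‖ * ‖x - y‖ := T.le_opNorm _
  have e4 : Y t x - T x = Y t (x - y) + (Y t y - T y) - T (x - y) := by
    rw [map_sub, map_sub]; abel
  rw [dist_eq_norm] at ht2 ⊢
  rw [e4]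
  have e5 := norm_sub_le (Y t (x - y) + (Y t y - T y)) (T (x - y))
  have e6 := norm_add_le (Y t (x - y)) (Y t y - T y)
  nlinarith [norm_nonneg (x - y), abs_nonneg c, norm_nonneg T]

theorem continuous_multiplierRep [LocallyCompactSpace G] {ρ : 𝔸 →⋆ₙₐ[ℂ] (K →L[ℂ] K)}
    (hρ : IsNondegenerate ρ) (hp : IsCentralCocycle 𝓢 A p) (x : K) :
    Continuous fun r => multiplierRep ρ (p r) x := by
  rw [continuous_iff_continuousAt]
  intro r
  obtain ⟨C, hC, hCr⟩ := exists_compact_mem_nhds r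
  obtain ⟨c, hc⟩ : ∃ c, ∀ t : C, ‖(p t : 𝓜(ℂ, 𝔸)).fst‖ ≤ c := by
    refine banach_steinhaus fun a => ?_
    obtain ⟨M, hM⟩ := hC.exists_bound_of_continuousOn (hp.continuous_fst a).continuousOn
    exact ⟨M, fun t => hM t t.2⟩
  refine tendsto_apply_of_dense (T := multiplierRep ρ (p r)) hρ (c := c) ?_ ?_ x
  · filter_upwards [hCr] with t ht x
    exact (norm_multiplierRep_le hρ _ x).trans
      (mul_le_mul_of_nonneg_right (hc ⟨t, ht⟩) (norm_nonneg _))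
  · rintro _ ⟨a, h, rfl⟩
    simp only [multiplierRep_apply ρ hρ]
    exact (((map_continuous ρ).comp (hp.continuous_fst a)).clm_apply continuous_const).tendsto r

end MultiplierOps

/-! ### Fields of operators rotated by the unitary representation -/

section Rotated
variable {G 𝔸 : Type*} [Group G] [TopologicalSpace G] [NonUnitalCStarAlgebra 𝔸]
  [IsTopologicalGroup G] [LocallyCompactSpace G] [T2Space G] [SecondCountableTopology G]
  [MeasurableSpace G] [BorelSpace G] (μ : Measure G)
  {K : Type*} [NormedAddCommGroup K] [InnerProductSpace ℂ K] [CompleteSpace K]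
  [TopologicalSpace.SeparableSpace K]
  {𝓢 : CStarDynamics G 𝔸} (R : CovariantRep 𝓢 K)

theorem CovariantRep.star_U (r : G) : star (R.U r : K →L[ℂ] K) = (R.U r⁻¹ : K →L[ℂ] K) := by
  rw [map_inv]
  rfl

theorem CovariantRep.U_mul (r s : G) :
    (R.U (r * s) : K →L[ℂ] K) = (R.U r : K →L[ℂ] K) * (R.U s : K →L[ℂ] K) := by
  rw [map_mul]
  rfl

theorem CovariantRep.isBoundedField_star_U :
    IsBoundedField fun r => star (R.U r : K →L[ℂ] K) := by
  refine ⟨fun x => ?_, 1, fun r x => ?_⟩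
  · simp only [R.star_U]
    exact (R.continuous_U x).comp continuous_inv
  · rw [one_mul, R.star_U, norm_unitary_apply (R.U r⁻¹).2]

theorem IsBoundedField.rotated {Y : G → K →L[ℂ] K} (hY : IsBoundedField Y) :
    IsBoundedField fun r => star (R.U r : K →L[ℂ] K) * Y r * (R.U r : K →L[ℂ] K) :=
  (R.isBoundedField_star_U.mul hY).mul R.isBoundedField_U

/-- Fields with the local continuity of `tendsto_resolvent`: every element of the graph of `E r`
extends to a continuous section of the graphs with constant first component. -/
def IsContinuousField (E : G → K →ₗ.[ℂ] K) : Prop :=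
  ∀ r u v, (u, v) ∈ (E r).graph → ∃ w : G → K, (∀ t, (u, w t) ∈ (E t).graph) ∧
    Tendsto w (𝓝 r) (𝓝 v)

variable {E : G → K →ₗ.[ℂ] K}

theorem IsContinuousField.isBoundedField_resolvent (hcont : IsContinuousField E)
    (hE : ∀ t, IsSelfAdjoint (E t)) {c : ℝ} (hc : c ^ 2 = 1) :
    IsBoundedField fun t => resolvent (E t) c :=
  ⟨fun x => continuous_iff_continuousAt.2 fun r => tendsto_resolvent (hE r) hE hc (hcont r) x, 1,
    fun t x => by rw [one_mul]; exact norm_resolvent_apply_le (hE t) hc x⟩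

theorem IsContinuousField.continuous_resolvent_rotated (hcont : IsContinuousField E)
    (hE : ∀ t, IsSelfAdjoint (E t)) (c : ℝ) (hc : c ^ 2 = 1) (x : K) : Continuous fun t =>
      resolvent (sandwich (star (R.U t : K →L[ℂ] K)) (E t) (R.U t : K →L[ℂ] K)) c x := by
  simp only [resolvent_sandwich (R.U _).2 (hE _) hc]
  exact ((hcont.isBoundedField_resolvent hE hc).rotated R).continuous_apply x

theorem isSelfAdjoint_rotated (hcont : IsContinuousField E) (hE : ∀ t, IsSelfAdjoint (E t)) :
    IsSelfAdjoint (R.rotated μ E) :=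
  isSelfAdjoint_fiberwise μ (fun t => isSelfAdjoint_sandwich (R.U t).2 (hE t))
    (hcont.continuous_resolvent_rotated R hE)

theorem mem_rotated_graph_iff (ξ ζ : Lp K 2 μ) : (ξ, ζ) ∈ (R.rotated μ E).graph ↔
    ∀ᵐ r ∂μ, ((R.U r : K →L[ℂ] K) (ξ r), (R.U r : K →L[ℂ] K) (ζ r)) ∈ (E r).graph := by
  rw [CovariantRep.rotated, mem_fiberwise_graph]
  simp only [mem_rotated_graph (R.U _).2]

theorem isContinuousField_ofBounded {Y : G → K →L[ℂ] K} (hY : ∀ x, Continuous fun r => Y r x) :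
    IsContinuousField fun r => ofBounded (Y r) := by
  intro r u v h
  rw [mem_ofBounded_graph] at h
  exact ⟨fun t => Y t u, fun t => mem_ofBounded_graph.2 rfl, h ▸ (hY u).tendsto r⟩

theorem isContinuousField_pauliSum {D : K →ₗ.[ℂ] K} {Y : G → K →L[ℂ] K}
    (hY : ∀ x, Continuous fun r => Y r x) : IsContinuousField fun r => pauliSum D (Y r) := by
  intro r u v h
  rw [mem_pauliSum_graph] at h
  refine ⟨fun t => WithLp.toLp 2 ![v 0 - Complex.I • (Y t (u 1) - Y r (u 1)),
    v 1 + Complex.I • (Y t (u 0) - Y r (u 0))], fun t => ?_, ?_⟩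
  · rw [mem_pauliSum_graph]
    convert h using 3
    · simp only [Matrix.cons_val_zero, smul_sub]
      abel
    · simp only [Matrix.cons_val_one, Matrix.cons_val_fin_one, smul_sub]
      abel
  · have h2 : v = WithLp.toLp 2 ![v 0, v 1] := by
      ext i; fin_cases i <;> rfl
    conv => rhs; rw [h2]
    refine ((PiLp.continuous_toLp 2 (fun _ : Fin 2 => K)).tendsto _).comp ?_
    refine tendsto_pi_nhds.2 fun i => ?_
    fin_cases i
    · have h3 : Continuous fun t => v 0 - Complex.I • (Y t (u 1) - Y r (u 1)) :=
        continuous_const.sub (((hY (u 1)).sub continuous_const).const_smul Complex.I)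
      simpa using h3.tendsto r
    · have h3 : Continuous fun t => v 1 + Complex.I • (Y t (u 0) - Y r (u 0)) :=
        continuous_const.add (((hY (u 0)).sub continuous_const).const_smul Complex.I)
      simpa using h3.tendsto r

end Rotated

/-! ### The modular operator and the twisted Dirac operator -/

section Modular
variable {K : Type*} [NormedAddCommGroup K] [InnerProductSpace ℂ K] [CompleteSpace K]

theorem dense_range_of_injective {E : K →ₗ.[ℂ] K} (hE : IsSelfAdjoint E)
    (h0 : ∀ x, (x, (0 : K)) ∈ E.graph → x = 0) : Dense (E.inverse.domain : Set K) := by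
  rw [Submodule.dense_iff_topologicalClosure_eq_top, Submodule.topologicalClosure_eq_top_iff,
    Submodule.eq_bot_iff]
  intro e he
  refine h0 e ((mem_graph_iff_of_isSelfAdjoint hE).2 fun u v huv => ?_)
  rw [inner_zero_right]
  refine (Submodule.mem_orthogonal _ _).1 he v ?_
  rw [LinearPMap.inverse_domain]
  obtain ⟨w, hw, rfl⟩ := (E.mem_graph_iff).1 huv
  exact ⟨w, rfl⟩

/-- An operator of the form `z z*` with invertible `z` is selfadjoint, positive and injective. -/
theorem isSelfAdjoint_unit_mul_star {z : (K →L[ℂ] K)ˣ} {P : K →L[ℂ] K}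
    (h : P = (z : K →L[ℂ] K) * star (z : K →L[ℂ] K)) : IsSelfAdjoint P := by
  rw [h]
  exact IsSelfAdjoint.mul_star_self _

theorem inner_unit_mul_star {z : (K →L[ℂ] K)ˣ} {P : K →L[ℂ] K}
    (h : P = (z : K →L[ℂ] K) * star (z : K →L[ℂ] K)) (x : K) :
    inner ℂ x (P x) = ((‖star (z : K →L[ℂ] K) x‖ ^ 2 : ℝ) : ℂ) := by
  rw [h, mul_apply_eq_comp, ContinuousLinearMap.star_eq_adjoint,
    ← ContinuousLinearMap.adjoint_inner_left, inner_self_eq_norm_sq_to_K]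
  simp

theorem injective_unit_mul_star {z : (K →L[ℂ] K)ˣ} {P : K →L[ℂ] K}
    (h : P = (z : K →L[ℂ] K) * star (z : K →L[ℂ] K)) {x : K} (hx : P x = 0) : x = 0 := by
  have h1 := inner_unit_mul_star h x
  rw [hx, inner_zero_right] at h1
  have h2 : star (z : K →L[ℂ] K) x = 0 := by
    have h3 : ‖star (z : K →L[ℂ] K) x‖ ^ 2 = 0 := by exact_mod_cast h1.symm
    simpa using h3
  have h4 : star ((z⁻¹ : (K →L[ℂ] K)ˣ) : K →L[ℂ] K) * star (z : K →L[ℂ] K) = 1 := by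
    rw [← star_mul, Units.mul_inv, star_one]
  have h5 := DFunLike.congr_fun h4 x
  rw [mul_apply_eq_comp, h2, map_zero] at h5
  exact h5.symm

variable {G 𝔸 : Type*} [Group G] [TopologicalSpace G] [NonUnitalCStarAlgebra 𝔸]
  [IsTopologicalGroup G] [LocallyCompactSpace G] [T2Space G] [SecondCountableTopology G]
  [MeasurableSpace G] [BorelSpace G] (μ : Measure G)
  [TopologicalSpace.SeparableSpace K]
  {𝓢 : CStarDynamics G 𝔸} (R : CovariantRep 𝓢 K) {A : NonUnitalStarSubalgebra ℂ 𝔸}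
  {p : G → 𝓜(ℂ, 𝔸)ˣ}

theorem isSelfAdjoint_fiberT (hP : ∀ r, IsSelfAdjoint (multiplierRep R.ρ (p r))) (η ω : ℝ) (r : G) :
    IsSelfAdjoint (fiberT R p η ω r) := by
  refine IsSelfAdjoint.add ?_ ?_
  · exact IsSelfAdjoint.smul (Complex.conj_ofReal η) (IsSelfAdjoint.one _)
  · exact IsSelfAdjoint.smul (Complex.conj_ofReal ω) (hP r)

theorem continuous_fiberT (hR : IsNondegenerate R.ρ) (hp : IsCentralCocycle 𝓢 A p) (η ω : ℝ)
    (x : K) : Continuous fun r => fiberT R p η ω r x :=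
  continuous_const.add ((continuous_multiplierRep hR hp x).const_smul (ω : ℂ))

theorem continuous_ampOp {Y : G → K →L[ℂ] K} (hY : ∀ x, Continuous fun r => Y r x)
    (x : Twofold K) : Continuous fun r => ampOp (Y r) x :=
  (PiLp.continuous_toLp 2 _).comp (continuous_pi fun i => hY (x i))

theorem isSelfAdjoint_diracOp (hR : IsNondegenerate R.ρ) (hp : IsCentralCocycle 𝓢 A p)
    (hP : ∀ r, IsSelfAdjoint (multiplierRep R.ρ (p r))) {D : K →ₗ.[ℂ] K} (hD : IsSelfAdjoint D)
    (η ω : ℝ) : IsSelfAdjoint (diracOp R μ D p η ω) :=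
  isSelfAdjoint_rotated μ R.amp (isContinuousField_pauliSum (continuous_fiberT R hR hp η ω))
    fun r => isSelfAdjoint_pauliSum hD (isSelfAdjoint_fiberT R hP η ω r)

theorem isSelfAdjoint_modularOp (hR : IsNondegenerate R.ρ) (hp : IsCentralCocycle 𝓢 A p)
    (hP : ∀ r, IsSelfAdjoint (multiplierRep R.ρ (p r))) : IsSelfAdjoint (modularOp R μ p) := by
  refine isSelfAdjoint_rotated μ R.amp (isContinuousField_ofBounded
    (continuous_ampOp (continuous_multiplierRep hR hp))) fun r => isSelfAdjoint_ofBounded ?_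
  rw [IsSelfAdjoint, ← ampOp_star, (hP r).star_eq]

theorem mem_modularOp_graph (ξ ζ : Lp (Twofold K) 2 μ) : (ξ, ζ) ∈ (modularOp R μ p).graph ↔
    ∀ᵐ r ∂μ, ∀ i, multiplierRep R.ρ (p r) ((R.U r : K →L[ℂ] K) (ξ r i)) =
      (R.U r : K →L[ℂ] K) (ζ r i) := by
  rw [modularOp, mem_rotated_graph_iff]
  simp only [mem_ofBounded_graph, PiLp.ext_iff]
  rfl

theorem modularOp_nonneg {z : G → (K →L[ℂ] K)ˣ}
    (hpz : ∀ r, multiplierRep R.ρ (p r) = (z r : K →L[ℂ] K) * star (z r : K →L[ℂ] K))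
    {ξ ζ : Lp (Twofold K) 2 μ} (h : (ξ, ζ) ∈ (modularOp R μ p).graph) :
    0 ≤ RCLike.re (inner ℂ ξ ζ) := by
  rw [L2.inner_def, ← integral_re (L2.integrable_inner ξ ζ)]
  rw [mem_modularOp_graph] at h
  refine integral_nonneg_of_ae ?_
  filter_upwards [h] with r hr
  rw [PiLp.inner_apply, map_sum]
  refine Finset.sum_nonneg fun i _ => ?_
  rw [← inner_unitary_apply (R.U r).2, ← hr i, inner_unit_mul_star (hpz r)]
  simp only [RCLike.re_to_complex, Complex.ofReal_re]
  positivity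

theorem modularOp_injective {z : G → (K →L[ℂ] K)ˣ}
    (hpz : ∀ r, multiplierRep R.ρ (p r) = (z r : K →L[ℂ] K) * star (z r : K →L[ℂ] K))
    {ξ : Lp (Twofold K) 2 μ} (h : (ξ, (0 : Lp (Twofold K) 2 μ)) ∈ (modularOp R μ p).graph) :
    ξ = 0 := by
  rw [mem_modularOp_graph] at h
  refine Lp.ext ?_
  filter_upwards [h, Lp.coeFn_zero (Twofold K) 2 μ] with r hr h0
  ext i
  have h1 := hr i
  rw [h0] at h1 ⊢
  simp only [Pi.zero_apply, PiLp.zero_apply, map_zero] at h1 ⊢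
  have h2 := injective_unit_mul_star (hpz r) h1
  rw [← norm_eq_zero, norm_unitary_apply (R.U r).2, norm_eq_zero] at h2
  exact h2

end Modular

/-! ### Cores and bounded commutators -/

section Cores
variable {K : Type*} [NormedAddCommGroup K] [InnerProductSpace ℂ K] [CompleteSpace K]

theorem AgreeOnCommonCore.eq {E F : K →ₗ.[ℂ] K} (h : AgreeOnCommonCore E F) : E = F := by
  obtain ⟨C, h1, h2, h3⟩ := h
  rw [← h1.closure_eq, ← h2.closure_eq, h3]

/-- A core is dense in the domain for the graph norm. -/
theorem mem_closure_of_hasCore {E : K →ₗ.[ℂ] K} (hE : IsSelfAdjoint E) {C : Submodule ℂ K}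
    (hC : E.HasCore C) {x y : K} (h : (x, y) ∈ E.graph) :
    (x, y) ∈ closure {q : K × K | q ∈ E.graph ∧ q.1 ∈ C} := by
  have hle : E.domRestrict C ≤ E := LinearPMap.domRestrict_le
  have hcl : (E.domRestrict C).IsClosable := hE.isClosed.isClosable.leIsClosable hle
  have h2 : (x, y) ∈ (E.domRestrict C).closure.graph := by rwa [hC.closure_eq]
  rw [← hcl.graph_closure_eq_closure_graph] at h2
  refine closure_mono (fun q hq => ?_) (show (x, y) ∈ closure _ from h2)
  exact ⟨LinearPMap.le_graph_of_le hle hq,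
    (mem_domain_of_mem_graph (E := E.domRestrict C) (x := q.1) (y := q.2) hq).1⟩

/-- A commutator `E S - S' E` which is bounded on a subspace that is dense in the domain of `E` for
the graph norm extends to a bounded operator, and then `S Dom E ⊆ Dom E`. The bound is stated in
terms of a bounded operator `L` so as to be uniform in applications. -/
theorem exists_bounded_commutator {E : K →ₗ.[ℂ] K} (hE : IsSelfAdjoint E) {S S' L : K →L[ℂ] K}
    {C : Submodule ℂ K} (hC : C ≤ E.domain)
    (hcore : ∀ x y, (x, y) ∈ E.graph → (x, y) ∈ closure {q : K × K | q ∈ E.graph ∧ q.1 ∈ C})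
    {M : ℝ} (hM : 0 ≤ M)
    (h : ∀ x ∈ C, ∃ u w, (x, u) ∈ E.graph ∧ (S x, w) ∈ E.graph ∧ ‖w - S' u‖ ≤ M * ‖L x‖) :
    ∃ T : K →L[ℂ] K, (∀ x, ‖T x‖ ≤ M * ‖L x‖) ∧
      ∀ x y, (x, y) ∈ E.graph → (S x, S' y + T x) ∈ E.graph := by
  have hS : ∀ x : C, S x ∈ E.domain := by
    intro x
    obtain ⟨u, w, -, hw, -⟩ := h x x.2
    exact mem_domain_of_mem_graph hw
  let f : C →ₗ[ℂ] K := E.toFun ∘ₗ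
    (S.toLinearMap.restrict (q := E.domain) (p := C) fun x hx => hS ⟨x, hx⟩)
    - S'.toLinearMap ∘ₗ E.toFun ∘ₗ Submodule.inclusion hC
  have hf : ∀ x : C, ∃ u w, ((x : K), u) ∈ E.graph ∧ (S x, w) ∈ E.graph ∧ f x = w - S' u := by
    intro x
    exact ⟨E ⟨x, hC x.2⟩, E ⟨S x, hS x⟩, E.mem_graph ⟨x, hC x.2⟩, E.mem_graph ⟨S x, hS x⟩, rfl⟩
  have hfn : ∀ x : C, ‖f x‖ ≤ M * ‖L x‖ := by
    intro x
    obtain ⟨u, w, h1, h2, h3⟩ := hf x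
    obtain ⟨u', w', h1', h2', h3'⟩ := h x x.2
    rw [h3, graph_unique h1 h1', graph_unique h2 h2']
    exact h3'
  have hd : Dense (C : Set K) := by
    rw [dense_iff_closure_eq, Set.eq_univ_iff_forall]
    intro x
    have hs : E.domain ≤ (C.topologicalClosure : Submodule ℂ K) := by
      intro y hy
      obtain ⟨v, hv⟩ := exists_mem_graph hy
      have h1 := hcore y v hv
      exact map_mem_closure continuous_fst h1 fun q hq => hq.2
    have h2 : closure (E.domain : Set K) ⊆ closure (C : Set K) :=
      closure_minimal hs isClosed_closure
    exact h2 (hE.dense_domain x)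
  have hd' : DenseRange (C.subtype) := by
    rw [DenseRange, Submodule.coe_subtype, Subtype.range_coe]
    exact hd
  have hb : ∃ c, ∀ x : C, ‖f x‖ ≤ c * ‖C.subtype x‖ :=
    ⟨M * ‖L‖, fun x => (hfn x).trans (by
      rw [mul_assoc]
      exact mul_le_mul_of_nonneg_left (L.le_opNorm _) hM)⟩
  have hT := LinearMap.extendOfNorm_eq hd' hb
  set T := f.extendOfNorm C.subtype
  refine ⟨T, fun x => ?_, fun x y hxy => ?_⟩
  · refine hd.induction (P := fun x => ‖T x‖ ≤ M * ‖L x‖) (fun x hx => ?_)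
      (isClosed_le T.continuous.norm (continuous_const.mul L.continuous.norm)) x
    have := hT ⟨x, hx⟩
    simp only [Submodule.coe_subtype] at this
    rw [this]
    exact hfn ⟨x, hx⟩
  · have hcl : IsClosed (E.graph : Set (K × K)) := hE.isClosed
    have h1 := map_mem_closure (t := (E.graph : Set (K × K)))
      (f := fun q : K × K => (S q.1, S' q.2 + T q.1)) (by fun_prop) (hcore x y hxy) (by
        rintro ⟨a, b⟩ ⟨hab, ha⟩
        obtain ⟨u, w, h1, h2, h3⟩ := hf ⟨a, ha⟩
        have h4 := hT ⟨a, ha⟩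
        simp only [Submodule.coe_subtype] at h4 h1 h2
        simp only
        rw [h4, h3, graph_unique hab h1, add_sub_cancel]
        exact h2)
    rwa [hcl.closure_eq] at h1

/-- Weak criterion for a vector to be in the domain of a selfadjoint operator: `Dom E = Dom E^*`. -/
theorem exists_graph_of_inner_le {E : K →ₗ.[ℂ] K} (hE : IsSelfAdjoint E) {x y : K} {c : ℝ}
    (hc : 0 ≤ c) (h : ∀ u v, (u, v) ∈ E.graph → ‖inner ℂ v x - inner ℂ u y‖ ≤ c * ‖u‖) :
    ∃ w, (x, w) ∈ E.graph ∧ ‖w - y‖ ≤ c := by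
  have hx : x ∈ (LinearPMap.adjoint E).domain := by
    rw [LinearPMap.mem_adjoint_domain_iff]
    refine AddMonoidHomClass.continuous_of_bound _ (c + ‖y‖) fun u => ?_
    change ‖inner ℂ x (E u)‖ ≤ (c + ‖y‖) * ‖(u : K)‖
    rw [norm_inner_symm]
    have h1 := h u (E u) (E.mem_graph u)
    have h2 := norm_sub_norm_le (inner ℂ (E u) x) (inner ℂ (u : K) y)
    have h3 := norm_inner_le_norm (𝕜 := ℂ) (u : K) y
    linarith
  rw [LinearPMap.isSelfAdjoint_def.1 hE] at hx
  obtain ⟨w, hw⟩ := exists_mem_graph hx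
  refine ⟨w, hw, ?_⟩
  have h1 : ∀ u : K, ‖inner ℂ u (w - y)‖ ≤ c * ‖u‖ := by
    refine hE.dense_domain.induction (fun u hu => ?_) (isClosed_le (by fun_prop) (by fun_prop))
    obtain ⟨v, hv⟩ := exists_mem_graph hu
    have h2 := h u v hv
    rwa [inner_graph_comm hE hw hv, ← inner_sub_right] at h2
  by_cases h0 : ‖w - y‖ = 0
  · rw [h0]
    exact hc
  · have h2 := h1 (w - y)
    rw [inner_self_eq_norm_sq_to_K, norm_pow, RCLike.norm_ofReal, abs_norm, sq] at h2
    exact le_of_mul_le_mul_right h2 (by positivity)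

end Cores

/-! ### Operators intertwining fields -/

section Intertwine
variable {G 𝔸 : Type*} [Group G] [TopologicalSpace G] [NonUnitalCStarAlgebra 𝔸]
  [IsTopologicalGroup G] [LocallyCompactSpace G] [T2Space G] [SecondCountableTopology G]
  [MeasurableSpace G] [BorelSpace G] (μ : Measure G) [μ.IsHaarMeasure]
  {K : Type*} [NormedAddCommGroup K] [InnerProductSpace ℂ K] [CompleteSpace K]
  [TopologicalSpace.SeparableSpace K]
  {𝓢 : CStarDynamics G 𝔸} (R : CovariantRep 𝓢 K) {E : G → K →ₗ.[ℂ] K}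

/-- A relation `E_{st} ρ(a) U_s = ρ(a') U_s E_t + X` between the fibers, for all `t`, passes to the
rotated operator. -/
theorem exists_translate_graph {s : G} {a a' : 𝔸} {X : K →L[ℂ] K} {c : ℝ}
    (hX : ∀ x, ‖X x‖ ≤ c * ‖x‖)
    (h : ∀ t x y, (x, y) ∈ (E t).graph →
      (R.ρ a ((R.U s : K →L[ℂ] K) x), R.ρ a' ((R.U s : K →L[ℂ] K) y) + X x) ∈ (E (s * t)).graph)
    {ξ ζ : Lp K 2 μ} (hξ : (ξ, ζ) ∈ (R.rotated μ E).graph) :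
    ∃ χ : Lp K 2 μ, ‖χ‖ ≤ c * ‖ξ‖ ∧
      (inducedRep μ R a (leftTranslate μ s ξ), inducedRep μ R a' (leftTranslate μ s ζ) + χ) ∈
        (R.rotated μ E).graph := by
  have hY : IsBoundedField fun r =>
      star (R.U r : K →L[ℂ] K) * (X * star (R.U s : K →L[ℂ] K)) * (R.U r : K →L[ℂ] K) :=
    IsBoundedField.rotated R ⟨fun x => continuous_const, ‖X * star (R.U s : K →L[ℂ] K)‖, fun t x =>
      ContinuousLinearMap.le_opNorm _ _⟩
  refine ⟨fieldOp μ _ hY (leftTranslate μ s ξ), ?_, ?_⟩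
  · rw [← norm_leftTranslate μ s ξ]
    refine Lp.norm_le_mul_norm_of_ae_le_mul ?_
    filter_upwards [fieldOp_ae_eq μ hY (leftTranslate μ s ξ)] with r hr
    rw [hr]
    simp only [mul_apply_eq_comp, R.star_U]
    rw [norm_unitary_apply (R.U r⁻¹).2]
    refine (hX _).trans_eq ?_
    rw [norm_unitary_apply (R.U s⁻¹).2, norm_unitary_apply (R.U r).2]
  · rw [mem_rotated_graph_iff] at hξ ⊢
    filter_upwards [ae_comp_left μ s hξ, inducedRep_ae_eq μ R a (leftTranslate μ s ξ),
      inducedRep_ae_eq μ R a' (leftTranslate μ s ζ), leftTranslate_ae_eq μ s ξ,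
      leftTranslate_ae_eq μ s ζ, fieldOp_ae_eq μ hY (leftTranslate μ s ξ),
      Lp.coeFn_add (inducedRep μ R a' (leftTranslate μ s ζ)) (fieldOp μ _ hY (leftTranslate μ s ξ))]
      with r h1 h2 h3 h4 h5 h6 h7
    have hU : ∀ x, (R.U r : K →L[ℂ] K) x = (R.U s : K →L[ℂ] K) ((R.U (s⁻¹ * r) : K →L[ℂ] K) x) := by
      intro x
      rw [← mul_apply_eq_comp, ← R.U_mul, mul_inv_cancel_left]
    have hρ : ∀ b x, (R.U r : K →L[ℂ] K) (R.ρ (𝓢.act r⁻¹ b) x) = R.ρ b ((R.U r : K →L[ℂ] K) x) := by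
      intro b x
      rw [R.act_inv_apply, ← mul_apply_eq_comp, ← mul_assoc, ← mul_assoc,
        Unitary.mul_star_self_of_mem (R.U r).2, one_mul]
      rfl
    have h8 := h _ _ _ h1
    rw [mul_inv_cancel_left] at h8
    rw [h2, h7, Pi.add_apply, h3, h6, map_add, hρ, hρ, h4, h5]
    have h9 : (R.U r : K →L[ℂ] K) ((star (R.U r : K →L[ℂ] K) * (X * star (R.U s : K →L[ℂ] K)) *
        (R.U r : K →L[ℂ] K)) (ξ (s⁻¹ * r))) = X ((R.U (s⁻¹ * r) : K →L[ℂ] K) (ξ (s⁻¹ * r))) := by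
      rw [← mul_apply_eq_comp, ← mul_assoc, ← mul_assoc, ← mul_assoc,
        Unitary.mul_star_self_of_mem (R.U r).2, one_mul]
      rw [mul_apply_eq_comp, mul_apply_eq_comp, hU, ← mul_apply_eq_comp (star _),
        Unitary.star_mul_self_of_mem (R.U s).2, one_apply_eq_self]
    rw [h9, hU, hU]
    exact h8

/-- Integrating `exists_translate_graph`: the regular representation maps the domain of the rotated
operator into itself, up to a bounded twisted commutator. -/
theorem exists_regularRep_graph (hE : IsSelfAdjoint (R.rotated μ E)) {f g : C_c(G, 𝔸)} {c : ℝ}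
    (hc : 0 ≤ c) (hg : ∀ s, f s = 0 → g s = 0)
    (h : ∀ s ∈ tsupport f, ∃ X : K →L[ℂ] K, (∀ x, ‖X x‖ ≤ c * ‖x‖) ∧
      ∀ t x y, (x, y) ∈ (E t).graph → (R.ρ (f s) ((R.U s : K →L[ℂ] K) x),
        R.ρ (g s) ((R.U s : K →L[ℂ] K) y) + X x) ∈ (E (s * t)).graph)
    {ξ ζ : Lp K 2 μ} (hξ : (ξ, ζ) ∈ (R.rotated μ E).graph) :
    ∃ w, (regularRep μ R f ξ, w) ∈ (R.rotated μ E).graph ∧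
      ‖w - regularRep μ R g ζ‖ ≤ c * μ.real (tsupport f) * ‖ξ‖ := by
  refine exists_graph_of_inner_le hE (by positivity) fun u v huv => ?_
  have i1 : Integrable (fun s => inner ℂ v (inducedRep μ R (f s) (leftTranslate μ s ξ))) μ :=
    (integrable_regular μ R f ξ).const_inner v
  have i2 : Integrable (fun s => inner ℂ u (inducedRep μ R (g s) (leftTranslate μ s ζ))) μ :=
    (integrable_regular μ R g ζ).const_inner u
  rw [inner_regularRep_right, inner_regularRep_right, ← integral_sub i1 i2]
  rw [← setIntegral_eq_integral_of_forall_compl_eq_zero (s := tsupport f)]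
  · have hfin : μ (tsupport f) < ∞ := f.hasCompactSupport.measure_lt_top
    refine (norm_setIntegral_le_of_norm_le_const (C := c * ‖ξ‖ * ‖u‖) hfin fun s hs => ?_).trans_eq
      (by ring)
    obtain ⟨X, hX, hX'⟩ := h s hs
    obtain ⟨χ, hχ, hχ'⟩ := exists_translate_graph μ R hX hX' hξ
    rw [inner_graph_comm hE hχ' huv, inner_add_right, add_sub_cancel_left]
    refine (norm_inner_le_norm _ _).trans ?_
    rw [mul_comm]
    exact mul_le_mul_of_nonneg_right hχ (norm_nonneg _)
  · intro s hs
    have h0 := image_eq_zero_of_notMem_tsupport hs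
    rw [h0, hg s h0]
    simp

end Intertwine

/-! ### Off-diagonal operators on `K ⊗ ℂ²` -/

section OffDiag
variable {K : Type*} [NormedAddCommGroup K] [InnerProductSpace ℂ K] [CompleteSpace K]

/-- The operator with matrix `(0, S; T, 0)` on `K ⊗ ℂ²`. -/
def offDiag (S T : K →L[ℂ] K) : Twofold K →L[ℂ] Twofold K :=
  ((PiLp.continuousLinearEquiv 2 ℂ (fun _ : Fin 2 => K)).symm : (Fin 2 → K) →L[ℂ] Twofold K) ∘L
    ContinuousLinearMap.pi ![S ∘L PiLp.proj 2 (fun _ : Fin 2 => K) 1,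
      T ∘L PiLp.proj 2 (fun _ : Fin 2 => K) 0]

theorem offDiag_apply_zero (S T : K →L[ℂ] K) (x : Twofold K) : offDiag S T x 0 = S (x 1) := rfl

theorem offDiag_apply_one (S T : K →L[ℂ] K) (x : Twofold K) : offDiag S T x 1 = T (x 0) := rfl

theorem norm_sq_twofold (x : Twofold K) : ‖x‖ ^ 2 = ‖x 0‖ ^ 2 + ‖x 1‖ ^ 2 := by
  rw [PiLp.norm_sq_eq_of_L2, Fin.sum_univ_two]

theorem norm_offDiag_apply_le {S T : K →L[ℂ] K} {c : ℝ} (hc : 0 ≤ c) (hS : ∀ x, ‖S x‖ ≤ c * ‖x‖)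
    (hT : ∀ x, ‖T x‖ ≤ c * ‖x‖) (x : Twofold K) : ‖offDiag S T x‖ ≤ c * ‖x‖ := by
  refine le_of_sq_le_sq ?_ (by positivity)
  rw [mul_pow, norm_sq_twofold, norm_sq_twofold, offDiag_apply_zero, offDiag_apply_one]
  have h1 := pow_le_pow_left₀ (norm_nonneg _) (hS (x 1)) 2
  have h2 := pow_le_pow_left₀ (norm_nonneg _) (hT (x 0)) 2
  rw [mul_pow] at h1 h2
  linarith

end OffDiag

/-! ### Twisted commutators -/

section Twisted
variable {G 𝔸 : Type*} [Group G] [TopologicalSpace G] [NonUnitalCStarAlgebra 𝔸]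
  [IsTopologicalGroup G] [LocallyCompactSpace G] [T2Space G] [SecondCountableTopology G]
  [MeasurableSpace G] [BorelSpace G] (μ : Measure G) [μ.IsHaarMeasure]
  {K : Type*} [NormedAddCommGroup K] [InnerProductSpace ℂ K] [CompleteSpace K]
  [TopologicalSpace.SeparableSpace K]
  {𝓢 : CStarDynamics G 𝔸} (R : CovariantRep 𝓢 K) {A : NonUnitalStarSubalgebra ℂ 𝔸}
  {p : G → 𝓜(ℂ, 𝔸)ˣ}

theorem CovariantRep.amp_U_apply (r : G) (x : Twofold K) (i : Fin 2) :
    (R.amp.U r : Twofold K →L[ℂ] Twofold K) x i = (R.U r : K →L[ℂ] K) (x i) := rfl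

/-- The fiberwise form of `π(β(f)) Θ = Θ π(f)`. -/
theorem multiplierRep_mul_rep_mul_U (hR : IsNondegenerate R.ρ) (hA : Dense (A : Set 𝔸))
    (hp : IsCentralCocycle 𝓢 A p) (s t : G) (a : 𝔸) :
    multiplierRep R.ρ (p (s * t)) * (R.ρ a * (R.U s : K →L[ℂ] K)) =
      R.ρ ((p s : 𝓜(ℂ, 𝔸)).fst a) * (R.U s : K →L[ℂ] K) * multiplierRep R.ρ (p t) := by
  rw [← mul_assoc, multiplierRep_mul_rep hR, ← rep_mul_multiplierRep hR hA hp, mul_assoc,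
    multiplierRep_cocycle R hR hp, ← mul_assoc, ← mul_assoc, rep_mul_multiplierRep hR hA hp]

/-- `π(β(f)) Θ ⊆ Θ π(f)`: the relation holds fiberwise with vanishing defect. -/
theorem modularOp_implemented (hR : IsNondegenerate R.ρ) (hA : Dense (A : Set 𝔸))
    (hp : IsCentralCocycle 𝓢 A p) (hP : ∀ r, IsSelfAdjoint (multiplierRep R.ρ (p r)))
    {f g : C_c(G, 𝔸)} (hg : ∀ s, g s = (p s : 𝓜(ℂ, 𝔸)).fst (f s)) {ξ ζ : Lp (Twofold K) 2 μ}
    (h : (ξ, ζ) ∈ (modularOp R μ p).graph) :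
    (regularRep μ R.amp f ξ, regularRep μ R.amp g ζ) ∈ (modularOp R μ p).graph := by
  obtain ⟨w, hw, hw'⟩ := exists_regularRep_graph μ R.amp (E := fun r =>
    ofBounded (ampOp (multiplierRep R.ρ (p r)))) (isSelfAdjoint_modularOp μ R hR hp hP) (f := f)
    (g := g) le_rfl (fun s hs => by rw [hg, hs, map_zero])
    (fun s _ => ⟨0, by simp, fun t x y hxy => by
      rw [mem_ofBounded_graph] at hxy ⊢
      ext i
      rw [← hxy, _root_.zero_apply, add_zero, hg, ampOp_apply, R.amp_ρ_apply, R.amp_ρ_apply,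
        R.amp_U_apply, R.amp_U_apply, ampOp_apply]
      exact DFunLike.congr_fun (multiplierRep_mul_rep_mul_U R hR hA hp s t (f s)) (x i)⟩) h
  rw [zero_mul, zero_mul] at hw'
  rw [sub_eq_zero.1 (norm_le_zero_iff.1 hw')] at hw
  exact hw

/-- The bound on `[D, ρ(f(s)) z(s)] z(s)⁻¹` is a bound on the twisted commutator
`D ρ(f(s)) U_s - ρ(p(s) f(s)) U_s D`, since `U_s D = z(s)*⁻¹ D z(s)⁻¹ U_s`. -/
theorem exists_fiber_commutator {D : K →ₗ.[ℂ] K} (hD : IsSelfAdjoint D)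
    (hR : IsNondegenerate R.ρ) (hA : Dense (A : Set 𝔸)) (hp : IsCentralCocycle 𝓢 A p) {s : G}
    {z : (K →L[ℂ] K)ˣ}
    (hz : AgreeOnCommonCore (sandwich (R.U s : K →L[ℂ] K) D (star (R.U s : K →L[ℂ] K)))
      (sandwich (star (z⁻¹ : (K →L[ℂ] K)ˣ).val) D (z⁻¹ : (K →L[ℂ] K)ˣ).val))
    (hpz : multiplierRep R.ρ (p s) = (z : K →L[ℂ] K) * star (z : K →L[ℂ] K)) {a : 𝔸} {M : ℝ}
    (hM : 0 ≤ M) {C : Submodule ℂ K} (hC : D.HasCore C)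
    (h : ∀ h ∈ C, ∃ u w : K, (h, u) ∈ D.graph ∧ (R.ρ a ((z : K →L[ℂ] K) h), w) ∈ D.graph ∧
        ‖w - R.ρ a ((z : K →L[ℂ] K) u)‖ ≤ M * ‖(z : K →L[ℂ] K) h‖) :
    ∃ B : K →L[ℂ] K, (∀ x, ‖B x‖ ≤ M * ‖x‖) ∧ ∀ x y, (x, y) ∈ D.graph →
      (R.ρ a ((R.U s : K →L[ℂ] K) x),
        R.ρ ((p s : 𝓜(ℂ, 𝔸)).fst a) ((R.U s : K →L[ℂ] K) y) + B x) ∈ D.graph := by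
  obtain ⟨T, hT, hT'⟩ := exists_bounded_commutator hD (S := R.ρ a * (z : K →L[ℂ] K))
    (S' := R.ρ a * (z : K →L[ℂ] K)) (L := (z : K →L[ℂ] K)) hC.le_domain
    (fun x y hxy => mem_closure_of_hasCore hD hC hxy) hM h
  have hzz : ∀ x, (z : K →L[ℂ] K) ((z⁻¹ : (K →L[ℂ] K)ˣ).val x) = x := fun x => by
    rw [← mul_apply_eq_comp, Units.mul_inv]
    rfl
  refine ⟨T * (z⁻¹ : (K →L[ℂ] K)ˣ).val * (R.U s : K →L[ℂ] K), fun x => ?_, fun x y hxy => ?_⟩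
  · have h1 := hT ((z⁻¹ : (K →L[ℂ] K)ˣ).val ((R.U s : K →L[ℂ] K) x))
    rw [hzz, norm_unitary_apply (R.U s).2] at h1
    exact h1
  · have h1 : ((R.U s : K →L[ℂ] K) x, (R.U s : K →L[ℂ] K) y) ∈
        (sandwich (R.U s : K →L[ℂ] K) D (star (R.U s : K →L[ℂ] K))).graph := by
      rw [mem_sandwich_graph]
      refine ⟨y, ?_, rfl⟩
      rwa [← mul_apply_eq_comp, Unitary.star_mul_self_of_mem (R.U s).2]
    rw [hz.eq, mem_sandwich_graph] at h1
    obtain ⟨v, hv, hv'⟩ := h1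
    have h2 := hT' _ _ hv
    have h3 : v = star (z : K →L[ℂ] K) ((R.U s : K →L[ℂ] K) y) := by
      rw [← hv', ← mul_apply_eq_comp, ← star_mul, Units.inv_mul, star_one]
      rfl
    rw [mul_apply_eq_comp, hzz, h3] at h2
    rw [← rep_mul_multiplierRep hR hA hp, hpz]
    exact h2

/-- `𝒟 π(f) - π(β(f)) 𝒟` is bounded. In the fibers this is a bound for both summands of `𝒟`: for `D`
it is `exists_fiber_commutator`, and for `T_p` the part `ω ρ(p)` intertwines exactly, so that only
the constant `η` contributes. -/
theorem exists_twisted_commutator {D : K →ₗ.[ℂ] K} (hD : IsSelfAdjoint D)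
    (hR : IsNondegenerate R.ρ) (hA : Dense (A : Set 𝔸)) (hp : IsCentralCocycle 𝓢 A p)
    {z : G → (K →L[ℂ] K)ˣ}
    (hz : ∀ r, AgreeOnCommonCore
      (sandwich (R.U r : K →L[ℂ] K) D (star (R.U r : K →L[ℂ] K)))
      (sandwich (star ((z r)⁻¹ : (K →L[ℂ] K)ˣ).val) D ((z r)⁻¹ : (K →L[ℂ] K)ˣ).val))
    (hpz : ∀ r, multiplierRep R.ρ (p r) = (z r : K →L[ℂ] K) * star (z r : K →L[ℂ] K))
    (η ω : ℝ) {f g : C_c(G, 𝔸)} (hg : ∀ s, g s = (p s : 𝓜(ℂ, 𝔸)).fst (f s))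
    (hcomm : ∃ M : ℝ, ∀ r ∈ tsupport f, ∃ C : Submodule ℂ K, D.HasCore C ∧
      ∀ h ∈ C, ∃ u w : K, (h, u) ∈ D.graph ∧ (R.ρ (f r) ((z r : K →L[ℂ] K) h), w) ∈ D.graph ∧
        ‖w - R.ρ (f r) ((z r : K →L[ℂ] K) u)‖ ≤ M * ‖(z r : K →L[ℂ] K) h‖) :
    ∃ T : Lp (Twofold K) 2 μ →L[ℂ] Lp (Twofold K) 2 μ, ∀ ξ ζ, (ξ, ζ) ∈ (diracOp R μ D p η ω).graph →
      (regularRep μ R.amp f ξ, regularRep μ R.amp g ζ + T ξ) ∈ (diracOp R μ D p η ω).graph := by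
  have hP : ∀ r, IsSelfAdjoint (multiplierRep R.ρ (p r)) := fun r =>
    isSelfAdjoint_unit_mul_star (hpz r)
  have hdirac := isSelfAdjoint_diracOp μ R hR hp hP hD η ω
  obtain ⟨M, hM⟩ := hcomm
  obtain ⟨c₁, hc₁⟩ := f.hasCompactSupport.exists_bound_of_continuous f.continuous
  obtain ⟨c₂, hc₂⟩ := g.hasCompactSupport.exists_bound_of_continuous g.continuous
  have hc₁0 : 0 ≤ c₁ := (norm_nonneg _).trans (hc₁ 1)
  have hc₂0 : 0 ≤ c₂ := (norm_nonneg _).trans (hc₂ 1)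
  set c := |M| + |η| * (c₁ + c₂) with hc
  have hc0 : 0 ≤ c := by positivity
  have key : ∀ s ∈ tsupport f, ∃ X : Twofold K →L[ℂ] Twofold K, (∀ x, ‖X x‖ ≤ c * ‖x‖) ∧
      ∀ t x y, (x, y) ∈ (pauliSum D (fiberT R p η ω t)).graph →
        (R.amp.ρ (f s) ((R.amp.U s : Twofold K →L[ℂ] Twofold K) x),
          R.amp.ρ (g s) ((R.amp.U s : Twofold K →L[ℂ] Twofold K) y) + X x) ∈
            (pauliSum D (fiberT R p η ω (s * t))).graph := by
    intro s hs
    obtain ⟨C, hC, hC'⟩ := hM s hs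
    obtain ⟨B, hB, hB'⟩ := exists_fiber_commutator R hD hR hA hp (hz s) (hpz s) (abs_nonneg M) hC
      fun h hh => by
        obtain ⟨u, w, h1, h2, h3⟩ := hC' h hh
        exact ⟨u, w, h1, h2, h3.trans (mul_le_mul_of_nonneg_right (le_abs_self M) (norm_nonneg _))⟩
    rw [← hg] at hB'
    -- the defect of the intertwining relation for `T_p`: its scalar part `η` is not twisted
    set N : K →L[ℂ] K := (η : ℂ) • ((R.ρ (g s) - R.ρ (f s)) * (R.U s : K →L[ℂ] K)) with hN
    have hNn : ∀ x, ‖N x‖ ≤ |η| * (c₁ + c₂) * ‖x‖ := by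
      intro x
      rw [hN, _root_.smul_apply, norm_smul, Complex.norm_real, Real.norm_eq_abs, mul_assoc,
        mul_apply_eq_comp, _root_.sub_apply]
      refine mul_le_mul_of_nonneg_left ?_ (abs_nonneg _)
      have h1 : ∀ a : 𝔸, ‖R.ρ a ((R.U s : K →L[ℂ] K) x)‖ ≤ ‖a‖ * ‖x‖ := fun a => by
        refine (ContinuousLinearMap.le_opNorm _ _).trans ?_
        rw [norm_unitary_apply (R.U s).2]
        exact mul_le_mul_of_nonneg_right (NonUnitalStarAlgHom.norm_apply_le R.ρ a) (norm_nonneg _)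
      refine (norm_sub_le _ _).trans ?_
      have h2 := h1 (f s)
      have h3 := h1 (g s)
      nlinarith [norm_nonneg x, hc₁ s, hc₂ s]
    have hdef : ∀ t x, R.ρ (g s) ((R.U s : K →L[ℂ] K) (fiberT R p η ω t x)) =
        fiberT R p η ω (s * t) (R.ρ (f s) ((R.U s : K →L[ℂ] K) x)) + N x := by
      intro t x
      have h1 := DFunLike.congr_fun (multiplierRep_mul_rep_mul_U R hR hA hp s t (f s)) x
      rw [← hg] at h1
      simp only [mul_apply_eq_comp] at h1
      simp only [fiberT, hN, _root_.add_apply, _root_.smul_apply, one_apply_eq_self,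
        mul_apply_eq_comp, _root_.sub_apply, map_add, map_smul, h1, smul_sub]
      abel
    refine ⟨offDiag (B + Complex.I • N) (B - Complex.I • N), ?_, fun t x y hxy => ?_⟩
    · have hIN : ∀ x, ‖(Complex.I • N) x‖ ≤ |η| * (c₁ + c₂) * ‖x‖ := fun x => by
        rw [_root_.smul_apply, norm_smul, Complex.norm_I, one_mul]
        exact hNn x
      refine norm_offDiag_apply_le hc0 (fun x => ?_) fun x => ?_
      · rw [hc, add_mul]
        exact (norm_add_le _ _).trans (add_le_add (hB x) (hIN x))
      · rw [hc, add_mul]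
        exact (norm_sub_le _ _).trans (add_le_add (hB x) (hIN x))
    · rw [mem_pauliSum_graph] at hxy ⊢
      refine ⟨?_, ?_⟩
      · convert hB' _ _ hxy.1 using 2
        · rw [R.amp_ρ_apply, R.amp_U_apply]
        rw [map_add, map_add, map_smul, map_smul, hdef, PiLp.add_apply, offDiag_apply_zero,
          R.amp_ρ_apply, R.amp_ρ_apply, R.amp_U_apply, R.amp_U_apply, _root_.add_apply,
          _root_.smul_apply, smul_add]
        abel
      · convert hB' _ _ hxy.2 using 2
        · rw [R.amp_ρ_apply, R.amp_U_apply]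
        rw [map_sub, map_sub, map_smul, map_smul, hdef, PiLp.add_apply, offDiag_apply_one,
          R.amp_ρ_apply, R.amp_ρ_apply, R.amp_U_apply, R.amp_U_apply, _root_.sub_apply,
          _root_.smul_apply, smul_add]
        abel
  obtain ⟨T, -, hT⟩ := exists_bounded_commutator hdirac (S := regularRep μ R.amp f)
    (S' := regularRep μ R.amp g) (L := 1) (C := (diracOp R μ D p η ω).domain) le_rfl
    (fun x y hxy => subset_closure ⟨hxy, mem_domain_of_mem_graph hxy⟩)
    (M := c * μ.real (tsupport f)) (by positivity) fun x hx => by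
      obtain ⟨y, hy⟩ := exists_mem_graph hx
      obtain ⟨w, hw, hw'⟩ := exists_regularRep_graph μ R.amp hdirac hc0
        (fun s hs => by rw [hg, hs, map_zero]) key hy
      exact ⟨y, w, hy, hw, hw'⟩
  exact ⟨T, hT⟩

end Twisted

/-! ### Compact operators and weakly null sequences -/

section Compact
variable {K K' : Type*} [NormedAddCommGroup K] [InnerProductSpace ℂ K] [CompleteSpace K]
  [NormedAddCommGroup K'] [InnerProductSpace ℂ K'] [CompleteSpace K']

/-- A bounded sequence which converges weakly to `0`. -/
structure IsWeaklyNull (y : ℕ → K) : Prop where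
  bounded : ∃ c, ∀ n, ‖y n‖ ≤ c
  tendsto_inner : ∀ w, Tendsto (fun n => inner ℂ w (y n)) atTop (𝓝 0)

theorem IsWeaklyNull.map {y : ℕ → K} (hy : IsWeaklyNull y) (T : K →L[ℂ] K') :
    IsWeaklyNull fun n => T (y n) := by
  obtain ⟨c, hc⟩ := hy.bounded
  refine ⟨⟨‖T‖ * c, fun n => ?_⟩, fun w => ?_⟩
  · exact (T.le_opNorm _).trans (mul_le_mul_of_nonneg_left (hc n) (norm_nonneg _))
  · simp only [← ContinuousLinearMap.adjoint_inner_left]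
    exact hy.tendsto_inner _

/-- Compact operators map weakly null sequences to null sequences. -/
theorem tendsto_of_isWeaklyNull {T : K →L[ℂ] K'} (hT : IsCompactOperator T) {y : ℕ → K}
    (hy : IsWeaklyNull y) : Tendsto (fun n => T (y n)) atTop (𝓝 0) := by
  obtain ⟨c, hc⟩ := hy.bounded
  obtain ⟨S, hS, hS'⟩ := IsCompactOperator.image_closedBall_subset_compact
    (f := T.toLinearMap) hT c
  refine tendsto_of_subseq_tendsto fun ns hns => ?_
  obtain ⟨z, -, φ, hφ, hz⟩ := hS.tendsto_subseq (x := fun n => T (y (ns n))) fun n =>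
    hS' ⟨y (ns n), by simpa using hc _, rfl⟩
  have h0 : z = 0 := by
    refine ext_inner_left ℂ fun w => ?_
    have h1 : Tendsto (fun n => inner ℂ w (T (y (ns (φ n))))) atTop (𝓝 (inner ℂ w z)) :=
      (continuous_const.inner continuous_id).continuousAt.tendsto.comp hz
    have h2 := ((hy.map T).tendsto_inner w).comp (hns.comp hφ.tendsto_atTop)
    rw [inner_zero_right]
    exact tendsto_nhds_unique h1 h2
  exact ⟨φ, h0 ▸ hz⟩

/-- On a separable Hilbert space, an operator which maps weakly null sequences to null sequences is
the norm limit of its restrictions to finite dimensional subspaces, hence compact. -/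
theorem isCompactOperator_of_isWeaklyNull [TopologicalSpace.SeparableSpace K] {T : K →L[ℂ] K'}
    (h : ∀ y : ℕ → K, IsWeaklyNull y → Tendsto (fun n => T (y n)) atTop (𝓝 0)) :
    IsCompactOperator T := by
  set d := TopologicalSpace.denseSeq K
  set U : ℕ → Submodule ℂ K := fun n => Submodule.span ℂ (d '' Set.Iio n)
  have hfin : ∀ n, FiniteDimensional ℂ (U n) := fun n =>
    FiniteDimensional.span_of_finite ℂ ((Set.finite_Iio n).image d)
  have hU : Monotone U := fun m n hmn =>
    Submodule.span_mono (Set.image_mono (Set.Iio_subset_Iio hmn))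
  have hUd : ⊤ ≤ (⨆ n, U n).topologicalClosure := by
    intro x _
    refine closure_mono ?_ (TopologicalSpace.denseRange_denseSeq K x)
    rintro _ ⟨n, rfl⟩
    exact Submodule.mem_iSup_of_mem (n + 1)
      (Submodule.subset_span ⟨n, Set.mem_Iio.2 (Nat.lt_succ_self n), rfl⟩)
  have hlim := fun x => Submodule.starProjection_tendsto_self U hU x hUd
  have key : Tendsto (fun n => T ∘L (U n).starProjection) atTop (𝓝 T) := by
    rw [tendsto_iff_norm_sub_tendsto_zero]
    -- vectors at which `T P_n - T` nearly attains its norm form a weakly null sequence after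
    -- projection to the complement of `U n`
    have hx : ∀ n, ∃ x : K, ‖x‖ ≤ 1 ∧
        ‖T ∘L (U n).starProjection - T‖ ≤ 2 * ‖T (x - (U n).starProjection x)‖ := by
      intro n
      set B := T ∘L (U n).starProjection - T
      by_cases h0 : ‖B‖ = 0
      · exact ⟨0, by simp, by rw [h0]; positivity⟩
      · have hlt : ‖B‖ / 2 < ‖B‖ := half_lt_self (by positivity)
        obtain ⟨x, hx1, hx2⟩ := B.exists_lt_apply_of_lt_opNorm hlt
        refine ⟨x, hx1.le, ?_⟩
        have h1 : ‖B x‖ = ‖T (x - (U n).starProjection x)‖ := by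
          rw [map_sub, norm_sub_rev]
          rfl
        rw [← h1]
        linarith
    choose x hx1 hx2 using hx
    have hy : IsWeaklyNull fun n => x n - (U n).starProjection (x n) := by
      refine ⟨⟨2, fun n => ?_⟩, fun w => ?_⟩
      · have := (U n).norm_starProjection_apply_le (x n)
        have h2 := norm_sub_le (x n) ((U n).starProjection (x n))
        linarith [hx1 n]
      · have h1 : ∀ n, inner ℂ w (x n - (U n).starProjection (x n)) =
            inner ℂ (w - (U n).starProjection w) (x n) := fun n => by
          rw [inner_sub_right, inner_sub_left, Submodule.inner_starProjection_left_eq_right]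
        simp only [h1]
        refine squeeze_zero_norm (a := fun n => ‖w - (U n).starProjection w‖) (fun n => ?_) ?_
        · exact (norm_inner_le_norm _ _).trans (mul_le_of_le_one_right (norm_nonneg _) (hx1 n))
        · have := ((tendsto_const_nhds (x := w)).sub (hlim w)).norm
          simpa using this
    have h3 := ((h _ hy).norm).const_mul 2
    rw [norm_zero, mul_zero] at h3
    exact squeeze_zero (fun n => norm_nonneg _) hx2 h3
  refine isCompactOperator_of_tendsto key (Eventually.of_forall fun n => ?_)
  have h1 : IsCompactOperator (T ∘L (U n).subtypeL) := by
    have : ProperSpace (U n) := FiniteDimensional.proper ℂ (U n)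
    exact isCompactOperator_of_locallyCompactSpace_rng _
  exact h1.comp_clm ((U n).orthogonalProjectionOnto)

theorem isCompactOperator_of_adjoint_mul [TopologicalSpace.SeparableSpace K] {T : K →L[ℂ] K'}
    (h : IsCompactOperator (T.adjoint ∘L T)) : IsCompactOperator T := by
  refine isCompactOperator_of_isWeaklyNull fun y hy => ?_
  obtain ⟨c, hc⟩ := hy.bounded
  have h1 := (tendsto_of_isWeaklyNull h hy).norm.mul_const c
  rw [norm_zero, zero_mul] at h1
  have h2 : ∀ n, ‖T (y n)‖ ^ 2 ≤ ‖(T.adjoint ∘L T) (y n)‖ * c := by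
    intro n
    have h3 : ((‖T (y n)‖ ^ 2 : ℝ) : ℂ) = inner ℂ ((T.adjoint ∘L T) (y n)) (y n) := by
      rw [ContinuousLinearMap.comp_apply, ContinuousLinearMap.adjoint_inner_left,
        inner_self_eq_norm_sq_to_K]
      simp
    have h4 : ‖T (y n)‖ ^ 2 = ‖inner ℂ ((T.adjoint ∘L T) (y n)) (y n)‖ := by
      rw [← h3, Complex.norm_real, Real.norm_of_nonneg (by positivity)]
    rw [h4]
    exact (norm_inner_le_norm _ _).trans (mul_le_mul_of_nonneg_left (hc n) (norm_nonneg _))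
  have h5 := squeeze_zero (fun n => by positivity) h2 h1
  rw [tendsto_zero_iff_norm_tendsto_zero]
  have h6 := h5.sqrt
  simpa using h6

/-- Schauder's theorem on separable Hilbert spaces. -/
theorem isCompactOperator_adjoint [TopologicalSpace.SeparableSpace K'] {T : K →L[ℂ] K'}
    (h : IsCompactOperator T) : IsCompactOperator T.adjoint := by
  refine isCompactOperator_of_adjoint_mul ?_
  rw [ContinuousLinearMap.adjoint_adjoint]
  exact h.comp_clm T.adjoint

/-- An operator with compact adjoint is compact. -/
theorem isCompactOperator_of_adjoint [TopologicalSpace.SeparableSpace K] {T : K →L[ℂ] K'}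
    (h : IsCompactOperator T.adjoint) : IsCompactOperator T := by
  rw [← ContinuousLinearMap.adjoint_adjoint T]
  exact isCompactOperator_adjoint h

end Compact

/-! ### Compact resolvents -/

section CompactResolvent
variable {K : Type*} [NormedAddCommGroup K] [InnerProductSpace ℂ K] [CompleteSpace K]
  [TopologicalSpace.SeparableSpace K]

theorem bracketPow_half_mul_self {D : K →ₗ.[ℂ] K} (hD : IsSelfAdjoint D) :
    bracketPow D (1 / 2) * bracketPow D (1 / 2) = resolventSq D := by
  have h0 := resolventSq_nonneg hD
  change resolventSq D ^ (1 / 2 : ℝ) * resolventSq D ^ (1 / 2 : ℝ) = resolventSq D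
  rw [← CFC.sqrt_eq_rpow, CFC.sqrt_mul_sqrt_self _ h0]

/-- If `a (1 + D²)^{-1/2}` is compact, then so is `a (D + i)⁻¹`. -/
theorem isCompactOperator_mul_resolvent {D : K →ₗ.[ℂ] K} (hD : IsSelfAdjoint D) {a : K →L[ℂ] K}
    (h : IsCompactOperator (a * bracketPow D (1 / 2))) : IsCompactOperator (a * resolvent D 1) := by
  refine isCompactOperator_of_adjoint (isCompactOperator_of_adjoint_mul ?_)
  rw [ContinuousLinearMap.adjoint_adjoint]
  have h1 : (a * resolvent D 1) ∘L (a * resolvent D 1).adjoint =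
      (a * bracketPow D (1 / 2)) ∘L (bracketPow D (1 / 2) * star a) := by
    change a * resolvent D 1 * star (a * resolvent D 1) =
      a * bracketPow D (1 / 2) * (bracketPow D (1 / 2) * star a)
    rw [star_mul, star_resolvent hD (by norm_num), mul_assoc a, ← mul_assoc (resolvent D 1),
      ← resolventSq_eq_mul hD (by norm_num), mul_assoc a, ← mul_assoc (bracketPow D _),
      bracketPow_half_mul_self hD]
  rw [h1]
  exact h.comp_clm _

/-- If `a (E + i)⁻¹` is compact, then so is `a (1 + E²)^{-s}` for `s > 0`: approximate the power by
polynomials without constant term in `(1 + E²)⁻¹ = (E + i)⁻¹ (E - i)⁻¹`. -/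
theorem isCompactOperator_mul_bracketPow {E : K →ₗ.[ℂ] K} (hE : IsSelfAdjoint E) {a : K →L[ℂ] K}
    (h : IsCompactOperator (a * resolvent E 1)) {s : ℝ} (hs : 0 < s) :
    IsCompactOperator (a * bracketPow E s) := by
  have hq : ∀ n : ℕ, ∃ q : Polynomial ℝ,
      ‖Polynomial.aeval (resolventSq E) (q * Polynomial.X) - bracketPow E s‖ ≤
        1 / ((n : ℝ) + 1) := by
    intro n
    obtain ⟨q, hq⟩ := exists_polynomial_near_rpow hs (ε := 1 / ((n : ℝ) + 1)) (by positivity)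
    exact ⟨q, norm_aeval_sub_rpow_le (resolventSq_nonneg hE) (norm_resolventSq_le hE) hs
      (by positivity) hq⟩
  choose q hq using hq
  have hlim : Tendsto (fun n => Polynomial.aeval (resolventSq E) (q n * Polynomial.X)) atTop
      (𝓝 (bracketPow E s)) := by
    rw [tendsto_iff_norm_sub_tendsto_zero]
    exact squeeze_zero (fun n => norm_nonneg _) hq tendsto_one_div_add_atTop_nhds_zero_nat
  refine isCompactOperator_of_tendsto (hlim.const_mul a) (Eventually.of_forall fun n => ?_)
  have h1 : a * Polynomial.aeval (resolventSq E) (q n * Polynomial.X) =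
      (a * resolvent E 1) ∘L (resolvent E (-1) * Polynomial.aeval (resolventSq E) (q n)) := by
    change _ = a * resolvent E 1 * (resolvent E (-1) * Polynomial.aeval (resolventSq E) (q n))
    rw [mul_comm, map_mul, Polynomial.aeval_X, resolventSq_eq_mul hE (c := 1) (by norm_num)]
    simp only [mul_assoc]
  rw [h1]
  exact h.comp_clm _

/-- The components of `(E ⊗ γ¹ + T ⊗ γ² + i)⁻¹ x` are in the range of `(E + i)⁻¹`, so compactness
passes from `E` to `E ⊗ γ¹ + T ⊗ γ²`. -/
theorem isCompactOperator_amp_mul_resolvent {E : K →ₗ.[ℂ] K} (hE : IsSelfAdjoint E)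
    {T : K →L[ℂ] K} (hT : IsSelfAdjoint T) {a : K →L[ℂ] K}
    (h : IsCompactOperator (a * resolvent E 1)) :
    IsCompactOperator (ampOp a * resolvent (pauliSum E T) 1) := by
  have hF := isSelfAdjoint_pauliSum hE hT
  set F := resolvent (pauliSum E T) 1 with hFdef
  -- solving the two components of `(E ⊗ γ¹ + T ⊗ γ² + i) F x = x` for `(E + i) (F x)_i`
  let π (i : Fin 2) : Twofold K →L[ℂ] K := PiLp.proj 2 (fun _ : Fin 2 => K) i
  set L₀ : Twofold K →L[ℂ] K := π 1 - Complex.I • (π 1 ∘L F) - Complex.I • (T ∘L π 0 ∘L F) +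
    Complex.I • (π 0 ∘L F) with hL₀
  set L₁ : Twofold K →L[ℂ] K := π 0 - Complex.I • (π 0 ∘L F) + Complex.I • (T ∘L π 1 ∘L F) +
    Complex.I • (π 1 ∘L F) with hL₁
  have hF' : ∀ x, F x 1 = resolvent E 1 (L₁ x) ∧ F x 0 = resolvent E 1 (L₀ x) := by
    intro x
    have h1 := mem_graph_resolvent hF (c := 1) (by norm_num) x
    rw [← hFdef, mem_pauliSum_graph] at h1
    refine ⟨?_, ?_⟩
    · rw [← resolvent_eq hE (c := 1) (by norm_num) h1.1]
      congr 1
      simp [hL₁, π]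
    · rw [← resolvent_eq hE (c := 1) (by norm_num) h1.2]
      congr 1
      simp [hL₀, π]
  let ι (i : Fin 2) : K →L[ℂ] Twofold K :=
    ((PiLp.continuousLinearEquiv 2 ℂ (fun _ : Fin 2 => K)).symm : (Fin 2 → K) →L[ℂ] Twofold K) ∘L
      ContinuousLinearMap.single ℂ (fun _ : Fin 2 => K) i
  have h2 : ampOp a * F = ι 0 ∘L (a * resolvent E 1) ∘L L₀ + ι 1 ∘L (a * resolvent E 1) ∘L L₁ := by
    ext x i
    rw [mul_apply_eq_comp, ampOp_apply, _root_.add_apply, PiLp.add_apply]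
    fin_cases i
    · change a (F x 0) = a (resolvent E 1 (L₀ x)) + 0
      rw [(hF' x).2, add_zero]
    · change a (F x 1) = 0 + a (resolvent E 1 (L₁ x))
      rw [(hF' x).1, zero_add]
  rw [h2]
  exact ((h.comp_clm L₀).clm_comp (ι 0)).add ((h.comp_clm L₁).clm_comp (ι 1))

end CompactResolvent

/-! ### Resolvent estimates -/

section Estimates
variable {K : Type*} [NormedAddCommGroup K] [InnerProductSpace ℂ K] [CompleteSpace K]

theorem norm_sq_le_of_mem_graph {E : K →ₗ.[ℂ] K} (hE : IsSelfAdjoint E) {x y : K}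
    (h : (x, y) ∈ E.graph) : ‖x‖ ^ 2 ≤ ‖resolventSq E‖ * (‖x‖ ^ 2 + ‖y‖ ^ 2) := by
  have h1 := resolvent_eq hE (c := 1) (by norm_num) h
  have h2 := norm_sq_add_smul (inner_graph_comm hE h h) (c := 1) (by norm_num)
  set v := y + ((1 : ℝ) * Complex.I : ℂ) • x
  have h3 : ((‖x‖ ^ 2 : ℝ) : ℂ) = inner ℂ v (resolventSq E v) := by
    rw [resolventSq_eq_mul hE (c := -1) (by norm_num), neg_neg, mul_apply_eq_comp,
      ← star_resolvent hE (by norm_num), ContinuousLinearMap.star_eq_adjoint,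
      ContinuousLinearMap.adjoint_inner_right, h1, inner_self_eq_norm_sq_to_K]
    simp
  have h4 : ‖x‖ ^ 2 = ‖inner ℂ v (resolventSq E v)‖ := by
    rw [← h3, Complex.norm_real, Real.norm_of_nonneg (by positivity)]
  rw [add_comm, ← h2]
  refine h4.trans_le ((norm_inner_le_norm _ _).trans ?_)
  have := (resolventSq E).le_opNorm v
  nlinarith [norm_nonneg v]

theorem inverse_one_add_sq_eq {T : K →L[ℂ] K} (hT : IsSelfAdjoint T) :
    Ring.inverse (1 + T ^ 2) = resolventSq (ofBounded T) := by
  have hE := isSelfAdjoint_ofBounded hT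
  have h1 : (1 + T ^ 2) * resolventSq (ofBounded T) = 1 := by
    ext x
    obtain ⟨y, z, hy, hz, hx⟩ := resolventSq_spec _ hE x
    rw [mem_ofBounded_graph] at hy hz
    rw [mul_apply_eq_comp, _root_.add_apply, sq, mul_apply_eq_comp, hy, hz]
    exact hx
  have h2 : resolventSq (ofBounded T) * (1 + T ^ 2) = 1 := by
    ext x
    rw [mul_apply_eq_comp, _root_.add_apply, sq, mul_apply_eq_comp]
    exact resolventSq_eq hE (mem_ofBounded_graph.2 rfl) (mem_ofBounded_graph.2 rfl)
  exact Ring.inverse_unit ⟨1 + T ^ 2, resolventSq (ofBounded T), h1, h2⟩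

theorem norm_resolventSq_sandwich_le {U : K →L[ℂ] K} (hU : U ∈ unitary (K →L[ℂ] K))
    {E : K →ₗ.[ℂ] K} (hE : IsSelfAdjoint E) :
    ‖resolventSq (sandwich (star U) E U)‖ ≤ ‖resolventSq E‖ := by
  refine norm_resolventSq_le_of_form (isSelfAdjoint_sandwich hU hE) (norm_nonneg _) fun x y h => ?_
  have h1 := norm_sq_le_of_mem_graph hE ((mem_rotated_graph hU).1 h)
  rwa [norm_unitary_apply hU, norm_unitary_apply hU] at h1

/-- If the form of the commutator `[D, T]` is bounded by `b`, then
`‖(1 + (D ⊗ γ¹ + T ⊗ γ²)²)⁻¹‖ ≤ (1 + b) ‖(1 + T²)⁻¹‖`, since the square of `D ⊗ γ¹ + T ⊗ γ²` is at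
least `T² - b` in the sense of forms. -/
theorem norm_resolventSq_pauliSum_le {D : K →ₗ.[ℂ] K} (hD : IsSelfAdjoint D) {T : K →L[ℂ] K}
    (hT : IsSelfAdjoint T) {b : ℝ} (hb : 0 ≤ b)
    (h : ∀ x y, (x, y) ∈ D.graph → |2 * (inner ℂ y (T x)).im| ≤ b * ‖x‖ ^ 2) :
    ‖resolventSq (pauliSum D T)‖ ≤ (1 + b) * ‖Ring.inverse (1 + T ^ 2)‖ := by
  rw [inverse_one_add_sq_eq hT]
  set c := ‖resolventSq (ofBounded T)‖ with hc
  have hc0 : 0 ≤ c := norm_nonneg _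
  refine norm_resolventSq_le_of_form (isSelfAdjoint_pauliSum hD hT) (by positivity)
    fun x y hxy => ?_
  rw [mem_pauliSum_graph] at hxy
  have h0 : ‖T (x 1)‖ ^ 2 ≤ ‖y 0‖ ^ 2 + b * ‖x 1‖ ^ 2 := by
    have h1 := (abs_le.1 (h _ _ hxy.1)).1
    set d := y 0 + Complex.I • T (x 1)
    have h2 : y 0 = d - Complex.I • T (x 1) := (add_sub_cancel_right _ _).symm
    have h3 : ‖y 0‖ ^ 2 = ‖d‖ ^ 2 + 2 * (inner ℂ d (T (x 1))).im + ‖T (x 1)‖ ^ 2 := by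
      rw [h2, norm_sub_sq (𝕜 := ℂ), inner_smul_right, norm_smul, Complex.norm_I, one_mul]
      simp
    nlinarith [sq_nonneg ‖d‖]
  have h1 : ‖T (x 0)‖ ^ 2 ≤ ‖y 1‖ ^ 2 + b * ‖x 0‖ ^ 2 := by
    have h1 := (abs_le.1 (h _ _ hxy.2)).2
    set d := y 1 - Complex.I • T (x 0)
    have h2 : y 1 = d + Complex.I • T (x 0) := (sub_add_cancel _ _).symm
    have h3 : ‖y 1‖ ^ 2 = ‖d‖ ^ 2 - 2 * (inner ℂ d (T (x 0))).im + ‖T (x 0)‖ ^ 2 := by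
      rw [h2, norm_add_sq (𝕜 := ℂ), inner_smul_right, norm_smul, Complex.norm_I, one_mul]
      simp
      ring
    nlinarith [sq_nonneg ‖d‖]
  have h2 := fun i => norm_sq_le_of_mem_graph (isSelfAdjoint_ofBounded hT)
    (mem_ofBounded_graph.2 (rfl : T (x i) = T (x i)))
  have h3 := h2 0
  have h4 := h2 1
  rw [← hc] at h3 h4
  rw [norm_sq_twofold, norm_sq_twofold]
  have h5 := mul_le_mul_of_nonneg_left h0 hc0
  have h6 := mul_le_mul_of_nonneg_left h1 hc0
  have h7 : 0 ≤ c * b * ‖y 0‖ ^ 2 := by positivity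
  have h8 : 0 ≤ c * b * ‖y 1‖ ^ 2 := by positivity
  linarith

/-- The weak form of a bounded commutator, on one side on the whole domain. -/
theorem HasBoundedCommutator.exists_inner_eq {S T : K →ₗ.[ℂ] K} (hS : IsSelfAdjoint S)
    (hT : IsSelfAdjoint T) (h : HasBoundedCommutator S T) :
    ∃ B : K →L[ℂ] K, ∀ ζ s τ σ ξ u, (ζ, s) ∈ S.graph → (ζ, τ) ∈ T.graph → (s, σ) ∈ T.graph →
      (ξ, u) ∈ S.graph → inner ℂ σ ξ - inner ℂ τ u = inner ℂ ζ (B ξ) := by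
  obtain ⟨B, C, hC, hB⟩ := h
  refine ⟨B, fun ζ s τ σ ξ u h1 h2 h3 h4 => ?_⟩
  have hcl : IsClosed {q : K × K | inner ℂ σ q.1 - inner ℂ τ q.2 = inner ℂ ζ (B q.1)} :=
    isClosed_eq (by fun_prop) (by fun_prop)
  refine closure_minimal ?_ hcl (mem_closure_of_hasCore hS hC h4)
  rintro ⟨x, y⟩ ⟨hxy, hx⟩
  obtain ⟨u', v, w, w', hu, hv, hw, hw', hB'⟩ := hB x hx
  obtain rfl := graph_unique hxy hu
  change inner ℂ σ x - inner ℂ τ y = inner ℂ ζ (B x)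
  rw [inner_graph_comm hT hv h3, inner_graph_comm hS hw h1, inner_graph_comm hT hw' h2,
    ← inner_sub_right, hB']

end Estimates

/-! ### Localisation of the commutator condition -/

section Localisation

/-- A continuous function is at most `c` if its averages over relatively compact sets are. -/
theorem le_of_forall_setIntegral_le {X : Type*} [TopologicalSpace X] [LocallyCompactSpace X]
    [T2Space X] [MeasurableSpace X] [BorelSpace X] {μ : Measure X} [IsFiniteMeasureOnCompacts μ]
    [μ.IsOpenPosMeasure] {ψ : X → ℝ} (hψ : Continuous ψ) {c : ℝ}
    (h : ∀ S C, MeasurableSet S → IsCompact C → S ⊆ C → ∫ t in S, ψ t ∂μ ≤ c * μ.real S) (t : X) :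
    ψ t ≤ c := by
  by_contra! hlt
  obtain ⟨d, hcd, hdt⟩ := exists_between hlt
  obtain ⟨C, hC, hCt⟩ := exists_compact_mem_nhds t
  set S := interior C ∩ {s | d < ψ s} with hS
  have hSo : IsOpen S := isOpen_interior.inter (isOpen_lt continuous_const hψ)
  have hSC : S ⊆ C := fun s hs => interior_subset hs.1
  have hfin : μ S ≠ ∞ := ((measure_mono hSC).trans_lt hC.measure_lt_top).ne
  have hpos : 0 < μ.real S :=
    ENNReal.toReal_pos (hSo.measure_pos μ ⟨t, mem_interior_iff_mem_nhds.2 hCt, hdt⟩).ne' hfin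
  have h1 := h S C hSo.measurableSet hC hSC
  have hi : IntegrableOn ψ S μ := (hψ.continuousOn.integrableOn_compact hC).mono_set hSC
  have h2 := setIntegral_ge_of_const_le (c := d) hSo.measurableSet hfin (fun s hs => hs.2.le) hi
  rw [smul_eq_mul] at h2
  nlinarith

variable {G 𝔸 : Type*} [Group G] [TopologicalSpace G] [NonUnitalCStarAlgebra 𝔸]
  [IsTopologicalGroup G] [LocallyCompactSpace G] [T2Space G] [SecondCountableTopology G]
  [MeasurableSpace G] [BorelSpace G] (μ : Measure G) [μ.IsHaarMeasure]
  {K : Type*} [NormedAddCommGroup K] [InnerProductSpace ℂ K] [CompleteSpace K]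
  [TopologicalSpace.SeparableSpace K]
  {𝓢 : CStarDynamics G 𝔸} (R : CovariantRep 𝓢 K)

theorem memLp_localised {S C : Set G} (hS : MeasurableSet S) (hC : IsCompact C) (hSC : S ⊆ C)
    {v : G → K} (hv : Continuous v) :
    MemLp (S.indicator fun t => star (R.U t : K →L[ℂ] K) (v t)) 2 μ := by
  obtain ⟨c, hc⟩ := hC.exists_bound_of_continuousOn hv.continuousOn
  have hfin : μ S < ∞ := (measure_mono hSC).trans_lt hC.measure_lt_top
  have _ : IsFiniteMeasure (μ.restrict S) := ⟨by simpa using hfin⟩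
  rw [memLp_indicator_iff_restrict hS]
  refine MemLp.of_bound ?_ c ?_
  · exact (aestronglyMeasurable_field R.isBoundedField_star_U.continuous_apply
      hv.aestronglyMeasurable)
  · filter_upwards [ae_restrict_mem hS] with t ht
    rw [R.star_U, norm_unitary_apply (R.U t⁻¹).2]
    exact hc t (hSC ht)

/-- If the commutator of `D̂` with a rotated field `T̂` of bounded operators is bounded by `b`, then
so is the form of each `[D, T_t]`. This is tested on the vectors `1_S(t) U_t^* x`. -/
theorem HasBoundedCommutator.exists_fiber_bound {D : K →ₗ.[ℂ] K} (hD : IsSelfAdjoint D)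
    {T : G → K →L[ℂ] K} (hT : ∀ t, IsSelfAdjoint (T t)) (hTc : ∀ x, Continuous fun t => T t x)
    (h : HasBoundedCommutator (R.rotated μ fun _ => D) (R.rotated μ fun t => ofBounded (T t))) :
    ∃ b, 0 ≤ b ∧ ∀ t x y, (x, y) ∈ D.graph → |2 * (inner ℂ y (T t x)).im| ≤ b * ‖x‖ ^ 2 := by
  obtain ⟨B, hB⟩ := h.exists_inner_eq
    (isSelfAdjoint_rotated μ R (E := fun _ => D)
      (fun r u v huv => ⟨fun _ => v, fun _ => huv, tendsto_const_nhds⟩) fun _ => hD)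
    (isSelfAdjoint_rotated μ R (isContinuousField_ofBounded hTc)
      fun t => isSelfAdjoint_ofBounded (hT t))
  have hUU : ∀ t x, (R.U t : K →L[ℂ] K) (star (R.U t : K →L[ℂ] K) x) = x := fun t x => by
    rw [← mul_apply_eq_comp, Unitary.mul_star_self_of_mem (R.U t).2]
    rfl
  refine ⟨‖B‖, norm_nonneg _, fun t x y hxy => ?_⟩
  have hψ : Continuous fun t => 2 * (inner ℂ y (T t x)).im :=
    continuous_const.mul (Complex.continuous_im.comp (continuous_const.inner (hTc x)))
  have key : ∀ S C, MeasurableSet S → IsCompact C → S ⊆ C →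
      |∫ t in S, 2 * (inner ℂ y (T t x)).im ∂μ| ≤ ‖B‖ * ‖x‖ ^ 2 * μ.real S := by
    intro S C hS hC hSC
    have hm := fun (v : G → K) (hv : Continuous v) => memLp_localised μ R hS hC hSC hv
    -- `loc v` is the class of `t ↦ 1_S(t) U_t^* v(t)`
    let loc (v : G → K) (hv : Continuous v) : Lp K 2 μ := (hm v hv).toLp
    have hgr : ∀ {E : G → K →ₗ.[ℂ] K} {v w : G → K} (hv : Continuous v) (hw : Continuous w),
        (∀ t, (v t, w t) ∈ (E t).graph) → (loc v hv, loc w hw) ∈ (R.rotated μ E).graph := by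
      intro E v w hv hw hvw
      rw [mem_rotated_graph_iff]
      filter_upwards [(hm v hv).coeFn_toLp, (hm w hw).coeFn_toLp] with t h1 h2
      rw [h1, h2]
      by_cases ht : t ∈ S
      · rw [Set.indicator_of_mem ht, Set.indicator_of_mem ht, hUU, hUU]
        exact hvw t
      · rw [Set.indicator_of_notMem ht, Set.indicator_of_notMem ht, map_zero]
        exact (E t).graph.zero_mem
    have hin : ∀ {v w : G → K} (hv : Continuous v) (hw : Continuous w),
        inner ℂ (loc v hv) (loc w hw) = ∫ t in S, inner ℂ (v t) (w t) ∂μ := by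
      intro v w hv hw
      rw [L2.inner_def, ← integral_indicator hS]
      refine integral_congr_ae ?_
      filter_upwards [(hm v hv).coeFn_toLp, (hm w hw).coeFn_toLp] with t h1 h2
      rw [h1, h2]
      by_cases ht : t ∈ S
      · rw [Set.indicator_of_mem ht, Set.indicator_of_mem ht, Set.indicator_of_mem ht, R.star_U,
          inner_unitary_apply (R.U t⁻¹).2]
      · rw [Set.indicator_of_notMem ht, Set.indicator_of_notMem ht, Set.indicator_of_notMem ht,
          inner_zero_left]
    have hx : Continuous fun _ : G => x := continuous_const
    have hy : Continuous fun _ : G => y := continuous_const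
    have h1 := hB _ _ _ _ _ _ (hgr hx hy fun _ => hxy)
      (hgr hx (hTc x) fun t => mem_ofBounded_graph.2 rfl)
      (hgr hy (hTc y) fun t => mem_ofBounded_graph.2 rfl) (hgr hx hy fun _ => hxy)
    have hint : ∀ {φ : G → ℂ}, Continuous φ → IntegrableOn φ S μ := fun hφ =>
      (hφ.continuousOn.integrableOn_compact hC).mono_set hSC
    rw [hin (hTc y) hx, hin (hTc x) hy,
      ← integral_sub (hint ((hTc y).inner hx)) (hint ((hTc x).inner hy))] at h1
    have h2 : ∀ t, inner ℂ (T t y) x - inner ℂ (T t x) y =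
        ((2 * (inner ℂ y (T t x)).im : ℝ) : ℂ) * Complex.I := by
      intro t
      have h3 : inner ℂ (T t y) x = inner ℂ y (T t x) := by
        rw [← ContinuousLinearMap.adjoint_inner_right, ← ContinuousLinearMap.star_eq_adjoint,
          (hT t).star_eq]
      rw [h3, ← inner_conj_symm (T t x) y, Complex.sub_conj]
    simp only [h2] at h1
    rw [integral_mul_const, integral_complex_ofReal] at h1
    have h3 := congrArg norm h1
    rw [norm_mul, Complex.norm_I, mul_one, Complex.norm_real, Real.norm_eq_abs] at h3
    rw [h3]
    have h4 : ‖loc (fun _ => x) hx‖ ^ 2 = μ.real S * ‖x‖ ^ 2 := by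
      have h5 := hin hx hx
      rw [inner_self_eq_norm_sq_to_K, setIntegral_const, inner_self_eq_norm_sq_to_K] at h5
      have h6 : ((‖loc (fun _ => x) hx‖ ^ 2 : ℝ) : ℂ) = ((μ.real S * ‖x‖ ^ 2 : ℝ) : ℂ) := by
        simpa using h5
      exact_mod_cast h6
    calc _ ≤ ‖loc (fun _ => x) hx‖ * (‖B‖ * ‖loc (fun _ => x) hx‖) :=
          (norm_inner_le_norm _ _).trans
            (mul_le_mul_of_nonneg_left (B.le_opNorm _) (norm_nonneg _))
      _ = ‖B‖ * ‖loc (fun _ => x) hx‖ ^ 2 := by ring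
      _ = _ := by rw [h4]; ring
  rw [abs_le']
  refine ⟨le_of_forall_setIntegral_le hψ (μ := μ) (fun S C hS hC hSC =>
      (le_abs_self _).trans (key S C hS hC hSC)) t,
    le_of_forall_setIntegral_le hψ.neg (μ := μ) (fun S C hS hC hSC => ?_) t⟩
  simp only [Pi.neg_apply]
  rw [integral_neg]
  exact (neg_le_abs _).trans (key S C hS hC hSC)

end Localisation

/-! ### Kernel operators -/

section Kernel
variable {G : Type*} [TopologicalSpace G] [TopologicalSpace.MetrizableSpace G]
  [SecondCountableTopology G] [MeasurableSpace G] [BorelSpace G] (μ : Measure G)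
  [IsFiniteMeasureOnCompacts μ] [MeasureTheory.IsSeparable μ]
  {K : Type*} [NormedAddCommGroup K] [InnerProductSpace ℂ K] [CompleteSpace K]
  [TopologicalSpace.SeparableSpace K] {C : G → K →L[ℂ] K}

theorem norm_toLp_sq {E : Type*} [NormedAddCommGroup E] {f : G → E} (hf : MemLp f 2 μ) :
    ‖hf.toLp f‖ₑ ^ 2 = ∫⁻ t, ‖f t‖ₑ ^ 2 ∂μ := by
  have h := eLpNorm_nnreal_pow_eq_lintegral (f := f) (μ := μ) (p := 2) (by norm_num)
  rw [Lp.enorm_toLp]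
  simpa using h

theorem memLp_kernel (hC : Continuous C) (hC' : HasCompactSupport C) (y : K) :
    MemLp (fun u => star (C u) y) 2 μ := by
  refine Continuous.memLp_of_hasCompactSupport (by fun_prop) (hC'.mono fun u hu => ?_)
  contrapose! hu
  simp [Function.notMem_support.1 hu]

theorem integrable_norm_kernel_sq (hC : Continuous C) (hC' : HasCompactSupport C) :
    Integrable (fun u => ‖C u‖ ^ 2) μ := by
  refine Continuous.integrable_of_hasCompactSupport (by fun_prop) (hC'.mono fun u hu => ?_)
  contrapose! hu
  simp [Function.notMem_support.1 hu]

theorem norm_toLp_kernel_sq (hC : Continuous C) (hC' : HasCompactSupport C) (y : K) :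
    ‖(memLp_kernel μ hC hC' y).toLp‖ ^ 2 = ∫ u, ‖star (C u) y‖ ^ 2 ∂μ := by
  have h : ((‖(memLp_kernel μ hC hC' y).toLp‖ ^ 2 : ℝ) : ℂ) =
      ((∫ u, ‖star (C u) y‖ ^ 2 ∂μ : ℝ) : ℂ) := by
    rw [← integral_complex_ofReal]
    have h1 := L2.inner_def (𝕜 := ℂ) ((memLp_kernel μ hC hC' y).toLp)
      ((memLp_kernel μ hC hC' y).toLp)
    rw [inner_self_eq_norm_sq_to_K] at h1
    push_cast
    refine h1.trans (integral_congr_ae ?_)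
    filter_upwards [(memLp_kernel μ hC hC' y).coeFn_toLp] with u hu
    rw [hu, inner_self_eq_norm_sq_to_K]
    rfl
  exact_mod_cast h

theorem norm_star_apply_sq_le (B : K →L[ℂ] K) (y : K) : ‖star B y‖ ^ 2 ≤ ‖B‖ ^ 2 * ‖y‖ ^ 2 := by
  rw [← mul_pow, ← norm_star B]
  exact pow_le_pow_left₀ (norm_nonneg _) ((star B).le_opNorm y) 2

theorem norm_toLp_kernel_le (hC : Continuous C) (hC' : HasCompactSupport C) (y : K) :
    ‖(memLp_kernel μ hC hC' y).toLp‖ ≤ √(∫ u, ‖C u‖ ^ 2 ∂μ) * ‖y‖ := by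
  refine le_of_sq_le_sq ?_ (by positivity)
  rw [norm_toLp_kernel_sq μ hC hC', mul_pow, Real.sq_sqrt (integral_nonneg fun u => by positivity),
    ← integral_mul_const]
  exact integral_mono_of_nonneg (Eventually.of_forall fun u => by positivity)
    ((integrable_norm_kernel_sq μ hC hC').mul_const _)
    (Eventually.of_forall fun u => norm_star_apply_sq_le (C u) y)

/-- The operator `y ↦ (u ↦ C(u)^* y)` from `K` to `L²(G; K)`. -/
def kernelDual (hC : Continuous C) (hC' : HasCompactSupport C) : K →L[ℂ] Lp K 2 μ :=
  LinearMap.mkContinuous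
    { toFun := fun y => (memLp_kernel μ hC hC' y).toLp
      map_add' := fun x y => by
        rw [← MemLp.toLp_add]; congr 1; ext u; simp
      map_smul' := fun c x => by
        rw [RingHom.id_apply, ← MemLp.toLp_const_smul]; congr 1; ext u; simp }
    (√(∫ u, ‖C u‖ ^ 2 ∂μ)) (norm_toLp_kernel_le μ hC hC')

/-- The operator `ζ ↦ ∫ C(u) ζ(u) dμ(u)` from `L²(G; K)` to `K`. -/
def kernelOp (hC : Continuous C) (hC' : HasCompactSupport C) : Lp K 2 μ →L[ℂ] K :=
  (kernelDual μ hC hC').adjoint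

theorem norm_kernelOp_le (hC : Continuous C) (hC' : HasCompactSupport C) :
    ‖kernelOp μ hC hC'‖ ≤ √(∫ u, ‖C u‖ ^ 2 ∂μ) := by
  rw [kernelOp, LinearIsometryEquiv.norm_map]
  exact LinearMap.mkContinuous_norm_le _ (Real.sqrt_nonneg _) _

theorem kernelOp_apply (hC : Continuous C) (hC' : HasCompactSupport C) (ζ : Lp K 2 μ) :
    kernelOp μ hC hC' ζ = ∫ u, C u (ζ u) ∂μ := by
  have hmeas : AEStronglyMeasurable (fun u => C u (ζ u)) μ :=
    aestronglyMeasurable_field (fun x => by fun_prop) (Lp.aestronglyMeasurable ζ)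
  have hint : Integrable (fun u => C u (ζ u)) μ := by
    have h1 : MemLp (fun u => ‖C u‖) 2 μ :=
      (Continuous.memLp_of_hasCompactSupport hC hC').norm
    refine (h1.integrable_mul (Lp.memLp ζ).norm).mono' hmeas (Eventually.of_forall fun u => ?_)
    exact (C u).le_opNorm _
  refine ext_inner_left ℂ fun y => ?_
  rw [kernelOp, ContinuousLinearMap.adjoint_inner_right, ← integral_inner hint, L2.inner_def]
  refine integral_congr_ae ?_
  filter_upwards [(memLp_kernel μ hC hC' y).coeFn_toLp] with u hu
  change inner ℂ ((memLp_kernel μ hC hC' y).toLp _ u) (ζ u) = _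
  rw [hu, ContinuousLinearMap.star_eq_adjoint, ContinuousLinearMap.adjoint_inner_left]

/-- A kernel operator is compact if the values of its kernel are: its adjoint maps weakly null
sequences to null sequences by dominated convergence. -/
theorem isCompactOperator_comp_kernelOp (hC : Continuous C) (hC' : HasCompactSupport C)
    {V : K →L[ℂ] K} (h : ∀ u, IsCompactOperator (V * C u)) :
    IsCompactOperator (V ∘L kernelOp μ hC hC') := by
  have _ : Fact ((2 : ℝ≥0∞) ≠ ∞) := ⟨by simp⟩
  refine isCompactOperator_of_adjoint (isCompactOperator_of_isWeaklyNull fun y hy => ?_)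
  rw [ContinuousLinearMap.adjoint_comp, kernelOp, ContinuousLinearMap.adjoint_adjoint]
  obtain ⟨c, hc⟩ := hy.bounded
  have h1 : ∀ n, ‖kernelDual μ hC hC' (V.adjoint (y n))‖ ^ 2 =
      ∫ u, ‖star (C u) (V.adjoint (y n))‖ ^ 2 ∂μ := fun n => norm_toLp_kernel_sq μ hC hC' _
  have h2 : Tendsto (fun n => ∫ u, ‖star (C u) (V.adjoint (y n))‖ ^ 2 ∂μ) atTop
      (𝓝 (∫ _, (0 : ℝ) ∂μ)) := by
    refine tendsto_integral_of_dominated_convergence (fun u => ‖C u‖ ^ 2 * (‖V.adjoint‖ * c) ^ 2)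
      (fun n => Continuous.aestronglyMeasurable (by fun_prop))
      ((integrable_norm_kernel_sq μ hC hC').mul_const _) (fun n => Eventually.of_forall fun u => ?_)
      (Eventually.of_forall fun u => ?_)
    · rw [Real.norm_of_nonneg (by positivity)]
      refine (norm_star_apply_sq_le _ _).trans ?_
      gcongr
      exact (V.adjoint.le_opNorm _).trans (mul_le_mul_of_nonneg_left (hc n) (norm_nonneg _))
    · have h3 := tendsto_of_isWeaklyNull (isCompactOperator_adjoint (T := V * C u) (h u)) hy
      have h4 : ∀ n, (V * C u).adjoint (y n) = star (C u) (V.adjoint (y n)) := fun n => by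
        rw [← ContinuousLinearMap.star_eq_adjoint, star_mul]
        rfl
      simp only [h4] at h3
      simpa using h3.norm.pow 2
  rw [integral_zero] at h2
  simp only [← h1] at h2
  rw [tendsto_zero_iff_norm_tendsto_zero]
  have h5 := h2.sqrt
  simpa using h5

/-- Operators `W_t : L²(G; K) → K` which are compact and square integrable in `t` define a compact
operator `ξ ↦ (t ↦ W_t ξ)` on `L²(G; K)`: along a weakly null sequence `W_t ξ_n → 0` for each `t`,
and the convergence is dominated. -/
theorem exists_compact_of_fibers {W : G → Lp K 2 μ →L[ℂ] K}
    (hmeas : ∀ ξ, AEStronglyMeasurable (fun t => W t ξ) μ) (hcomp : ∀ t, IsCompactOperator (W t))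
    {k : G → ℝ≥0∞} (hk : ∫⁻ t, k t ∂μ ≠ ∞) (hW : ∀ t ξ, ‖W t ξ‖ₑ ^ 2 ≤ k t * ‖ξ‖ₑ ^ 2) :
    ∃ Z : Lp K 2 μ →L[ℂ] Lp K 2 μ, IsCompactOperator Z ∧ ∀ ξ, Z ξ =ᵐ[μ] fun t => W t ξ := by
  have _ : Fact ((2 : ℝ≥0∞) ≠ ∞) := ⟨by simp⟩
  have hle : ∀ ξ, ∫⁻ t, ‖W t ξ‖ₑ ^ 2 ∂μ ≤ (∫⁻ t, k t ∂μ) * ‖ξ‖ₑ ^ 2 := fun ξ => by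
    rw [← lintegral_mul_const' _ _ (by simp)]
    exact lintegral_mono fun t => hW t ξ
  have hmem : ∀ ξ, MemLp (fun t => W t ξ) 2 μ := fun ξ => by
    refine ⟨hmeas ξ, ?_⟩
    rw [eLpNorm_lt_top_iff_lintegral_rpow_enorm_lt_top (by simp) (by simp)]
    have h1 : ∫⁻ t, ‖W t ξ‖ₑ ^ 2 ∂μ < ∞ :=
      (hle ξ).trans_lt (ENNReal.mul_lt_top hk.lt_top (by simp))
    simpa using h1
  have hn : ∀ ξ, ‖(hmem ξ).toLp‖ ≤ √(∫⁻ t, k t ∂μ).toReal * ‖ξ‖ := fun ξ => by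
    refine le_of_sq_le_sq ?_ (by positivity)
    have h1 := hle ξ
    rw [← norm_toLp_sq μ (hmem ξ)] at h1
    have h2 := ENNReal.toReal_mono (ENNReal.mul_ne_top hk (by simp)) h1
    rw [mul_pow, Real.sq_sqrt ENNReal.toReal_nonneg]
    simpa using h2
  refine ⟨LinearMap.mkContinuous
    { toFun := fun ξ => (hmem ξ).toLp
      map_add' := fun ξ ζ => by
        rw [← MemLp.toLp_add]; congr 1; ext t; simp
      map_smul' := fun c ξ => by
        rw [RingHom.id_apply, ← MemLp.toLp_const_smul]; congr 1; ext t; simp }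
    (√(∫⁻ t, k t ∂μ).toReal) hn, ?_, fun ξ => (hmem ξ).coeFn_toLp⟩
  refine isCompactOperator_of_isWeaklyNull fun ξ hξ => ?_
  obtain ⟨c, hc⟩ := hξ.bounded
  change Tendsto (fun n => (hmem (ξ n)).toLp) atTop (𝓝 0)
  have h1 : Tendsto (fun n => ∫⁻ t, ‖W t (ξ n)‖ₑ ^ 2 ∂μ) atTop (𝓝 (∫⁻ _, 0 ∂μ)) := by
    refine tendsto_lintegral_of_dominated_convergence' (fun t => k t * ENNReal.ofReal c ^ 2)
      (fun n => (hmeas _).enorm.pow_const 2) (fun n => Eventually.of_forall fun t => ?_) ?_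
      (Eventually.of_forall fun t => ?_)
    · refine (hW t _).trans ?_
      have h2 : ‖ξ n‖ₑ ≤ ENNReal.ofReal c := by
        rw [← ofReal_norm]
        exact ENNReal.ofReal_le_ofReal (hc n)
      exact mul_le_mul' le_rfl (pow_le_pow_left' h2 2)
    · rw [lintegral_mul_const' _ _ (by simp)]
      exact ENNReal.mul_ne_top hk (by simp)
    · have h2 := tendsto_of_isWeaklyNull (hcomp t) hξ
      have h3 := (ENNReal.continuous_pow 2).tendsto _ |>.comp ((continuous_enorm.tendsto 0).comp h2)
      simpa [Function.comp_def] using h3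
  rw [lintegral_zero] at h1
  simp only [← norm_toLp_sq μ (hmem _)] at h1
  have h4 := (ENNReal.tendsto_toReal (a := 0) (by simp)).comp h1
  rw [tendsto_zero_iff_norm_tendsto_zero]
  have h5 := h4.sqrt
  simpa [Function.comp_def] using h5

end Kernel

/-! ### The regular representation as a field of kernel operators -/

section RegularKernel
variable {G 𝔸 : Type*} [Group G] [TopologicalSpace G] [NonUnitalCStarAlgebra 𝔸]
  [IsTopologicalGroup G] [LocallyCompactSpace G] [T2Space G] [SecondCountableTopology G]
  [MeasurableSpace G] [BorelSpace G] (μ : Measure G) [μ.IsHaarMeasure]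
  {K : Type*} [NormedAddCommGroup K] [InnerProductSpace ℂ K] [CompleteSpace K]
  [TopologicalSpace.SeparableSpace K]
  {𝓢 : CStarDynamics G 𝔸} (R : CovariantRep 𝓢 K)

/-- The kernel `u ↦ Δ(u)⁻¹ ρ(α_{t⁻¹}(f(t u⁻¹)))` of `ξ ↦ (ρ̂(f) ξ)(t)`. -/
def regularKernel (f : C_c(G, 𝔸)) (t u : G) : K →L[ℂ] K :=
  (((modularFun u)⁻¹ : ℝ) : ℂ) • R.ρ (𝓢.act t⁻¹ (f (t * u⁻¹)))

theorem continuous_regularKernel (f : C_c(G, 𝔸)) (t : G) : Continuous (regularKernel R f t) := by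
  refine Continuous.smul (Complex.continuous_ofReal.comp
      (continuous_modularFun.inv₀ fun r => (modularFun_pos r).ne')) ?_
  exact (map_continuous R.ρ).comp (𝓢.continuous_act_apply continuous_const
    (f.continuous.comp (by fun_prop)))

theorem hasCompactSupport_regularKernel (f : C_c(G, 𝔸)) (t : G) :
    HasCompactSupport (regularKernel R f t) := by
  refine HasCompactSupport.intro (K := (fun s => s⁻¹ * t) '' tsupport f)
    (f.hasCompactSupport.isCompact.image (by fun_prop)) fun u hu => ?_
  have h : f (t * u⁻¹) = 0 := image_eq_zero_of_notMem_tsupport fun h => hu ⟨_, h, by simp⟩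
  simp [regularKernel, h]

theorem regularRep_ae_eq_kernelOp (f : C_c(G, 𝔸)) (ξ : Lp K 2 μ) :
    regularRep μ R f ξ =ᵐ[μ] fun t => kernelOp μ (continuous_regularKernel R f t)
      (hasCompactSupport_regularKernel R f t) ξ := by
  filter_upwards [regularRep_ae_eq μ R f ξ] with t ht
  rw [ht, kernelOp_apply, ← integral_mul_left_eq_self _ t]
  have h := integral_comp_inv μ fun u => R.ρ (𝓢.act t⁻¹ (f (t * u⁻¹))) (ξ u)
  simp only [inv_inv] at h
  simp only [mul_inv_rev, inv_mul_cancel_right]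
  rw [h]
  refine integral_congr_ae (Eventually.of_forall fun u => ?_)
  simp only [regularKernel, _root_.smul_apply, Complex.coe_smul]

theorem integral_norm_regularKernel_le (f : C_c(G, 𝔸)) (t : G) :
    ∫ u, ‖regularKernel R f t u‖ ^ 2 ∂μ ≤
      (modularFun t)⁻¹ * ∫ s, modularFun s * ‖f s‖ ^ 2 ∂μ := by
  have h1 : ∀ u, ‖regularKernel R f t u‖ ^ 2 ≤ (modularFun u)⁻¹ ^ 2 * ‖f (t * u⁻¹)‖ ^ 2 := by
    intro u
    rw [regularKernel, norm_smul, mul_pow, Complex.norm_real, Real.norm_of_nonneg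
      (inv_nonneg.2 (modularFun_pos u).le)]
    gcongr
    exact R.norm_rep_le _ _
  have hc : HasCompactSupport fun u => (modularFun u)⁻¹ ^ 2 * ‖f (t * u⁻¹)‖ ^ 2 := by
    refine HasCompactSupport.intro (K := (fun s => s⁻¹ * t) '' tsupport f)
      (f.hasCompactSupport.isCompact.image (by fun_prop)) fun u hu => ?_
    have h : f (t * u⁻¹) = 0 := image_eq_zero_of_notMem_tsupport fun h => hu ⟨_, h, by simp⟩
    simp [h]
  have hcont : Continuous fun u => (modularFun u)⁻¹ ^ 2 * ‖f (t * u⁻¹)‖ ^ 2 :=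
    ((continuous_modularFun.inv₀ fun r => (modularFun_pos r).ne').pow 2).mul
      ((f.continuous.comp (by fun_prop)).norm.pow 2)
  refine (integral_mono_of_nonneg (Eventually.of_forall fun u => by positivity)
    (hcont.integrable_of_hasCompactSupport hc) (Eventually.of_forall h1)).trans_eq ?_
  -- substitute `u⁻¹` for `u`, then `t⁻¹ s` for `u`
  have h2 := integral_comp_inv μ fun u => modularFun u ^ 2 * ‖f (t * u)‖ ^ 2
  simp only [modularFun_inv] at h2
  rw [h2, ← integral_mul_left_eq_self _ t⁻¹, ← integral_const_mul]
  refine integral_congr_ae (Eventually.of_forall fun s => ?_)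
  have h3 := (modularFun_pos s).ne'
  have h4 := (modularFun_pos t).ne'
  simp only [mul_inv_cancel_left, modularFun_mul, modularFun_inv, smul_eq_mul]
  field_simp

end RegularKernel

/-! ### Compactness of `Θ π(f) (1 + 𝒟²)^{-s}` -/

section Resolvent
variable {K : Type*} [NormedAddCommGroup K] [InnerProductSpace ℂ K] [CompleteSpace K]

theorem isSelfAdjoint_bracketPow (E : K →ₗ.[ℂ] K) (s : ℝ) : IsSelfAdjoint (bracketPow E s) :=
  IsSelfAdjoint.of_nonneg (CFC.rpow_nonneg (a := resolventSq E) (y := s))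

theorem norm_ampOp_le (T : K →L[ℂ] K) : ‖ampOp T‖ ≤ ‖T‖ := by
  refine ContinuousLinearMap.opNorm_le_bound _ (norm_nonneg _) fun x => ?_
  refine le_of_sq_le_sq ?_ (by positivity)
  rw [mul_pow, norm_sq_twofold, norm_sq_twofold, ampOp_apply, ampOp_apply]
  have h1 := pow_le_pow_left₀ (norm_nonneg _) (T.le_opNorm (x 0)) 2
  have h2 := pow_le_pow_left₀ (norm_nonneg _) (T.le_opNorm (x 1)) 2
  rw [mul_pow] at h1 h2
  linarith

theorem norm_unitary_conj_le {U : K →L[ℂ] K} (hU : U ∈ unitary (K →L[ℂ] K)) (T : K →L[ℂ] K) :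
    ‖star U * T * U‖ ≤ ‖T‖ := by
  refine ContinuousLinearMap.opNorm_le_bound _ (norm_nonneg _) fun x => ?_
  rw [mul_apply_eq_comp, mul_apply_eq_comp, norm_unitary_apply (Unitary.star_mem hU),
    ← norm_unitary_apply hU x]
  exact T.le_opNorm _

variable {G 𝔸 : Type*} [Group G] [TopologicalSpace G] [NonUnitalCStarAlgebra 𝔸]
  [IsTopologicalGroup G] [LocallyCompactSpace G] [T2Space G] [SecondCountableTopology G]
  [MeasurableSpace G] [BorelSpace G] (μ : Measure G) [μ.IsHaarMeasure]
  [TopologicalSpace.SeparableSpace K]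
  {𝓢 : CStarDynamics G 𝔸} (R : CovariantRep 𝓢 K) {A : NonUnitalStarSubalgebra ℂ 𝔸}
  {p : G → 𝓜(ℂ, 𝔸)ˣ}

/-- The fiber `V_t^* (D ⊗ γ¹ + T_p(t) ⊗ γ²) V_t` of the Dirac operator. -/
def diracFiber (D : K →ₗ.[ℂ] K) (p : G → 𝓜(ℂ, 𝔸)ˣ) (η ω : ℝ) (t : G) :
    Twofold K →ₗ.[ℂ] Twofold K :=
  sandwich (star (R.amp.U t : Twofold K →L[ℂ] Twofold K)) (pauliSum D (fiberT R p η ω t))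
    (R.amp.U t : Twofold K →L[ℂ] Twofold K)

/-- The fiber `V_t^* (ρ(p(t)) ⊗ 1) V_t` of the modular operator. -/
def modularFiber (p : G → 𝓜(ℂ, 𝔸)ˣ) (t : G) : Twofold K →L[ℂ] Twofold K :=
  star (R.amp.U t : Twofold K →L[ℂ] Twofold K) * ampOp (multiplierRep R.ρ (p t)) *
    (R.amp.U t : Twofold K →L[ℂ] Twofold K)

theorem isSelfAdjoint_diracFiber (hP : ∀ r, IsSelfAdjoint (multiplierRep R.ρ (p r)))
    {D : K →ₗ.[ℂ] K} (hD : IsSelfAdjoint D) (η ω : ℝ) (t : G) :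
    IsSelfAdjoint (diracFiber R D p η ω t) :=
  isSelfAdjoint_sandwich (R.amp.U t).2
    (isSelfAdjoint_pauliSum hD (isSelfAdjoint_fiberT R hP η ω t))

theorem modularFiber_mul_rep (hR : IsNondegenerate R.ρ) (t : G) (a : 𝔸) :
    modularFiber R p t * R.amp.ρ (𝓢.act t⁻¹ a) =
      R.amp.ρ (𝓢.act t⁻¹ ((p t : 𝓜(ℂ, 𝔸)).fst a)) := by
  have h : ampOp (multiplierRep R.ρ (p t)) * R.amp.ρ a = R.amp.ρ ((p t : 𝓜(ℂ, 𝔸)).fst a) := by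
    ext x i
    rw [mul_apply_eq_comp, ampOp_apply, R.amp_ρ_apply, R.amp_ρ_apply,
      ← multiplierRep_mul_rep hR]
    rfl
  rw [R.amp.act_inv_apply, R.amp.act_inv_apply, modularFiber, ← h]
  simp only [mul_assoc]
  rw [← mul_assoc _ (star _) (R.amp.ρ a * _), Unitary.mul_star_self_of_mem (R.amp.U t).2, one_mul]

theorem modularFiber_apply_eq {ξ ζ : Lp (Twofold K) 2 μ} (h : (ξ, ζ) ∈ (modularOp R μ p).graph) :
    ζ =ᵐ[μ] fun t => modularFiber R p t (ξ t) := by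
  filter_upwards [(mem_modularOp_graph μ R ξ ζ).1 h] with t ht
  have h1 : ampOp (multiplierRep R.ρ (p t)) ((R.amp.U t : Twofold K →L[ℂ] Twofold K) (ξ t)) =
      (R.amp.U t : Twofold K →L[ℂ] Twofold K) (ζ t) := by
    ext i
    exact ht i
  rw [modularFiber, mul_apply_eq_comp, mul_apply_eq_comp, h1, ← mul_apply_eq_comp,
    Unitary.star_mul_self_of_mem (R.amp.U t).2]
  rfl

/-- Compactness of `ρ(a) (D + i)⁻¹` passes to `(1 + 𝒟_t²)^{-s} ρ(α_{t⁻¹}(a))`. -/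
theorem isCompactOperator_bracketPow_diracFiber_mul
    (hP : ∀ r, IsSelfAdjoint (multiplierRep R.ρ (p r))) {D : K →ₗ.[ℂ] K}
    (hD : IsSpectralTriple A R.ρ D) (η ω : ℝ) {s : ℝ} (hs : 0 < s) (t : G) {a : 𝔸} (ha : a ∈ A) :
    IsCompactOperator (bracketPow (diracFiber R D p η ω t) s * R.amp.ρ (𝓢.act t⁻¹ a)) := by
  have hE := isSelfAdjoint_diracFiber R hP hD.selfAdjoint η ω t
  have hpauli := isSelfAdjoint_pauliSum hD.selfAdjoint (isSelfAdjoint_fiberT R hP η ω t)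
  refine isCompactOperator_of_adjoint ?_
  have h1 : (bracketPow (diracFiber R D p η ω t) s * R.amp.ρ (𝓢.act t⁻¹ a)).adjoint =
      R.amp.ρ (𝓢.act t⁻¹ (star a)) * bracketPow (diracFiber R D p η ω t) s := by
    rw [← ContinuousLinearMap.star_eq_adjoint, star_mul,
      (isSelfAdjoint_bracketPow (diracFiber R D p η ω t) s).star_eq, ← map_star, ← map_star]
  rw [h1]
  refine isCompactOperator_mul_bracketPow hE ?_ hs
  have h2 := isCompactOperator_amp_mul_resolvent hD.selfAdjoint (isSelfAdjoint_fiberT R hP η ω t)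
    (isCompactOperator_mul_resolvent hD.selfAdjoint (hD.compact_resolvent (star a) (star_mem ha)))
  have h3 : R.amp.ρ (𝓢.act t⁻¹ (star a)) * resolvent (diracFiber R D p η ω t) 1 =
      star (R.amp.U t : Twofold K →L[ℂ] Twofold K) ∘L
        (ampOp (R.ρ (star a)) * resolvent (pauliSum D (fiberT R p η ω t)) 1) ∘L
          (R.amp.U t : Twofold K →L[ℂ] Twofold K) := by
    ext1 x
    have h4 := resolvent_sandwich (R.amp.U t).2 hpauli (c := 1) (by norm_num) x
    rw [mul_apply_eq_comp, diracFiber, h4, R.amp.act_inv_apply, ← mul_apply_eq_comp, mul_assoc,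
      Unitary.mul_star_self_of_mem (R.amp.U t).2, mul_one]
    rfl
  rw [h3]
  exact (h2.comp_clm (R.amp.U t : Twofold K →L[ℂ] Twofold K)).clm_comp
    (star (R.amp.U t : Twofold K →L[ℂ] Twofold K))

/-- The fiber at `t` of `(1 + 𝒟²)^{-s} Θ π(g)`, as an operator from `L²(G; K ⊗ ℂ²)` to
`K ⊗ ℂ²`. -/
def modularResolventFiber (D : K →ₗ.[ℂ] K) (p : G → 𝓜(ℂ, 𝔸)ˣ) (η ω s : ℝ)
    (g : C_c(G, 𝔸)) (t : G) : Lp (Twofold K) 2 μ →L[ℂ] Twofold K :=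
  (bracketPow (diracFiber R D p η ω t) s * modularFiber R p t) ∘L
    kernelOp μ (continuous_regularKernel R.amp g t) (hasCompactSupport_regularKernel R.amp g t)

theorem modularResolventFiber_ae_eq (D : K →ₗ.[ℂ] K) (η ω s : ℝ) (g : C_c(G, 𝔸))
    (ξ : Lp (Twofold K) 2 μ) :
    (fun t => bracketPow (diracFiber R D p η ω t) s
      (modularFiber R p t (regularRep μ R.amp g ξ t))) =ᵐ[μ]
        fun t => modularResolventFiber μ R D p η ω s g t ξ := by
  filter_upwards [regularRep_ae_eq_kernelOp μ R.amp g ξ] with t ht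
  rw [ht]
  rfl

theorem isCompactOperator_modularResolventFiber (hR : IsNondegenerate R.ρ)
    (hp : IsCentralCocycle 𝓢 A p) (hP : ∀ r, IsSelfAdjoint (multiplierRep R.ρ (p r)))
    {D : K →ₗ.[ℂ] K} (hD : IsSpectralTriple A R.ρ D) (η ω : ℝ) {s : ℝ} (hs : 0 < s)
    {g : C_c(G, 𝔸)} (hgA : ∀ r, g r ∈ A) (t : G) :
    IsCompactOperator (modularResolventFiber μ R D p η ω s g t) := by
  refine isCompactOperator_comp_kernelOp μ (continuous_regularKernel R.amp g t)
    (hasCompactSupport_regularKernel R.amp g t) fun u => ?_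
  have h1 : bracketPow (diracFiber R D p η ω t) s * modularFiber R p t *
      regularKernel R.amp g t u = (((modularFun u)⁻¹ : ℝ) : ℂ) •
        (bracketPow (diracFiber R D p η ω t) s *
          R.amp.ρ (𝓢.act t⁻¹ ((p t : 𝓜(ℂ, 𝔸)).fst (g (t * u⁻¹))))) := by
    rw [regularKernel, mul_smul_comm, mul_assoc, modularFiber_mul_rep R hR]
  rw [h1]
  have h2 := isCompactOperator_bracketPow_diracFiber_mul R hP hD η ω hs t
    (hp.mul_mem t _ (hgA (t * u⁻¹)))
  exact h2.smul (((modularFun u)⁻¹ : ℝ) : ℂ)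

/-- The norm bound that turns the convergence condition into an `L²` bound for the fibers. -/
theorem norm_modularResolventFiber_le {D : K →ₗ.[ℂ] K} {η ω s C q : ℝ} {t : G}
    (hQ : ‖bracketPow (diracFiber R D p η ω t) s‖ ≤ C * q) (g : C_c(G, 𝔸))
    (ξ : Lp (Twofold K) 2 μ) :
    ‖modularResolventFiber μ R D p η ω s g t ξ‖ ^ 2 ≤
      (modularFun t)⁻¹ * ‖multiplierRep R.ρ (p t)‖ ^ 2 * q ^ 2 *
        (C ^ 2 * ∫ r, modularFun r * ‖g r‖ ^ 2 ∂μ) * ‖ξ‖ ^ 2 := by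
  have h1 : ‖modularFiber R p t‖ ≤ ‖multiplierRep R.ρ (p t)‖ :=
    (norm_unitary_conj_le (R.amp.U t).2 _).trans (norm_ampOp_le _)
  have h2 : ‖kernelOp μ (continuous_regularKernel R.amp g t)
      (hasCompactSupport_regularKernel R.amp g t)‖ ^ 2 ≤
      (modularFun t)⁻¹ * ∫ r, modularFun r * ‖g r‖ ^ 2 ∂μ := by
    have h := norm_kernelOp_le μ (continuous_regularKernel R.amp g t)
      (hasCompactSupport_regularKernel R.amp g t)
    refine (pow_le_pow_left₀ (ContinuousLinearMap.opNorm_nonneg _) h 2).trans ?_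
    rw [Real.sq_sqrt (integral_nonneg fun u => by positivity)]
    exact integral_norm_regularKernel_le μ R.amp g t
  have hCq : 0 ≤ C * q := (norm_nonneg _).trans hQ
  have h4 : ‖modularResolventFiber μ R D p η ω s g t ξ‖ ≤
      (C * q) * ‖multiplierRep R.ρ (p t)‖ *
      ‖kernelOp μ (continuous_regularKernel R.amp g t)
        (hasCompactSupport_regularKernel R.amp g t)‖ * ‖ξ‖ := by
    refine ((modularResolventFiber μ R D p η ω s g t).le_opNorm ξ).trans
      (mul_le_mul_of_nonneg_right ?_ (norm_nonneg _))
    refine (ContinuousLinearMap.opNorm_comp_le _ _).trans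
      (mul_le_mul_of_nonneg_right ?_ (norm_nonneg _))
    exact (norm_mul_le _ _).trans (mul_le_mul hQ h1 (norm_nonneg _) hCq)
  refine (pow_le_pow_left₀ (norm_nonneg _) h4 2).trans ?_
  have h6 := mul_le_mul_of_nonneg_left h2
    (show 0 ≤ ((C * q) * ‖multiplierRep R.ρ (p t)‖) ^ 2 * ‖ξ‖ ^ 2 by positivity)
  refine (le_of_eq ?_).trans (h6.trans (le_of_eq ?_)) <;> ring

/-- The bracket power `(1 + 𝒟²)^{-s}` acts fiberwise. -/
theorem bracketPow_diracOp_fiberwise (hR : IsNondegenerate R.ρ)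
    (hp : IsCentralCocycle 𝓢 A p) (hP : ∀ r, IsSelfAdjoint (multiplierRep R.ρ (p r)))
    {D : K →ₗ.[ℂ] K} (hD : IsSelfAdjoint D) (η ω : ℝ) {s : ℝ} (hs : 0 < s) :
    ∃ hQ : IsBoundedField fun t => bracketPow (diracFiber R D p η ω t) s,
      bracketPow (diracOp R μ D p η ω) s = fieldOp μ _ hQ := by
  have hT := isSelfAdjoint_fiberT R hP η ω
  exact bracketPow_fiberwise μ (isSelfAdjoint_diracFiber R hP hD η ω)
    ((isContinuousField_pauliSum (continuous_fiberT R hR hp η ω)).continuous_resolvent_rotated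
      R.amp fun t => isSelfAdjoint_pauliSum hD (hT t)) hs

/-- Boundedness of `[D̂, 𝒯]` compares `(1 + 𝒟_t²)^{-s}` with `(1 + T_p(t)²)^{-s}`, uniformly
in `t`. -/
theorem exists_norm_bracketPow_diracFiber_le (hR : IsNondegenerate R.ρ)
    (hp : IsCentralCocycle 𝓢 A p) (hP : ∀ r, IsSelfAdjoint (multiplierRep R.ρ (p r)))
    {D : K →ₗ.[ℂ] K} (hD : IsSelfAdjoint D) (η ω : ℝ)
    (hB : HasBoundedCommutator (hatD R μ D) (hatT R μ p η ω)) {s : ℝ} (hs : 0 < s) :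
    ∃ C : ℝ, ∀ t, ‖bracketPow (diracFiber R D p η ω t) s‖ ≤
      C * ‖Ring.inverse (1 + fiberT R p η ω t ^ 2)‖ ^ s := by
  have hT := isSelfAdjoint_fiberT R hP η ω
  obtain ⟨b, hb0, hb⟩ := hB.exists_fiber_bound μ R hD hT (continuous_fiberT R hR hp η ω)
  refine ⟨(1 + b) ^ s, fun t => ?_⟩
  rw [← Real.mul_rpow (by positivity) (norm_nonneg _)]
  refine norm_rpow_le (resolventSq_nonneg (isSelfAdjoint_diracFiber R hP hD η ω t)) ?_ hs
  exact (norm_resolventSq_sandwich_le (R.amp.U t).2 (isSelfAdjoint_pauliSum hD (hT t))).trans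
    (norm_resolventSq_pauliSum_le hD (hT t) hb0 (hb t))

theorem aestronglyMeasurable_modularResolventFiber (hR : IsNondegenerate R.ρ)
    (hp : IsCentralCocycle 𝓢 A p) {D : K →ₗ.[ℂ] K} {η ω s : ℝ}
    (hQ : IsBoundedField fun t => bracketPow (diracFiber R D p η ω t) s) (g : C_c(G, 𝔸))
    (ξ : Lp (Twofold K) 2 μ) :
    AEStronglyMeasurable (fun t => modularResolventFiber μ R D p η ω s g t ξ) μ := by
  have h := aestronglyMeasurable_field hQ.continuous_apply (aestronglyMeasurable_field
    R.amp.isBoundedField_star_U.continuous_apply (aestronglyMeasurable_field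
      (continuous_ampOp (continuous_multiplierRep hR hp)) (aestronglyMeasurable_field
        R.amp.continuous_U (Lp.aestronglyMeasurable (regularRep μ R.amp g ξ)))))
  exact h.congr (modularResolventFiber_ae_eq μ R D η ω s g ξ)

theorem enorm_sq_le_ofReal_mul {E F : Type*} [NormedAddCommGroup E] [NormedAddCommGroup F]
    {x : E} {y : F} {k c : ℝ} (hk : 0 ≤ k) (hc : 0 ≤ c) (h : ‖x‖ ^ 2 ≤ k * c * ‖y‖ ^ 2) :
    ‖x‖ₑ ^ 2 ≤ ENNReal.ofReal k * ENNReal.ofReal c * ‖y‖ₑ ^ 2 := by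
  rw [← ofReal_norm, ← ofReal_norm, ← ENNReal.ofReal_pow (norm_nonneg _),
    ← ENNReal.ofReal_pow (norm_nonneg _), ← ENNReal.ofReal_mul hk,
    ← ENNReal.ofReal_mul (mul_nonneg hk hc)]
  exact ENNReal.ofReal_le_ofReal h

/-- The operator `(1 + 𝒟²)^{-s} Θ π(g)` is bounded and compact. -/
theorem exists_compact_resolvent_modular (hR : IsNondegenerate R.ρ)
    (hp : IsCentralCocycle 𝓢 A p) (hP : ∀ r, IsSelfAdjoint (multiplierRep R.ρ (p r)))
    {D : K →ₗ.[ℂ] K} (hD : IsSpectralTriple A R.ρ D) (η ω : ℝ)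
    (hB : HasBoundedCommutator (hatD R μ D) (hatT R μ p η ω)) {ε : ℝ} (hε : 0 < ε)
    (hint : ∫⁻ r, ENNReal.ofReal ((modularFun r)⁻¹ * ‖multiplierRep R.ρ (p r)‖ ^ 2 *
      ‖Ring.inverse (1 + fiberT R p η ω r ^ 2)‖ ^ (1 + ε)) ∂μ < ∞)
    {g : C_c(G, 𝔸)} (hgA : ∀ r, g r ∈ A) :
    ∃ Z : Lp (Twofold K) 2 μ →L[ℂ] Lp (Twofold K) 2 μ, IsCompactOperator Z ∧
      ∀ ξ, Z ξ =ᵐ[μ] fun t => bracketPow (diracFiber R D p η ω t) ((1 + ε) / 2)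
        (modularFiber R p t (regularRep μ R.amp g ξ t)) := by
  have hs : 0 < (1 + ε) / 2 := by positivity
  obtain ⟨hQ, -⟩ := bracketPow_diracOp_fiberwise μ R hR hp hP hD.selfAdjoint η ω hs
  obtain ⟨C, hC⟩ := exists_norm_bracketPow_diracFiber_le μ R hR hp hP hD.selfAdjoint η ω hB hs
  have hc0 : 0 ≤ C ^ 2 * ∫ r, modularFun r * ‖g r‖ ^ 2 ∂μ :=
    mul_nonneg (sq_nonneg C)
      (integral_nonneg fun r => mul_nonneg (modularFun_pos r).le (by positivity))
  have hW : ∀ t ξ, ‖modularResolventFiber μ R D p η ω ((1 + ε) / 2) g t ξ‖ₑ ^ 2 ≤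
      ENNReal.ofReal ((modularFun t)⁻¹ * ‖multiplierRep R.ρ (p t)‖ ^ 2 *
        ‖Ring.inverse (1 + fiberT R p η ω t ^ 2)‖ ^ (1 + ε)) *
          ENNReal.ofReal (C ^ 2 * ∫ r, modularFun r * ‖g r‖ ^ 2 ∂μ) * ‖ξ‖ₑ ^ 2 := fun t ξ => by
    have h5 : (‖Ring.inverse (1 + fiberT R p η ω t ^ 2)‖ ^ ((1 + ε) / 2)) ^ 2 =
        ‖Ring.inverse (1 + fiberT R p η ω t ^ 2)‖ ^ (1 + ε) := by
      rw [← Real.rpow_natCast, ← Real.rpow_mul (norm_nonneg _)]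
      congr 1
      push_cast
      ring
    rw [← h5]
    exact enorm_sq_le_ofReal_mul (mul_nonneg (mul_nonneg (inv_nonneg.2 (modularFun_pos t).le)
      (sq_nonneg _)) (sq_nonneg _)) hc0 (norm_modularResolventFiber_le μ R (hC t) g ξ)
  have hk : ∫⁻ t, ENNReal.ofReal ((modularFun t)⁻¹ * ‖multiplierRep R.ρ (p t)‖ ^ 2 *
      ‖Ring.inverse (1 + fiberT R p η ω t ^ 2)‖ ^ (1 + ε)) *
        ENNReal.ofReal (C ^ 2 * ∫ r, modularFun r * ‖g r‖ ^ 2 ∂μ) ∂μ ≠ ∞ := by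
    rw [lintegral_mul_const' _ _ ENNReal.ofReal_ne_top]
    exact ENNReal.mul_ne_top hint.ne ENNReal.ofReal_ne_top
  obtain ⟨Z, hZ, hZ'⟩ := exists_compact_of_fibers μ
    (aestronglyMeasurable_modularResolventFiber μ R hR hp hQ g)
    (isCompactOperator_modularResolventFiber μ R hR hp hP hD η ω hs hgA) hk hW
  exact ⟨Z, hZ, fun ξ => (hZ' ξ).trans (modularResolventFiber_ae_eq μ R D η ω _ g ξ).symm⟩

/-- With `β(g) = f^*`, the adjoint of the compact operator `(1 + 𝒟²)^{-s} Θ π(g)` is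
`Θ π(f) (1 + 𝒟²)^{-s}`; in particular the range of `π(f) (1 + 𝒟²)^{-s}` lies in the domain of
`Θ`. -/
theorem exists_compact_modular_resolvent (hR : IsNondegenerate R.ρ) (hA : Dense (A : Set 𝔸))
    (hp : IsCentralCocycle 𝓢 A p) (hP : ∀ r, IsSelfAdjoint (multiplierRep R.ρ (p r)))
    {D : K →ₗ.[ℂ] K} (hD : IsSpectralTriple A R.ρ D) (η ω : ℝ)
    (hB : HasBoundedCommutator (hatD R μ D) (hatT R μ p η ω)) {ε : ℝ} (hε : 0 < ε)
    (hint : ∫⁻ r, ENNReal.ofReal ((modularFun r)⁻¹ * ‖multiplierRep R.ρ (p r)‖ ^ 2 *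
      ‖Ring.inverse (1 + fiberT R p η ω r ^ 2)‖ ^ (1 + ε)) ∂μ < ∞)
    {f g : C_c(G, 𝔸)} (hg : ∀ r, involution 𝓢 f r = (p r : 𝓜(ℂ, 𝔸)).fst (g r))
    (hgA : ∀ r, g r ∈ A) :
    ∃ T : Lp (Twofold K) 2 μ →L[ℂ] Lp (Twofold K) 2 μ, IsCompactOperator T ∧
      ∀ x, (regularRep μ R.amp f (bracketPow (diracOp R μ D p η ω) ((1 + ε) / 2) x), T x) ∈
        (modularOp R μ p).graph := by
  have _ : Fact ((2 : ℝ≥0∞) ≠ ∞) := ⟨by simp⟩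
  obtain ⟨Z, hZ, hZ'⟩ := exists_compact_resolvent_modular μ R hR hp hP hD η ω hB hε hint hgA
  obtain ⟨hQ, hQ'⟩ := bracketPow_diracOp_fiberwise μ R hR hp hP hD.selfAdjoint η ω
    (s := (1 + ε) / 2) (by positivity)
  refine ⟨Z.adjoint, isCompactOperator_adjoint hZ, fun x => ?_⟩
  refine (mem_graph_iff_of_isSelfAdjoint (isSelfAdjoint_modularOp μ R hR hp hP)).2
    fun u v huv => ?_
  have h1 := modularOp_implemented μ R hR hA hp hP hg huv
  have h2 : Z u = bracketPow (diracOp R μ D p η ω) ((1 + ε) / 2)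
      (regularRep μ R.amp (involution 𝓢 f) v) := by
    refine Lp.ext ?_
    rw [hQ']
    filter_upwards [hZ' u, fieldOp_ae_eq μ hQ (regularRep μ R.amp (involution 𝓢 f) v),
      modularFiber_apply_eq μ R h1] with t h4 h6 h7
    rw [h4, h6, h7]
  rw [ContinuousLinearMap.adjoint_inner_right, h2, regularRep_involution,
    ContinuousLinearMap.star_eq_adjoint]
  have h3 := (isSelfAdjoint_bracketPow (diracOp R μ D p η ω) ((1 + ε) / 2)).star_eq
  rw [ContinuousLinearMap.star_eq_adjoint] at h3
  rw [← h3, ContinuousLinearMap.adjoint_inner_left, ContinuousLinearMap.adjoint_inner_left, h3]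

end Resolvent

end ModularTriple

end

theorem mainTheorem1
    -- the dynamical system `(𝔸, G, α)`, a Haar measure and the Hilbert space
    {𝔸 : Type*} [NonUnitalCStarAlgebra 𝔸]
    {G : Type*} [Group G] [TopologicalSpace G] [IsTopologicalGroup G] [LocallyCompactSpace G]
    [T2Space G] [SecondCountableTopology G] [MeasurableSpace G] [BorelSpace G]
    (μ : Measure G) [μ.IsHaarMeasure]
    {H : Type*} [NormedAddCommGroup H] [InnerProductSpace ℂ H] [CompleteSpace H]
    [TopologicalSpace.SeparableSpace H]
    (𝓢 : ModularTriple.CStarDynamics G 𝔸)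
    -- the faithful nondegenerate covariant representation `(ρ, U, H)`
    (R : ModularTriple.CovariantRep 𝓢 H) (hRf : Function.Injective R.ρ)
    (hRn : ModularTriple.IsNondegenerate R.ρ)
    -- the spectral triple `(A, H, D)`
    (A : NonUnitalStarSubalgebra ℂ 𝔸) (hA : Dense (A : Set 𝔸))
    (hAα : ∀ r, ∀ a ∈ A, 𝓢.act r a ∈ A)
    (D : H →ₗ.[ℂ] H) (hD : ModularTriple.IsSpectralTriple A R.ρ D)
    -- the algebra `𝒜 ⊆ C_c(G, A)`
    (𝒜 : Submodule ℂ C_c(G, 𝔸)) (h𝒜 : ModularTriple.IsDenseStarSubalgebra μ 𝓢 A 𝒜)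
    -- the map `z` and the cocycle `p`
    (z : G → (H →L[ℂ] H)ˣ)
    (hz : ∀ r, ModularTriple.AgreeOnCommonCore
      (ModularTriple.sandwich (R.U r : H →L[ℂ] H) D (star (R.U r : H →L[ℂ] H)))
      (ModularTriple.sandwich (star ((z r)⁻¹ : (H →L[ℂ] H)ˣ).val) D ((z r)⁻¹ : (H →L[ℂ] H)ˣ).val))
    (p : G → 𝓜(ℂ, 𝔸)ˣ) (hp : ModularTriple.IsCentralCocycle 𝓢 A p)
    (hpz : ∀ r, ModularTriple.multiplierRep R.ρ (p r) = (z r : H →L[ℂ] H) * star (z r : H →L[ℂ] H))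
    (hp𝒜 : ∀ f ∈ 𝒜, (∃ g ∈ 𝒜, ∀ r, g r = (p r : 𝓜(ℂ, 𝔸)).fst (f r)) ∧
      ∃ g ∈ 𝒜, ∀ r, g r = ((p r)⁻¹ : 𝓜(ℂ, 𝔸)ˣ).val.fst (f r))
    -- the parameters and the control of domains
    (η ω : ℝ) (hω : ω ≠ 0)
    (hY : Dense (ModularTriple.domainY R μ D p ω : Set (Lp H 2 μ)))
    (hY𝒜 : ∃ Y ≤ ModularTriple.domainY R μ D p ω, Dense (Y : Set (Lp H 2 μ)) ∧
      ∀ f ∈ 𝒜, ∀ ξ ∈ Y, ModularTriple.regularRep μ R f ξ ∈ ModularTriple.domainY R μ D p ω)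
    -- the bound on `[D, ρ(f(r)) z(r)] z(r)⁻¹`
    (hcomm : ∀ f ∈ 𝒜, ∃ M : ℝ, ∀ r ∈ tsupport f, ∃ C : Submodule ℂ H, D.HasCore C ∧
      ∀ h ∈ C, ∃ u w : H, (h, u) ∈ D.graph ∧ (R.ρ (f r) ((z r : H →L[ℂ] H) h), w) ∈ D.graph ∧
        ‖w - R.ρ (f r) ((z r : H →L[ℂ] H) u)‖ ≤ M * ‖(z r : H →L[ℂ] H) h‖) :
    closure (ModularTriple.regularRep μ R '' (𝒜 : Set C_c(G, 𝔸))) =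
        ModularTriple.reducedCrossedProduct μ R ∧
    ∃ β : 𝒜 ≃ₗ[ℂ] 𝒜,
      (∀ (f : 𝒜) (r : G), (β f : C_c(G, 𝔸)) r = (p r : 𝓜(ℂ, 𝔸)).fst ((f : C_c(G, 𝔸)) r)) ∧
      ModularTriple.IsModularTwistedTriple
        (fun f g : 𝒜 => (⟨ModularTriple.conv μ 𝓢 f g, h𝒜.conv_mem f f.2 g g.2⟩ : 𝒜))
        (fun f : 𝒜 => (⟨ModularTriple.involution 𝓢 f, h𝒜.involution_mem f f.2⟩ : 𝒜))
        (ModularTriple.regularRep μ R.amp ∘ₗ 𝒜.subtype)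
        (ModularTriple.diracOp R μ D p η ω) β (ModularTriple.modularOp R μ p) ∧
      (ModularTriple.HasBoundedCommutator
          (ModularTriple.hatD R μ D) (ModularTriple.hatT R μ p η ω) →
        ∀ ε : ℝ, 0 < ε →
          ∫⁻ r, ENNReal.ofReal ((ModularTriple.modularFun r)⁻¹ *
            ‖ModularTriple.multiplierRep R.ρ (p r)‖ ^ 2 *
            ‖Ring.inverse (1 + ModularTriple.fiberT R p η ω r ^ 2)‖ ^ (1 + ε)) ∂μ < ∞ →
          ModularTriple.ModularCompactResolvent
            (ModularTriple.regularRep μ R.amp ∘ₗ 𝒜.subtype)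
            (ModularTriple.diracOp R μ D p η ω) (ModularTriple.modularOp R μ p)
            ((1 + ε) / 2)) := by
  have hP : ∀ r, IsSelfAdjoint (ModularTriple.multiplierRep R.ρ (p r)) := fun r =>
    ModularTriple.isSelfAdjoint_unit_mul_star (hpz r)
  have hdirac := ModularTriple.isSelfAdjoint_diracOp μ R hRn hp hP hD.selfAdjoint η ω
  have hmod := ModularTriple.isSelfAdjoint_modularOp μ R hRn hp hP
  have _ : Fact ((2 : ℝ≥0∞) ≠ ∞) := ⟨by simp⟩
  refine ⟨ModularTriple.closure_regularRep_image μ R h𝒜, ?_⟩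
  obtain ⟨β, hβ⟩ := ModularTriple.exists_twist hp𝒜
  refine ⟨β, hβ, ⟨?_, ?_, ?_, ?_, ?_, hdirac, ?_, ?_, ?_, hmod, ?_, ?_, ?_, ?_⟩, ?_⟩
  · infer_instance
  · exact fun f g => ModularTriple.regularRep_conv μ R.amp f g
  · exact fun f => ModularTriple.regularRep_involution μ R.amp f
  · exact (ModularTriple.regularRep_injective μ R.amp (R.amp_injective hRf)).comp
      Subtype.val_injective
  · exact ModularTriple.regularRep_nondegenerate μ R.amp (R.amp_nondegenerate hRn) h𝒜
  · intro f g
    ext r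
    rw [hβ]
    exact ModularTriple.conv_twist hA hp μ (hβ f) (hβ g) r
  · intro f
    ext r
    rw [hβ]
    refine ModularTriple.involution_twist hA hp (fun r => ?_) r
    rw [← hβ, LinearEquiv.apply_symm_apply]
  · intro f
    obtain ⟨T, hT⟩ := ModularTriple.exists_twisted_commutator μ R hD.selfAdjoint hRn hA hp hz hpz
      η ω (hβ f) (hcomm f f.2)
    exact ⟨T, fun x => hT _ _ (LinearPMap.mem_graph _ x)⟩
  · exact fun x => ModularTriple.modularOp_nonneg μ R hpz (LinearPMap.mem_graph _ x)
  · intro x hx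
    have h := LinearPMap.mem_graph _ x
    rw [hx] at h
    exact ModularTriple.modularOp_injective μ R hpz h
  · exact ModularTriple.dense_range_of_injective hmod fun x hx =>
      ModularTriple.modularOp_injective μ R hpz hx
  · intro f x
    refine ModularTriple.modularOp_implemented μ R hRn hA hp hP (hβ f) ?_
    have hker : LinearMap.ker (ModularTriple.modularOp R μ p).toFun = ⊥ := by
      rw [LinearMap.ker_eq_bot']
      intro y hy
      have h := LinearPMap.mem_graph _ y
      rw [show (ModularTriple.modularOp R μ p) y = 0 from hy] at h
      exact Subtype.ext (ModularTriple.modularOp_injective μ R hpz h)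
    -- the graph of `Θ⁻¹` is the flipped graph of `Θ`, so `(Θ⁻¹ x, x)` is in the graph of `Θ`
    have h := LinearPMap.mem_graph (ModularTriple.modularOp R μ p).inverse x
    rw [LinearPMap.inverse_graph hker] at h
    obtain ⟨q, hq, hq'⟩ := h
    have h1 : q = ((ModularTriple.modularOp R μ p).inverse x,
        (x : Lp (ModularTriple.Twofold H) 2 μ)) := by
      rw [← Prod.swap_swap q]
      exact congrArg Prod.swap hq'
    rw [← h1]
    exact hq
  · intro hB ε hε hint f
    -- `g = β⁻¹(f^*)`, so that the adjoint of `Θ π(f)` is `π(f^*) Θ = Θ π(g)`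
    refine ModularTriple.exists_compact_modular_resolvent μ R hRn hA hp hP hD η ω hB hε hint
      (g := (β.symm ⟨ModularTriple.involution 𝓢 f, h𝒜.involution_mem f f.2⟩ : 𝒜)) (fun r => ?_)
      fun r => h𝒜.apply_mem _ (Subtype.prop _) r
    rw [← hβ, LinearEquiv.apply_symm_apply]
    rfl
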